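/- Let $d\ge 2$, let $A$ be an invertible real $d\times d$ matrix, and let $\lambda_1\ge\lambda_2\ge\dots\ge\lambda_d>0$ be the eigenvalues of $A^{\top}A$, repeated according to multiplicity. Let $T$ be a positive random variable and let $W$ be uniformly distributed on the unit sphere of $\mathbb{R}^d$ and independent of $T$. Assume that there is a function $\psi_T$ with $\psi_T(x)/x\to0$ as $x\to\infty$ and $$\lim_{x\to\infty}\frac{\mathbb{P}(T>x+\psi_T(x)z)}{\mathbb{P}(T>x)}=e^{-z}$$ locally uniformly with respect to $z\in\mathbb{R}$. Let $\{X_i\}_{i\ge1}$ be i.i.d. random vectors with the same distribution as $X=TAW$, and write $\mathrm{diam}_2(n)=\max_{1\le i<j\le n}\|X_i-X_j\|$ for the Euclidean diameter of the first $n$ of them. Let $(a_n)$ be any sequence with $n\,\mathbb{P}(\|X\|>a_n)\to1$ (for instance the $1-1/n$ quantiles of $\|X\|$) and let $b_n=\sqrt{\lambda_1}\,\psi_T(a_n/\sqrt{\lambda_1})$. Assume that $\lambda_1>\lambda_2$. Let $\{(\Gamma_i^{+},G_{i,2}^{+},\dots,G_{i,d}^{+})\}_{i\ge1}$ and $\{(\Gamma_i^{-},G_{i,2}^{-},\dots,G_{i,d}^{-})\}_{i\ge1}$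 be the points of two independent Poisson point processes on $\mathbb{R}\times\mathbb{R}^{d-1}$, each with mean measure $\tfrac12 e^{-x}\,dx\,\Phi(dt_2)\cdots\Phi(dt_d)$, where $\Phi$ is the standard Gaussian law on $\mathbb{R}$; that is, the $\Gamma_i^{\pm}$ are the points of Poisson processes with mean measure $\tfrac12e^{-x}dx$, marked by i.i.d. standard Gaussian vectors. Let $$D=\max_{i,j\ge1}\Big\{\Gamma_i^{+}+\Gamma_j^{-}-\frac14\sum_{q=2}^{d}\frac{\lambda_q}{\lambda_1-\lambda_q}\big(G_{i,q}^{+}-G_{j,q}^{-}\big)^2\Big\}.$$ Then almost surely this maximum is finite and attained; $(\mathrm{diam}_2(n)-2a_n)/b_n$ converges weakly to $D$ as $n\to\infty$; the law of $D$ is not a Gumbel law (with any location $m\in\mathbb{R}$ and scale $\beta>0$, i.e. with distribution function $x\mapsto\exp(-e^{-(x-m)/\beta})$); and it is not the law of the sum of two independent Gumbel random variables (with any locations and scales), so that in particular it differs from the limit law of the one-dimensional case, which is that of the sum of two independent Gumbel variables with location $-\log 2$ and scale $1$. -/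

import Mathlib

open MeasureTheory ProbabilityTheory Filter Topology

noncomputable section

/-- The uniform probability distribution on the unit sphere of `ℝ^d`, as a measure on `ℝ^d`. -/
def uniformSphere (d : ℕ) : Measure (EuclideanSpace ℝ (Fin d)) :=
  (ProbabilityTheory.cond (volume : Measure (EuclideanSpace ℝ (Fin d))).toSphere Set.univ).map
    Subtype.val

/-- The eigenvalues `λ₁ ≥ ⋯ ≥ λ_d` of `Aᵀ A`, in decreasing order and repeated according to
multiplicity; the index `0` is that of the largest one. -/
def orderedEigenvalues {d : ℕ} (A : Matrix (Fin d) (Fin d) ℝ) (q : Fin d) : ℝ :=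
  (show (A.transpose * A).IsHermitian by
    simpa using Matrix.isHermitian_conjTranspose_mul_self A).eigenvalues₀
      (Fin.cast (Fintype.card_fin d).symm q)

/-- `ψ` is an auxiliary function of the random variable `T` in the max-domain of attraction of the
Gumbel law: `ψ(x)/x → 0` and `P(T > x + ψ(x) z) / P(T > x) → e^{-z}` as `x → ∞`, locally uniformly
in `z`. -/
def IsGumbelAuxiliary {Ω : Type*} [MeasurableSpace Ω] (P : Measure Ω) (T : Ω → ℝ)
    (ψ : ℝ → ℝ) : Prop :=
  Tendsto (fun x => ψ x / x) atTop (𝓝 0) ∧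
  TendstoLocallyUniformly
    (fun x z => P.real {ω | x + ψ x * z < T ω} / P.real {ω | x < T ω})
    (fun z => Real.exp (-z)) atTop

/-- The random vector `T A W`. -/
def ellipticalVector {Ω : Type*} {d : ℕ} (A : Matrix (Fin d) (Fin d) ℝ) (T : Ω → ℝ)
    (W : Ω → EuclideanSpace ℝ (Fin d)) (ω : Ω) : EuclideanSpace ℝ (Fin d) :=
  T ω • Matrix.toEuclideanLin A (W ω)

/-- The Euclidean diameter of the cloud formed by the first `n` vectors of the sequence `X`. -/
def cloudDiam {Ω : Type*} {d : ℕ} (X : ℕ → Ω → EuclideanSpace ℝ (Fin d)) (n : ℕ) (ω : Ω) : ℝ :=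
  Metric.diam ((fun i => X i ω) '' Set.Iio n)

/-- The random measure `N` is a Poisson point process with mean measure `Λ`. -/
structure IsPoissonProcess {Ω S : Type*} [MeasurableSpace Ω] [MeasurableSpace S]
    (P : Measure Ω) (Λ : Measure S) (N : Ω → Measure S) : Prop where
  measurable : Measurable N
  law : ∀ B : Set S, MeasurableSet B → Λ B < ⊤ →
    P.map (fun ω => N ω B) =
      (poissonMeasure (Λ B).toNNReal).map (fun k : ℕ => (k : ENNReal))
  indep : ∀ (m : ℕ) (B : Fin m → Set S), (∀ k, MeasurableSet (B k)) →
    Pairwise (fun k l => Disjoint (B k) (B l)) →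
    iIndepFun (fun k ω => N ω (B k)) P

/-- The measure `½ e^{-x} dx Φ(dt₂) ⋯ Φ(dt_d)` on `ℝ × ℝ^{d-1}`, where `d - 1 = p` and `Φ` is the
standard Gaussian law. -/
def markedIntensity (p : ℕ) : Measure (ℝ × (Fin p → ℝ)) :=
  ((volume : Measure ℝ).withDensity fun x => ENNReal.ofReal (Real.exp (-x) / 2)).prod
    (Measure.pi fun _ : Fin p => gaussianReal 0 1)

/-- The random point measure `∑ i, δ_{(Γ i, G i)}`. -/
def pointMeasure {Ω : Type*} {p : ℕ} (Γ : ℕ → Ω → ℝ) (G : ℕ → Ω → Fin p → ℝ) (ω : Ω) :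
    Measure (ℝ × (Fin p → ℝ)) :=
  Measure.sum fun i => Measure.dirac (Γ i ω, G i ω)

/-- `Γ⁺_i + Γ⁻_j - ¼ ∑_q λ_q / (λ₁ - λ_q) (G⁺_{i,q} - G⁻_{j,q})²`, where `q` runs over all the
indices but the first one and `ij = (i, j)`. -/
def pairValue {Ω : Type*} {p : ℕ} (lam : Fin (p + 1) → ℝ) (Γp Γm : ℕ → Ω → ℝ)
    (Gp Gm : ℕ → Ω → Fin p → ℝ) (ω : Ω) (ij : ℕ × ℕ) : ℝ :=
  Γp ij.1 ω + Γm ij.2 ω -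
    1 / 4 * ∑ q : Fin p,
      lam q.succ / (lam 0 - lam q.succ) * (Gp ij.1 ω q - Gm ij.2 ω q) ^ 2

/-- `ν` is a Gumbel law, with some location `m` and some scale `β > 0`. -/
def IsGumbelLaw (ν : Measure ℝ) : Prop :=
  IsProbabilityMeasure ν ∧ ∃ m β : ℝ, 0 < β ∧
    ∀ x, ν (Set.Iic x) = ENNReal.ofReal (Real.exp (-Real.exp (-((x - m) / β))))

end

set_option linter.unusedSectionVars false

/-! Take singular bases with `A v_q = √λ_q u_q` and describe a point by its norm and its projective
coordinates with respect to `u_0`, the direction of the largest singular value. Put `α = a_n / √λ₁`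
and `h² = ψ(α) / α`, so that `b_n = h² a_n`. If `W` has projective coordinates `h y`, then `‖TAW‖ >
a_n + b_n c` says that `T > α + ψ(α) (c + ½ ∑ (1 - λ_q/λ₁) y_q² + o(1))`. The Gumbel condition on
`T` turns this into `e^{-c}` times a Gaussian weight in `y`. Since `λ₁ > λ₂` that weight is
nondegenerate, and the extreme points concentrate near the two poles `±u_0`, with exponential radial
excesses and independent Gaussian transverse coordinates. This is `tendsto_cell_intensity`; the
exchange of limit and integral rests on the Potter-type bound behind `exists_domination`.

Two points near opposite poles, with norms `a (1 + h² u)`, `a (1 + h² u')` and projective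
coordinates `h ζ`, `h ζ'`, are at distance `2a + h² a (u + u' - ¼ |ζ - ζ'|² + o(1))`, uniformly on
bounded sets (`eventually_triangleDefect`). In terms of standard Gaussian marks, `ζ_q = √(λ_q / (λ₁
- λ_q)) g_q`. Two points near the same pole are at distance about `√2 a` at most and never compete.

Weak convergence (`tendstoInDistribution_pairs`) reduces to finitely many events. The quadratic term
only lowers the value of a pair, so outside an event of small probability only a bounded box of
coordinates matters. Once the box is cut into small cells, the maximum is nearly a function of the
set of occupied cells. The law of that set is determined by void probabilities, which for the sample
are powers `(1 - μ)^n` converging to the Poisson values.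

For the law of `D`, integrate out the minus process: `P(D ≤ x) = E exp(-e^{-x} Z)`, where `Z`
(`totalMass`) is the Gaussian integral of the supremum of one profile per point of the plus process.
The supremum `M` (`topMass`) of the separate integrals has an exact Fréchet law of scale `κ`, and `M
≤ Z`. Two large points at once are rare, so the tail of `Z` is at most `(κ + o(1)) / y`; the marks
are not all equal, so `M < Z` almost surely. The tail of `D` is thus of exact order `x e^{-x}`. This
excludes a Gumbel law, and also a sum of two unless both scales are one. Such a sum has the same
Laplace form with a Fréchet variable of some scale `κ'` in place of `Z`: `κ' ≤ κ` contradicts `M <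
Z`, and `κ' > κ` contradicts the tail bound on `Z` through the Laplace transforms near zero
(`ne_conv_of_laplaceTail`). -/

/-! ### The marked intensity and random point measures. -/

/-- The standard Gaussian law on `ℝ^p`. -/
noncomputable abbrev stdGauss (p : ℕ) : Measure (Fin p → ℝ) :=
  Measure.pi fun _ : Fin p => gaussianReal 0 1

/-- The measure `½ e^{-x} dx` on the line. -/
noncomputable abbrev halfExp : Measure ℝ :=
  (volume : Measure ℝ).withDensity fun x => ENNReal.ofReal (Real.exp (-x) / 2)

theorem halfExp_Ioi (c : ℝ) : halfExp (Set.Ioi c) = ENNReal.ofReal (Real.exp (-c) / 2) := by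
  rw [halfExp, withDensity_apply _ measurableSet_Ioi, ← ofReal_integral_eq_lintegral_ofReal]
  · rw [integral_div, integral_exp_neg_Ioi]
  · exact (integrableOn_exp_neg_Ioi c).div_const 2
  · exact Eventually.of_forall fun x => by positivity

theorem markedIntensity_Ioi_prod (p : ℕ) (c : ℝ) (B : Set (Fin p → ℝ)) :
    markedIntensity p (Set.Ioi c ×ˢ B) = ENNReal.ofReal (Real.exp (-c) / 2) * stdGauss p B := by
  rw [markedIntensity, Measure.prod_prod]
  congr 1
  exact halfExp_Ioi c

theorem markedIntensity_Ioi_prod_lt_top (p : ℕ) (c : ℝ) (B : Set (Fin p → ℝ)) :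
    markedIntensity p (Set.Ioi c ×ˢ B) < ⊤ := by
  rw [markedIntensity_Ioi_prod]
  exact ENNReal.mul_lt_top ENNReal.ofReal_lt_top (measure_lt_top _ _)

theorem pointMeasure_apply {Ω : Type*} {p : ℕ} (Γ : ℕ → Ω → ℝ) (G : ℕ → Ω → Fin p → ℝ) (ω : Ω)
    {B : Set (ℝ × (Fin p → ℝ))} (hB : MeasurableSet B) :
    pointMeasure Γ G ω B = ∑' i, B.indicator 1 (Γ i ω, G i ω) := by
  rw [pointMeasure, Measure.sum_apply _ hB]
  exact tsum_congr fun i => Measure.dirac_apply' _ hB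

theorem pointMeasure_eq_zero_iff {Ω : Type*} {p : ℕ} (Γ : ℕ → Ω → ℝ) (G : ℕ → Ω → Fin p → ℝ)
    (ω : Ω) {B : Set (ℝ × (Fin p → ℝ))} (hB : MeasurableSet B) :
    pointMeasure Γ G ω B = 0 ↔ ∀ i, (Γ i ω, G i ω) ∉ B := by
  rw [pointMeasure_apply Γ G ω hB, ENNReal.tsum_eq_zero]
  simp [Set.indicator_apply_eq_zero]

theorem finite_of_pointMeasure_lt_top {Ω : Type*} {p : ℕ} (Γ : ℕ → Ω → ℝ)
    (G : ℕ → Ω → Fin p → ℝ) (ω : Ω) {B : Set (ℝ × (Fin p → ℝ))} (hB : MeasurableSet B)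
    (h : pointMeasure Γ G ω B < ⊤) : {i | (Γ i ω, G i ω) ∈ B}.Finite := by
  rw [pointMeasure_apply Γ G ω hB] at h
  have h1 : ∑' i, (B.indicator 1 (Γ i ω, G i ω) : ENNReal)
      = ∑' i, ({i | (Γ i ω, G i ω) ∈ B}.indicator 1 i : ENNReal) := tsum_congr fun i => rfl
  rw [h1, ← tsum_subtype, show (fun i : {i | (Γ i ω, G i ω) ∈ B} => (1 : ℕ → ENNReal) i)
    = fun _ => 1 from rfl, ENNReal.tsum_set_one] at h
  exact Set.encard_lt_top_iff.1 (by simpa using h)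

/-! ### Void probabilities of Poisson processes. -/

section VoidProbability

variable {Ω S : Type*} [MeasurableSpace Ω] [MeasurableSpace S] {P : Measure Ω}
  {Λ : Measure S} {N : Ω → Measure S}

theorem IsPoissonProcess.measurable_apply (h : IsPoissonProcess P Λ N) {B : Set S}
    (hB : MeasurableSet B) : Measurable fun ω => N ω B :=
  (Measure.measurable_coe hB).comp h.measurable

/-- The void probabilities of a Poisson process. -/
theorem IsPoissonProcess.measure_eq_zero (h : IsPoissonProcess P Λ N) {B : Set S}
    (hB : MeasurableSet B) (hfin : Λ B < ⊤) :
    P {ω | N ω B = 0} = ENNReal.ofReal (Real.exp (-(Λ B).toReal)) := by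
  have h1 := congrArg (fun m => m {0}) (h.law B hB hfin)
  beta_reduce at h1
  rw [Measure.map_apply (h.measurable_apply hB) (measurableSet_singleton _),
    Measure.map_apply (by fun_prop) (measurableSet_singleton _)] at h1
  have h2 : (fun k : ℕ => (k : ENNReal)) ⁻¹' {0} = {0} := by ext k; simp
  rw [h2, poissonMeasure_singleton] at h1
  simpa using! h1

theorem IsPoissonProcess.ae_lt_top (h : IsPoissonProcess P Λ N) {B : Set S}
    (hB : MeasurableSet B) (hfin : Λ B < ⊤) : ∀ᵐ ω ∂P, N ω B < ⊤ := by
  have h1 := congrArg (fun m => m {⊤}) (h.law B hB hfin)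
  beta_reduce at h1
  rw [Measure.map_apply (h.measurable_apply hB) (measurableSet_singleton _),
    Measure.map_apply (by fun_prop) (measurableSet_singleton _)] at h1
  have h2 : (fun k : ℕ => (k : ENNReal)) ⁻¹' {⊤} = ∅ := by ext k; simp
  rw [h2, measure_empty] at h1
  rw [ae_iff]
  simpa [Set.preimage] using! h1

/-- Joint void probabilities of two independent Poisson processes. -/
theorem measure_eq_zero_and_eq_zero {N' : Ω → Measure S} (h : IsPoissonProcess P Λ N)
    (h' : IsPoissonProcess P Λ N') (hind : IndepFun N N' P) {B B' : Set S}
    (hB : MeasurableSet B) (hfin : Λ B < ⊤) (hB' : MeasurableSet B') (hfin' : Λ B' < ⊤) :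
    P {ω | N ω B = 0 ∧ N' ω B' = 0} =
      ENNReal.ofReal (Real.exp (-((Λ B).toReal + (Λ B').toReal))) := by
  have h1 := (hind.comp (Measure.measurable_coe hB)
    (Measure.measurable_coe hB')).measure_inter_preimage_eq_mul {0} {0}
    (measurableSet_singleton _) (measurableSet_singleton _)
  have h2 := h.measure_eq_zero hB hfin
  have h3 := h'.measure_eq_zero hB' hfin'
  rw [neg_add, Real.exp_add, ENNReal.ofReal_mul (Real.exp_nonneg _), ← h2, ← h3]
  exact h1

end VoidProbability

/-! ### The limiting variable: finiteness and attainment of the maximum. -/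

section Limit

variable {p : ℕ}

/-- Almost surely, only finitely many points of the process lie above a given level. -/
theorem ae_finite_above {Ω : Type*} [MeasurableSpace Ω] {P : Measure Ω}
    {Γ : ℕ → Ω → ℝ} {G : ℕ → Ω → Fin p → ℝ}
    (h : IsPoissonProcess P (markedIntensity p) (pointMeasure Γ G)) :
    ∀ᵐ ω ∂P, ∀ c : ℝ, {i | c < Γ i ω}.Finite := by
  have h1 : ∀ᵐ ω ∂P, ∀ k : ℕ, pointMeasure Γ G ω (Set.Ioi (-(k : ℝ)) ×ˢ Set.univ) < ⊤ :=
    ae_all_iff.2 fun k => h.ae_lt_top (measurableSet_Ioi.prod .univ)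
      (markedIntensity_Ioi_prod_lt_top p _ _)
  filter_upwards [h1] with ω hω c
  obtain ⟨k, hk⟩ := exists_nat_ge (-c)
  refine (finite_of_pointMeasure_lt_top Γ G ω (measurableSet_Ioi.prod .univ) (hω k)).subset ?_
  intro i hi
  simp only [Set.mem_ofPred_eq, Set.mem_prod, Set.mem_Ioi, Set.mem_univ, and_true] at hi ⊢
  linarith

/-- The weights `λ_q / (λ₁ - λ_q)`. -/
noncomputable def gapWeight (lam : Fin (p + 1) → ℝ) (q : Fin p) : ℝ :=
  lam q.succ / (lam 0 - lam q.succ)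

/-- The value of a pair of points, one of each process. -/
noncomputable def pairFun (w : Fin p → ℝ) (z z' : ℝ × (Fin p → ℝ)) : ℝ :=
  z.1 + z'.1 - 1 / 4 * ∑ q, w q * (z.2 q - z'.2 q) ^ 2

/-- The quadratic penalty can only lower the value. This crude bound carries every localisation
below: when both first coordinates are bounded above, a pair of large value has both of them bounded
below as well. -/
theorem pairFun_le {w : Fin p → ℝ} (hw : ∀ q, 0 ≤ w q) (z z' : ℝ × (Fin p → ℝ)) :
    pairFun w z z' ≤ z.1 + z'.1 := by
  have : 0 ≤ ∑ q, w q * (z.2 q - z'.2 q) ^ 2 :=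
    Finset.sum_nonneg fun q _ => mul_nonneg (hw q) (sq_nonneg _)
  unfold pairFun
  linarith

theorem continuous_pairFun (w : Fin p → ℝ) :
    Continuous fun zz : (ℝ × (Fin p → ℝ)) × (ℝ × (Fin p → ℝ)) => pairFun w zz.1 zz.2 := by
  unfold pairFun
  fun_prop

theorem measurable_iSup_pairFun {Ω : Type*} [MeasurableSpace Ω] {w : Fin p → ℝ} {Γp Γm : ℕ → Ω → ℝ} {Gp Gm : ℕ → Ω → Fin p → ℝ}
    (hΓp : ∀ i, Measurable (Γp i)) (hΓm : ∀ i, Measurable (Γm i))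
    (hGp : ∀ i, Measurable (Gp i)) (hGm : ∀ i, Measurable (Gm i)) :
    Measurable fun ω => ⨆ ij : ℕ × ℕ,
      pairFun w (Γp ij.1 ω, Gp ij.1 ω) (Γm ij.2 ω, Gm ij.2 ω) := by
  refine Measurable.iSup fun ij => ?_
  exact (continuous_pairFun w).measurable.comp
    (((hΓp _).prodMk (hGp _)).prodMk ((hΓm _).prodMk (hGm _)))

theorem isGreatest_iSup_of_finite_above {ι : Type*} [Nonempty ι] {f : ι → ℝ}
    (h : ∀ c, {i | c < f i}.Finite) : IsGreatest (Set.range f) (⨆ i, f i) := by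
  obtain ⟨i₀⟩ := ‹Nonempty ι›
  obtain ⟨m, hm, hmax⟩ : ∃ m, f i₀ ≤ f m ∧ ∀ i, f i ≤ f m := by
    by_cases hne : {i | f i₀ < f i}.Nonempty
    · obtain ⟨m, hm, hmax⟩ := (h (f i₀)).exists_maximalFor f _ hne
      refine ⟨m, hm.le, fun i => ?_⟩
      by_contra hlt
      exact hlt (hmax (show f i₀ < f i from hm.trans (not_le.1 hlt)) (not_le.1 hlt).le)
    · refine ⟨i₀, le_rfl, fun i => ?_⟩
      by_contra hlt
      exact hne ⟨i, not_le.1 hlt⟩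
  have hg : IsGreatest (Set.range f) (f m) := ⟨⟨m, rfl⟩, by rintro _ ⟨i, rfl⟩; exact hmax i⟩
  have : (⨆ i, f i) = f m := hg.csSup_eq
  rwa [this]

theorem bddAbove_range_of_finite_above {ι : Type*} [Nonempty ι] {f : ι → ℝ}
    (h : ∀ c, {i | c < f i}.Finite) : BddAbove (Set.range f) :=
  ⟨_, (isGreatest_iSup_of_finite_above h).2⟩

/-- Each family of first coordinates has an upper bound, `m` and `m'`. By `pairFun_le` a pair above
`c` has its coordinates above `c - m'` and `c - m`, which leaves finitely many indices on each side.
-/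
theorem finite_above_pair {w : Fin p → ℝ} (hw : ∀ q, 0 ≤ w q) {z z' : ℕ → ℝ × (Fin p → ℝ)}
    (h : ∀ c, {i | c < (z i).1}.Finite) (h' : ∀ c, {i | c < (z' i).1}.Finite) (c : ℝ) :
    {ij : ℕ × ℕ | c < pairFun w (z ij.1) (z' ij.2)}.Finite := by
  obtain ⟨m, hm⟩ := bddAbove_range_of_finite_above h
  obtain ⟨m', hm'⟩ := bddAbove_range_of_finite_above h'
  refine ((h (c - m')).prod (h' (c - m))).subset ?_
  rintro ⟨i, j⟩ hij
  have h1 := hm ⟨i, rfl⟩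
  have h2 := hm' ⟨j, rfl⟩
  have h3 := pairFun_le hw (z i) (z' j)
  simp only [Set.mem_ofPred_eq, Set.mem_prod] at hij h1 h2 ⊢
  constructor <;> linarith

/-- Almost surely, the supremum over all pairs is attained. -/
theorem ae_isGreatest_pairFun {Ω : Type*} [MeasurableSpace Ω] {P : Measure Ω} {w : Fin p → ℝ} (hw : ∀ q, 0 ≤ w q) {Γp Γm : ℕ → Ω → ℝ}
    {Gp Gm : ℕ → Ω → Fin p → ℝ}
    (hNp : IsPoissonProcess P (markedIntensity p) (pointMeasure Γp Gp))
    (hNm : IsPoissonProcess P (markedIntensity p) (pointMeasure Γm Gm)) :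
    ∀ᵐ ω ∂P, IsGreatest
      (Set.range fun ij : ℕ × ℕ => pairFun w (Γp ij.1 ω, Gp ij.1 ω) (Γm ij.2 ω, Gm ij.2 ω))
      (⨆ ij : ℕ × ℕ, pairFun w (Γp ij.1 ω, Gp ij.1 ω) (Γm ij.2 ω, Gm ij.2 ω)) := by
  filter_upwards [ae_finite_above hNp, ae_finite_above hNm] with ω h h'
  exact isGreatest_iSup_of_finite_above fun c =>
    finite_above_pair hw (z := fun i => (Γp i ω, Gp i ω)) (z' := fun i => (Γm i ω, Gm i ω)) h h' c

end Limit

/-! ### Laws of random subsets of a finite set. -/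

section FiniteLaws

variable {κ : Type*} [Fintype κ] [DecidableEq κ]

/-- The law of a random finite set is determined by, and depends continuously on, the
probabilities of being contained in the given sets. -/
theorem tendsto_of_tendsto_sum_powerset {q : ℕ → Finset κ → ℝ} {q' : Finset κ → ℝ}
    (h : ∀ J : Finset κ, Tendsto (fun n => ∑ I ∈ J.powerset, q n I) atTop
      (𝓝 (∑ I ∈ J.powerset, q' I))) (J : Finset κ) :
    Tendsto (fun n => q n J) atTop (𝓝 (q' J)) := by
  induction J using Finset.strongInduction with
  | H J ih =>
    -- Triangular inversion: the mass at `J` is the mass of all subsets less that of the strict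
    -- ones, and the latter converges by induction.
    have key : ∀ r : Finset κ → ℝ,
        r J = ∑ I ∈ J.powerset, r I - ∑ I ∈ J.ssubsets, r I := fun r => by
      rw [Finset.ssubsets, ← Finset.add_sum_erase _ r (Finset.mem_powerset_self J)]
      ring
    rw [key q']
    simp_rw [fun n => key (q n)]
    exact (h J).sub (tendsto_finsetSum _ fun I hI => ih I (Finset.mem_ssubsets.1 hI))

variable {Ω : Type*} [MeasurableSpace Ω] {P : Measure Ω} [IsProbabilityMeasure P]
  {O : Ω → Finset κ}

theorem measureReal_finset_mem_eq_sum (hO : ∀ J, MeasurableSet {ω | O ω = J})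
    (s : Finset (Finset κ)) :
    P.real {ω | O ω ∈ s} = ∑ I ∈ s, P.real {ω | O ω = I} := by
  have h1 : {ω | O ω ∈ s} = ⋃ I ∈ s, {ω | O ω = I} := by ext; simp
  rw [h1, measureReal_biUnion_finset ?_ fun I _ => hO I]
  intro I _ I' _ hne
  refine Set.disjoint_left.2 fun ω h h' => hne ?_
  exact (show O ω = I from h).symm.trans h'

theorem measureReal_finset_subset_eq_sum (hO : ∀ J, MeasurableSet {ω | O ω = J})
    (J : Finset κ) :
    P.real {ω | O ω ⊆ J} = ∑ I ∈ J.powerset, P.real {ω | O ω = I} := by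
  rw [← measureReal_finset_mem_eq_sum hO]
  simp

theorem measureReal_finset_notMem_eq_sum (hO : ∀ J, MeasurableSet {ω | O ω = J})
    (s : Finset (Finset κ)) :
    P.real {ω | O ω ∉ s} = ∑ I ∈ sᶜ, P.real {ω | O ω = I} := by
  rw [← measureReal_finset_mem_eq_sum hO]
  simp

theorem integrable_comp_finset (hO : ∀ J, MeasurableSet {ω | O ω = J}) (f : Finset κ → ℝ) :
    Integrable (fun ω => f (O ω)) P := by
  let _ : MeasurableSpace (Finset κ) := ⊤
  have hm : Measurable O := measurable_to_countable' fun J => hO J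
  refine Integrable.of_bound ((measurable_from_top (f := f)).comp hm).aestronglyMeasurable
    (∑ J, |f J|) (Eventually.of_forall fun ω => ?_)
  exact Finset.single_le_sum (f := fun J => |f J|) (fun J _ => abs_nonneg _) (Finset.mem_univ (O ω))

theorem integral_comp_finset (hO : ∀ J, MeasurableSet {ω | O ω = J}) (f : Finset κ → ℝ) :
    ∫ ω, f (O ω) ∂P = ∑ J, P.real {ω | O ω = J} * f J := by
  have h1 : ∀ ω, f (O ω) = ∑ J, ({ω | O ω = J}.indicator (fun _ => f J) ω) := fun ω => by
    rw [Finset.sum_eq_single (O ω)]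
    · simp
    · intro J _ hJ
      simp [hJ.symm]
    · simp
  simp_rw [h1]
  rw [integral_finsetSum _ fun J _ => (integrable_const (f J)).indicator (hO J)]
  refine Finset.sum_congr rfl fun J _ => ?_
  rw [integral_indicator (hO J)]
  simp

/-- For a Lipschitz test function of bounded oscillation, a good configuration costs the Lipschitz
constant times `ε`, and a bad one costs at most the oscillation `C`. -/
theorem abs_integral_sub_le_of_approx {D : Ω → ℝ} (hD : AEMeasurable D P) {f : ℝ → ℝ} {C : ℝ}
    {L : NNReal} (hC : ∀ x y, dist (f x) (f y) ≤ C) (hL : LipschitzWith L f)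
    (hO : ∀ J, MeasurableSet {ω | O ω = J}) (F : Finset κ → ℝ) (𝒢 : Finset (Finset κ)) {ε : ℝ}
    (hε : 0 ≤ ε) (h : ∀ᵐ ω ∂P, O ω ∈ 𝒢 → |D ω - F (O ω)| ≤ ε) :
    |∫ ω, f (D ω) ∂P - ∫ ω, f (F (O ω)) ∂P| ≤ L * ε + C * P.real {ω | O ω ∉ 𝒢} := by
  have hC0 : 0 ≤ C := dist_nonneg.trans (hC 0 0)
  have hms : MeasurableSet {ω | O ω ∉ 𝒢} := by
    have : {ω | O ω ∈ 𝒢} = ⋃ I ∈ 𝒢, {ω | O ω = I} := by ext; simp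
    have h2 : MeasurableSet {ω | O ω ∈ 𝒢} := by
      rw [this]; exact Finset.measurableSet_biUnion _ fun I _ => hO I
    exact h2.compl
  have hi1 : Integrable (fun ω => f (D ω)) P := by
    refine Integrable.of_bound (hL.continuous.measurable.comp_aemeasurable hD).aestronglyMeasurable
      (|f 0| + C) (Eventually.of_forall fun ω => ?_)
    have := hC (D ω) 0
    rw [Real.dist_eq] at this
    have h2 := abs_sub_abs_le_abs_sub (f (D ω)) (f 0)
    rw [Real.norm_eq_abs]
    linarith
  rw [← integral_sub hi1 (integrable_comp_finset hO fun J => f (F J))]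
  have hi2 : Integrable (fun ω => L * ε + {ω | O ω ∉ 𝒢}.indicator (fun _ => C) ω) P :=
    (integrable_const _).add ((integrable_const C).indicator hms)
  have h3 : ‖∫ ω, (f (D ω) - f (F (O ω))) ∂P‖ ≤
      ∫ ω, (L * ε + {ω | O ω ∉ 𝒢}.indicator (fun _ => C) ω) ∂P := by
    refine norm_integral_le_of_norm_le hi2 ?_
    filter_upwards [h] with ω hω
    by_cases hg : O ω ∈ 𝒢
    · have := hL.dist_le_mul (D ω) (F (O ω))
      rw [Real.dist_eq, Real.dist_eq] at this
      have h4 : (L : ℝ) * |D ω - F (O ω)| ≤ L * ε :=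
        mul_le_mul_of_nonneg_left (hω hg) L.2
      simp only [Set.indicator_apply, Set.mem_ofPred_eq, hg, not_true_eq_false, if_false, add_zero]
      exact this.trans h4
    · simp only [Set.indicator_apply, Set.mem_ofPred_eq, hg, not_false_eq_true, if_true]
      have h5 := hC (D ω) (F (O ω))
      rw [dist_eq_norm] at h5
      have : 0 ≤ (L : ℝ) * ε := mul_nonneg L.2 hε
      linarith
  refine h3.trans (le_of_eq ?_)
  rw [integral_add (integrable_const _) ((integrable_const C).indicator hms),
    integral_indicator hms]
  simp [mul_comm]

end FiniteLaws

/-! ### Weak convergence from approximation by finite configurations. -/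

/-- Convergence in distribution of random variables that are approximated, on events of large
probability, by functions of random subsets of a finite set whose laws converge. -/
theorem tendstoInDistribution_of_finite_approx {Ω Ω' : Type*} [MeasurableSpace Ω]
    [MeasurableSpace Ω'] {P : Measure Ω} {P' : Measure Ω'} [IsProbabilityMeasure P]
    [IsProbabilityMeasure P'] {D : ℕ → Ω → ℝ} {D' : Ω' → ℝ} (hD : ∀ n, AEMeasurable (D n) P)
    (hD' : AEMeasurable D' P')
    (h : ∀ ε : ℝ, 0 < ε → ∃ (κ : Type) (_ : Fintype κ) (_ : DecidableEq κ)
      (O : ℕ → Ω → Finset κ) (O' : Ω' → Finset κ) (F : Finset κ → ℝ) (𝒢 : Finset (Finset κ)),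
      (∀ n J, MeasurableSet {ω | O n ω = J}) ∧ (∀ J, MeasurableSet {ω | O' ω = J}) ∧
      (∀ J, Tendsto (fun n => P.real {ω | O n ω ⊆ J}) atTop (𝓝 (P'.real {ω | O' ω ⊆ J}))) ∧
      (∀ᶠ n in atTop, ∀ᵐ ω ∂P, O n ω ∈ 𝒢 → |D n ω - F (O n ω)| ≤ ε) ∧
      (∀ᵐ ω ∂P', O' ω ∈ 𝒢 → |D' ω - F (O' ω)| ≤ ε) ∧
      P'.real {ω | O' ω ∉ 𝒢} ≤ ε) :
    TendstoInDistribution D atTop D' (fun _ => P) P' where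
  forall_aemeasurable := hD
  aemeasurable_limit := hD'
  tendsto := by
    refine tendsto_iff_forall_lipschitz_integral_tendsto.2 ?_
    rintro f ⟨C, hC⟩ ⟨L, hL⟩
    have hC0 : 0 ≤ C := dist_nonneg.trans (hC 0 0)
    have hmap : ∀ n, ∫ x, f x ∂(P.map (D n)) = ∫ ω, f (D n ω) ∂P := fun n =>
      integral_map (hD n) hL.continuous.aestronglyMeasurable
    have hmap' : ∫ x, f x ∂(P'.map D') = ∫ ω, f (D' ω) ∂P' :=
      integral_map hD' hL.continuous.aestronglyMeasurable
    simp only [ProbabilityMeasure.coe_mk]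
    simp_rw [hmap]
    rw [hmap', Metric.tendsto_atTop']
    intro η hη
    -- The costs `L ε` and `C ε` occur once for the sample and once for the limit. The other two
    -- thirds of `η` pay for the convergence of the integrals and of the bad probabilities.
    obtain ⟨ε, hε, hεη⟩ : ∃ ε : ℝ, 0 < ε ∧ 2 * (L * ε) + 2 * (C * ε) < η / 3 := by
      refine ⟨η / (12 * (L + C + 1)), by positivity, ?_⟩
      have h1 : (0 : ℝ) < L + C + 1 := by positivity
      have h2 : (L + C) * (η / (12 * (L + C + 1))) ≤ η / 12 := by
        rw [mul_div_assoc', div_le_div_iff₀ (by positivity) (by norm_num)]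
        nlinarith
      nlinarith
    obtain ⟨κ, _, _, O, O', F, 𝒢, hO, hO', hconv, hn, hlim, hbad⟩ := h ε hε
    have hpt : ∀ J, Tendsto (fun n => P.real {ω | O n ω = J}) atTop
        (𝓝 (P'.real {ω | O' ω = J})) := by
      refine tendsto_of_tendsto_sum_powerset fun J => ?_
      have := hconv J
      rw [measureReal_finset_subset_eq_sum hO'] at this
      exact this.congr fun n => measureReal_finset_subset_eq_sum (hO n) J
    have hint : Tendsto (fun n => ∫ ω, f (F (O n ω)) ∂P) atTop (𝓝 (∫ ω, f (F (O' ω)) ∂P')) := by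
      rw [integral_comp_finset hO' fun J => f (F J)]
      simp_rw [fun n => integral_comp_finset (P := P) (hO n) fun J => f (F J)]
      exact tendsto_finsetSum _ fun J _ => (hpt J).mul_const _
    -- Bad configurations are assumed rare only in the limit; convergence of the finite laws
    -- transfers this to large `n`.
    have hbadn : Tendsto (fun n => P.real {ω | O n ω ∉ 𝒢}) atTop
        (𝓝 (P'.real {ω | O' ω ∉ 𝒢})) := by
      rw [measureReal_finset_notMem_eq_sum hO']
      simp_rw [fun n => measureReal_finset_notMem_eq_sum (P := P) (hO n)]
      exact tendsto_finsetSum _ fun J _ => hpt J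
    have e2 : ∀ᶠ n in atTop, |∫ ω, f (F (O n ω)) ∂P - ∫ ω, f (F (O' ω)) ∂P'| < η / 3 := by
      have := (Metric.tendsto_nhds.1 hint) (η / 3) (by positivity)
      simpa [Real.dist_eq] using this
    have e3 : ∀ᶠ n in atTop, C * P.real {ω | O n ω ∉ 𝒢} < C * ε + η / 3 := by
      refine (hbadn.const_mul C).eventually_lt_const ?_
      have := mul_le_mul_of_nonneg_left hbad hC0
      linarith
    obtain ⟨n₀, hn₀⟩ := eventually_atTop.1 (hn.and (e2.and e3))
    refine ⟨n₀, fun n hnn => ?_⟩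
    obtain ⟨h1, h2, h3⟩ := hn₀ n hnn.le
    have h4 := abs_integral_sub_le_of_approx (hD n) hC hL (hO n) F 𝒢 hε.le h1
    have h5 := abs_integral_sub_le_of_approx hD' hC hL hO' F 𝒢 hε.le hlim
    have h6 := mul_le_mul_of_nonneg_left hbad hC0
    rw [Real.dist_eq]
    rw [abs_le] at h4 h5
    rw [abs_lt] at h2 ⊢
    constructor <;> linarith [h4.1, h4.2, h5.1, h5.2, h2.1, h2.2]

/-! ### Occupied cells, for the sample and for the Poisson processes. -/

section Occupancy

open Classical in
/-- The set of the cells that are hit by the points `x i`, `i ∈ s`. -/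
noncomputable def occupied {κ ι E : Type*} [Fintype κ] (C : κ → Set E) (s : Set ι) (x : ι → E) :
    Finset κ := Finset.univ.filter fun k => ∃ i ∈ s, x i ∈ C k

theorem mem_occupied {κ ι E : Type*} [Fintype κ] {C : κ → Set E} {s : Set ι} {x : ι → E} {k : κ} :
    k ∈ occupied C s x ↔ ∃ i ∈ s, x i ∈ C k := by
  simp [occupied]

theorem occupied_subset_iff {κ ι E : Type*} [Fintype κ] {C : κ → Set E} {s : Set ι} {x : ι → E}
    {J : Finset κ} : occupied C s x ⊆ J ↔ ∀ i ∈ s, x i ∉ ⋃ k ∈ (J : Set κ)ᶜ, C k := by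
  constructor
  · intro h i hi hx
    simp only [Set.mem_iUnion] at hx
    obtain ⟨k, hk, hx⟩ := hx
    exact hk (h (mem_occupied.2 ⟨i, hi, hx⟩))
  · intro h k hk
    obtain ⟨i, hi, hx⟩ := mem_occupied.1 hk
    by_contra hkJ
    exact h i hi (Set.mem_biUnion (by simpa using hkJ) hx)

theorem measurableSet_finset_eq {κ Ω : Type*} [MeasurableSpace Ω] [Fintype κ]
    {O : Ω → Finset κ} (h : ∀ k, MeasurableSet {ω | k ∈ O ω}) (J : Finset κ) :
    MeasurableSet {ω | O ω = J} := by
  have : {ω | O ω = J} = ⋂ k, {ω | k ∈ O ω ↔ k ∈ J} := by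
    ext ω; simp [Finset.ext_iff]
  rw [this]
  exact MeasurableSet.iInter fun k => (h k).iff (MeasurableSet.const _)

/-- Containment in `J` means that `n` independent points all miss the union `U n` of the other
cells. Its probability is `(1 - μ(U n))^n`, and `n μ(U n)` tends to the sum of the `ℓ k` over these
cells, so the limit is a Poisson void probability. -/
theorem tendsto_measureReal_occupied_subset {Ω E κ : Type*} [MeasurableSpace Ω]
    [MeasurableSpace E] [Fintype κ] [DecidableEq κ] {P : Measure Ω} [IsProbabilityMeasure P]
    {μ : Measure E} [IsProbabilityMeasure μ]
    {X : ℕ → Ω → E} (hX : ∀ i, Measurable (X i)) (hind : iIndepFun X P)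
    (hlaw : ∀ i, P.map (X i) = μ) {C : ℕ → κ → Set E} (hC : ∀ n k, MeasurableSet (C n k))
    (hdisj : ∀ n, Pairwise fun k l => Disjoint (C n k) (C n l)) {ℓ : κ → ℝ}
    (hℓ : ∀ k, Tendsto (fun n : ℕ => (n : ℝ) * μ.real (C n k)) atTop (𝓝 (ℓ k)))
    (J : Finset κ) :
    Tendsto (fun n => P.real {ω | occupied (C n) (Set.Iio n) (fun i => X i ω) ⊆ J}) atTop
      (𝓝 (Real.exp (-∑ k ∈ Jᶜ, ℓ k))) := by
  set U : ℕ → Set E := fun n => ⋃ k ∈ (J : Set κ)ᶜ, C n k with hU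
  have hUm : ∀ n, MeasurableSet (U n) := fun n =>
    MeasurableSet.biUnion (Set.to_countable _) fun k _ => hC n k
  have hUr : ∀ n, μ.real (U n) = ∑ k ∈ Jᶜ, μ.real (C n k) := fun n => by
    have : U n = ⋃ k ∈ Jᶜ, C n k := by simp [hU]
    rw [this, measureReal_biUnion_finset (fun k _ l _ hkl => hdisj n hkl) fun k _ => hC n k]
  have hp : ∀ n, P.real {ω | occupied (C n) (Set.Iio n) (fun i => X i ω) ⊆ J}
      = (1 + -μ.real (U n)) ^ n := fun n => by
    have h1 : {ω | occupied (C n) (Set.Iio n) (fun i => X i ω) ⊆ J}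
        = ⋂ i ∈ Finset.range n, X i ⁻¹' (U n)ᶜ := by
      ext ω
      rw [Set.mem_ofPred_eq, occupied_subset_iff]
      simp [hU]
    rw [h1, measureReal_def, hind.measure_inter_preimage_eq_mul _ fun i _ => (hUm n).compl]
    have h2 : ∀ i, P (X i ⁻¹' (U n)ᶜ) = μ (U n)ᶜ := fun i => by
      rw [← hlaw i, Measure.map_apply (hX i) (hUm n).compl]
    simp_rw [h2]
    rw [Finset.prod_const, Finset.card_range, ENNReal.toReal_pow, ← measureReal_def,
      probReal_compl_eq_one_sub (hUm n), sub_eq_add_neg]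
  simp_rw [hp]
  refine Real.tendsto_one_add_pow_exp_of_tendsto ?_
  have h3 := (tendsto_finsetSum Jᶜ fun k _ => hℓ k).neg
  refine h3.congr fun n => ?_
  rw [hUr, ← Finset.mul_sum]
  ring

theorem measurableSet_mem_occupied {Ω E κ ι : Type*} [MeasurableSpace Ω] [Countable ι]
    [MeasurableSpace E] [Fintype κ] {X : ι → Ω → E} (hX : ∀ i, Measurable (X i)) {C : κ → Set E}
    (hC : ∀ k, MeasurableSet (C k)) (s : Set ι) (k : κ) :
    MeasurableSet {ω | k ∈ occupied C s fun i => X i ω} := by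
  simp_rw [mem_occupied]
  have : {ω | ∃ i ∈ s, X i ω ∈ C k} = ⋃ i ∈ s, X i ⁻¹' C k := by ext; simp
  rw [this]
  exact MeasurableSet.biUnion (Set.to_countable _) fun i _ => hX i (hC k)

open Classical in
/-- The cells that are hit by two families of points, indexed by the family and the cell. -/
noncomputable def occupiedPair {κ E : Type*} [Fintype κ] (C : κ → Set E) (z z' : ℕ → E) :
    Finset (Bool × κ) :=
  Finset.univ.filter fun sk => ∃ i, (bif sk.1 then z else z') i ∈ C sk.2

theorem mem_occupiedPair {κ E : Type*} [Fintype κ] {C : κ → Set E} {z z' : ℕ → E} {s : Bool}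
    {k : κ} : (s, k) ∈ occupiedPair C z z' ↔ ∃ i, (bif s then z else z') i ∈ C k := by
  simp [occupiedPair]

/-- The Poisson counterpart of the sample limit. Splitting the forbidden cells by their label
(`true` for the plus process, `false` for the minus process) gives a joint void event of two
independent processes. -/
theorem measureReal_occupiedPair_subset {Ω κ : Type*} {p : ℕ} [MeasurableSpace Ω] [Fintype κ]
    [DecidableEq κ] {P : Measure Ω} {Γp Γm : ℕ → Ω → ℝ} {Gp Gm : ℕ → Ω → Fin p → ℝ}
    (hNp : IsPoissonProcess P (markedIntensity p) (pointMeasure Γp Gp))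
    (hNm : IsPoissonProcess P (markedIntensity p) (pointMeasure Γm Gm))
    (hN : IndepFun (pointMeasure Γp Gp) (pointMeasure Γm Gm) P)
    {C : κ → Set (ℝ × (Fin p → ℝ))} (hC : ∀ k, MeasurableSet (C k))
    (hdisj : Pairwise fun k l => Disjoint (C k) (C l))
    (hfin : ∀ k, markedIntensity p (C k) < ⊤) (J : Finset (Bool × κ)) :
    P.real {ω | occupiedPair C (fun i => (Γp i ω, Gp i ω)) (fun i => (Γm i ω, Gm i ω)) ⊆ J}
      = Real.exp (-∑ sk ∈ Jᶜ, (markedIntensity p (C sk.2)).toReal) := by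
  set K : Bool → Finset κ := fun s => Finset.univ.filter fun k => (s, k) ∉ J with hK
  set U : Bool → Set (ℝ × (Fin p → ℝ)) := fun s => ⋃ k ∈ K s, C k with hU
  have hUm : ∀ s, MeasurableSet (U s) := fun s => Finset.measurableSet_biUnion _ fun k _ => hC k
  have hUr : ∀ s, markedIntensity p (U s) = ∑ k ∈ K s, markedIntensity p (C k) := fun s =>
    measure_biUnion_finset (fun k _ l _ hkl => hdisj hkl) fun k _ => hC k
  have hUf : ∀ s, markedIntensity p (U s) < ⊤ := fun s => by
    rw [hUr]; exact ENNReal.sum_lt_top.2 fun k _ => hfin k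
  have h1 : {ω | occupiedPair C (fun i => (Γp i ω, Gp i ω)) (fun i => (Γm i ω, Gm i ω)) ⊆ J}
      = {ω | pointMeasure Γp Gp ω (U true) = 0 ∧ pointMeasure Γm Gm ω (U false) = 0} := by
    ext ω
    simp only [Set.mem_ofPred_eq, pointMeasure_eq_zero_iff _ _ _ (hUm _)]
    constructor
    · intro h
      constructor <;> intro i hi <;> simp only [hU, hK, Set.mem_iUnion] at hi <;>
        obtain ⟨k, hk, hi⟩ := hi
      · exact (Finset.mem_filter.1 hk).2 (h (mem_occupiedPair.2 ⟨i, hi⟩))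
      · exact (Finset.mem_filter.1 hk).2 (h (mem_occupiedPair.2 ⟨i, hi⟩))
    · rintro ⟨h, h'⟩ ⟨s, k⟩ hsk
      obtain ⟨i, hi⟩ := mem_occupiedPair.1 hsk
      by_contra hkJ
      have hkK : k ∈ K s := by simp [hK, hkJ]
      cases s
      · exact h' i (Set.mem_biUnion hkK hi)
      · exact h i (Set.mem_biUnion hkK hi)
  have h2 : ∑ sk ∈ Jᶜ, (markedIntensity p (C sk.2)).toReal =
      (markedIntensity p (U true)).toReal + (markedIntensity p (U false)).toReal := by
    rw [hUr, hUr, ENNReal.toReal_sum fun k _ => (hfin k).ne,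
      ENNReal.toReal_sum fun k _ => (hfin k).ne]
    have : Jᶜ = Finset.univ.filter fun sk : Bool × κ => sk ∉ J := by ext; simp
    rw [this, Finset.sum_filter, Fintype.sum_prod_type]
    simp [hK, Finset.sum_filter]
  rw [h1, measureReal_def, measure_eq_zero_and_eq_zero hNp hNm hN (hUm _) (hUf _) (hUm _) (hUf _),
    ENNReal.toReal_ofReal (Real.exp_nonneg _), h2]

end Occupancy

/-! ### Fine finite partitions. -/

theorem TotallyBounded.exists_finite_measurable_partition {α : Type*} [PseudoMetricSpace α]
    [MeasurableSpace α] [OpensMeasurableSpace α] {K : Set α} (hK : TotallyBounded K)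
    (hKm : MeasurableSet K) {δ : ℝ} (hδ : 0 < δ) :
    ∃ (N : ℕ) (E : Fin N → Set α), (∀ k, MeasurableSet (E k)) ∧
      Pairwise (fun k l => Disjoint (E k) (E l)) ∧ (⋃ k, E k) = K ∧
      ∀ k, ∀ x ∈ E k, ∀ y ∈ E k, dist x y < δ := by
  obtain ⟨t, htf, ht⟩ := Metric.totallyBounded_iff.1 hK (δ / 2) (by positivity)
  obtain ⟨N, e, he⟩ := htf.fin_embedding
  set f : Fin N → Set α := fun k => K ∩ Metric.ball (e k) (δ / 2) with hf
  refine ⟨N, disjointed f, fun k => ?_, disjoint_disjointed f, ?_, fun k x hx y hy => ?_⟩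
  · exact disjointedRec (p := fun s => MeasurableSet s)
      (fun _ i hs => hs.diff (hKm.inter Metric.isOpen_ball.measurableSet))
      (hKm.inter Metric.isOpen_ball.measurableSet)
  · rw [show (⋃ k, disjointed f k) = ⋃ k, f k from iSup_disjointed f, hf, ← Set.inter_iUnion]
    refine Set.inter_eq_left.2 (ht.trans ?_)
    intro x hx
    simp only [Set.mem_iUnion] at hx ⊢
    obtain ⟨y, hy, hxy⟩ := hx
    rw [← he] at hy
    obtain ⟨k, rfl⟩ := hy
    exact ⟨k, hxy⟩
  · have hx' := (disjointed_subset f k hx).2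
    have hy' := (disjointed_subset f k hy).2
    rw [Metric.mem_ball] at hx' hy'
    have := dist_triangle_right x y (e k)
    linarith

theorem exists_monotone_subdivision {a b δ : ℝ} (hab : a ≤ b) (hδ : 0 < δ) :
    ∃ (m : ℕ) (c : ℕ → ℝ), Monotone c ∧ c 0 = a ∧ c m = b ∧ ∀ i, c (i + 1) - c i < δ := by
  obtain ⟨m, hm⟩ := exists_nat_gt ((b - a) / δ)
  have hm0 : (0 : ℝ) < m := lt_of_le_of_lt (div_nonneg (by linarith) hδ.le) hm
  refine ⟨m, fun i => a + i * ((b - a) / m), ?_, by simp, ?_, fun i => ?_⟩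
  · intro i j hij
    have : (i : ℝ) ≤ j := by exact_mod_cast hij
    have h2 : 0 ≤ (b - a) / m := div_nonneg (by linarith) hm0.le
    have := mul_le_mul_of_nonneg_right this h2
    simpa using this
  · field_simp
    ring
  · push_cast
    rw [div_lt_iff₀ hδ] at hm
    have : (b - a) / m < δ := by rw [div_lt_iff₀ hm0]; linarith
    linarith

/-! ### Product cells and their limiting intensities. -/

section Cells

variable {p : ℕ}

/-- Cells of the first coordinate: a subdivision of a bounded interval and the half-line above. -/
def levelCell (c : ℕ → ℝ) (m : ℕ) : Option (Fin m) → Set ℝ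
  | none => Set.Ioi (c m)
  | some j => Set.Ioc (c j) (c (j + 1))

/-- Cells of the marks: a family of sets and the complement of their union. -/
def markCell {N : ℕ} {α : Type*} (E : Fin N → Set α) : Option (Fin N) → Set α
  | none => (⋃ k, E k)ᶜ
  | some k => E k

theorem pairwise_disjoint_levelCell {c : ℕ → ℝ} (hc : Monotone c) (m : ℕ) :
    Pairwise fun k l => Disjoint (levelCell c m k) (levelCell c m l) := by
  have h1 : ∀ j : Fin m, Disjoint (levelCell c m none) (levelCell c m (some j)) := fun j => by
    refine Set.disjoint_left.2 fun x hx hx' => ?_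
    have h2 : c (j + 1) ≤ c m := hc j.2
    exact absurd (hx'.2.trans h2) (not_le.2 hx)
  rintro (_ | j) (_ | k) hjk
  · exact absurd rfl hjk
  · exact h1 k
  · exact (h1 j).symm
  · have := hc.pairwise_disjoint_on_Ioc_succ
    exact this fun h => hjk (congrArg some (Fin.ext h))

theorem pairwise_disjoint_markCell {N : ℕ} {α : Type*} {E : Fin N → Set α}
    (hE : Pairwise fun k l => Disjoint (E k) (E l)) :
    Pairwise fun k l => Disjoint (markCell E k) (markCell E l) := by
  have h1 : ∀ j, Disjoint (markCell E none) (markCell E (some j)) := fun j =>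
    Set.disjoint_left.2 fun x hx hx' => hx (Set.mem_iUnion_of_mem j hx')
  rintro (_ | j) (_ | k) hjk
  · exact absurd rfl hjk
  · exact h1 k
  · exact (h1 j).symm
  · exact hE fun h => hjk (congrArg some h)

theorem exists_mem_levelCell {c : ℕ → ℝ} {m : ℕ} {x : ℝ} (hx : c 0 < x) :
    ∃ j, x ∈ levelCell c m j := by
  by_cases h : c m < x
  · exact ⟨none, h⟩
  · have hex : ∃ i, x ≤ c i := ⟨m, not_lt.1 h⟩
    classical
    have h1 := Nat.find_spec hex
    have h0 : Nat.find hex ≠ 0 := fun h0 => by rw [h0] at h1; exact absurd h1 (not_le.2 hx)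
    obtain ⟨i, hi⟩ := Nat.exists_eq_succ_of_ne_zero h0
    have him : i < m := by
      have := Nat.find_min' hex (not_lt.1 h)
      omega
    refine ⟨some ⟨i, him⟩, ?_, ?_⟩
    · have := Nat.find_min hex (m := i) (by omega)
      simpa using this
    · rw [hi] at h1; exact h1

theorem exists_mem_markCell {N : ℕ} {α : Type*} (E : Fin N → Set α) (x : α) :
    ∃ k, x ∈ markCell E k := by
  by_cases h : x ∈ ⋃ k, E k
  · obtain ⟨k, hk⟩ := Set.mem_iUnion.1 h
    exact ⟨some k, hk⟩
  · exact ⟨none, h⟩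

/-- Product cells. -/
def prodCell {m N : ℕ} (c : ℕ → ℝ) (E : Fin N → Set (Fin p → ℝ))
    (k : Option (Fin m) × Option (Fin N)) : Set (ℝ × (Fin p → ℝ)) :=
  levelCell c m k.1 ×ˢ markCell E k.2

theorem pairwise_disjoint_prodCell {m N : ℕ} {c : ℕ → ℝ} (hc : Monotone c)
    {E : Fin N → Set (Fin p → ℝ)} (hE : Pairwise fun k l => Disjoint (E k) (E l)) :
    Pairwise fun k l => Disjoint (prodCell (m := m) c E k) (prodCell c E l) := by
  rintro ⟨j, k⟩ ⟨j', k'⟩ hne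
  rw [prodCell, prodCell, Set.disjoint_prod]
  by_cases hj : j = j'
  · exact Or.inr (pairwise_disjoint_markCell hE fun h => hne (by rw [hj]; exact congrArg _ h))
  · exact Or.inl (pairwise_disjoint_levelCell hc m hj)

theorem measurableSet_levelCell (c : ℕ → ℝ) (m : ℕ) (j : Option (Fin m)) :
    MeasurableSet (levelCell c m j) := by
  cases j
  · exact measurableSet_Ioi
  · exact measurableSet_Ioc

theorem measurableSet_markCell {N : ℕ} {E : Fin N → Set (Fin p → ℝ)}
    (hE : ∀ k, MeasurableSet (E k)) (k : Option (Fin N)) : MeasurableSet (markCell E k) := by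
  cases k
  · exact (MeasurableSet.iUnion hE).compl
  · exact hE _

theorem levelCell_subset {c : ℕ → ℝ} (hc : Monotone c) (m : ℕ) (j : Option (Fin m)) :
    levelCell c m j ⊆ Set.Ioi (c 0) := by
  cases j with
  | none => exact fun x hx => lt_of_le_of_lt (hc (Nat.zero_le m)) hx
  | some j => exact fun x hx => lt_of_le_of_lt (hc (Nat.zero_le _)) hx.1

/-- Convergence on half-lines is enough: a bounded level cell is the difference of two nested
half-lines of finite intensity. -/
theorem tendsto_measureReal_levelCell {E : Type*} [MeasurableSpace E] {μ : Measure E}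
    [IsProbabilityMeasure μ] {S : Set E} (hS : MeasurableSet S) {u : ℕ → E → ℝ}
    {g : ℕ → E → Fin p → ℝ} (hu : ∀ n, Measurable (u n)) (hg : ∀ n, Measurable (g n))
    (h : ∀ (c : ℝ) (B : Set (Fin p → ℝ)), MeasurableSet B →
      Tendsto (fun n : ℕ => (n : ℝ) * μ.real (S ∩ {x | c < u n x} ∩ {x | g n x ∈ B})) atTop
        (𝓝 (Real.exp (-c) / 2 * (stdGauss p).real B)))
    {c : ℕ → ℝ} (hc : Monotone c) (m : ℕ) (j : Option (Fin m)) {B : Set (Fin p → ℝ)}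
    (hB : MeasurableSet B) :
    Tendsto (fun n : ℕ => (n : ℝ) * μ.real (S ∩ {x | u n x ∈ levelCell c m j} ∩ {x | g n x ∈ B}))
      atTop (𝓝 ((markedIntensity p (levelCell c m j ×ˢ B)).toReal)) := by
  have hΛ : ∀ t, (markedIntensity p (Set.Ioi t ×ˢ B)).toReal
      = Real.exp (-t) / 2 * (stdGauss p).real B := fun t => by
    rw [markedIntensity_Ioi_prod, ENNReal.toReal_mul, ENNReal.toReal_ofReal (by positivity)]
    rfl
  cases j with
  | none =>
    simp only [levelCell]
    rw [hΛ]
    exact h _ _ hB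
  | some j =>
    have hle : c j ≤ c (j + 1) := hc (Nat.le_succ _)
    simp only [levelCell]
    have h1 : (markedIntensity p (Set.Ioc (c j) (c (j + 1)) ×ˢ B)).toReal
        = Real.exp (-c j) / 2 * (stdGauss p).real B
          - Real.exp (-c (j + 1)) / 2 * (stdGauss p).real B := by
      have hset : Set.Ioc (c j) (c (j + 1)) ×ˢ B
          = Set.Ioi (c j) ×ˢ B \ Set.Ioi (c (j + 1)) ×ˢ B := by
        rw [Set.prod_sdiff_prod]
        simp
      rw [← hΛ, ← hΛ, hset]
      exact measureReal_sdiff (Set.prod_mono (Set.Ioi_subset_Ioi hle) subset_rfl)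
        (measurableSet_Ioi.prod hB) (markedIntensity_Ioi_prod_lt_top p _ _).ne
    rw [h1]
    refine ((h (c j) B hB).sub (h (c (j + 1)) B hB)).congr fun n => ?_
    rw [← mul_sub, ← measureReal_sdiff]
    · congr 2
      ext x
      simp only [Set.mem_sdiff, Set.mem_inter_iff, Set.mem_ofPred_eq, Set.mem_Ioc]
      grind
    · intro x hx
      exact ⟨⟨hx.1.1, lt_of_le_of_lt hle hx.1.2⟩, hx.2⟩
    · exact (hS.inter (hu n measurableSet_Ioi)).inter (hg n hB)

end Cells

/-! ### Comparison of maxima, and tightness. -/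

/-- Approximation of `V` by `A` is demanded only above `-M - 1`, since small values cannot influence
the maximum. The witness `a₀ > -M`, together with `ε ≤ 1`, places the maximum of `V` above that
level. -/
theorem abs_sub_csSup_le {V A : Set ℝ} {D M ε a₀ : ℝ} (hD : IsGreatest V D) (hA : A.Finite)
    (ha₀ : a₀ ∈ A) (hM : -M < a₀) (hε : ε ≤ 1)
    (h1 : ∀ v ∈ V, -M - 1 < v → ∃ a ∈ A, |v - a| ≤ ε) (h2 : ∀ a ∈ A, ∃ v ∈ V, |v - a| ≤ ε) :
    |D - sSup A| ≤ ε := by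
  have hne : A.Nonempty := ⟨a₀, ha₀⟩
  have hmem := hne.csSup_mem hA
  have hle := fun {a} (ha : a ∈ A) => le_csSup hA.bddAbove ha
  obtain ⟨v, hv, hva⟩ := h2 _ hmem
  have hvD := hD.2 hv
  rw [abs_le] at hva
  have h3 : -M - 1 < D := by linarith [hle ha₀]
  obtain ⟨a, ha, hDa⟩ := h1 D hD.1 h3
  rw [abs_le] at hDa ⊢
  have := hle ha
  constructor <;> linarith

open Classical in
/-- A point of a cell. -/
noncomputable def cellPoint {κ S : Type*} [Zero S] (C : κ → Set S) (k : κ) : S :=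
  if h : (C k).Nonempty then h.some else 0

theorem cellPoint_mem {κ S : Type*} [Zero S] {C : κ → Set S} {k : κ} (h : (C k).Nonempty) :
    cellPoint C k ∈ C k := by
  rw [cellPoint, dif_pos h]
  exact h.some_mem

/-- The values of the pairs of occupied cells. -/
def cellValues {κ : Type*} {p : ℕ} (w : Fin p → ℝ) (C : κ → Set (ℝ × (Fin p → ℝ)))
    (O : Finset (Bool × κ)) : Set ℝ :=
  {a | ∃ k l, (true, k) ∈ O ∧ (false, l) ∈ O ∧ a = pairFun w (cellPoint C k) (cellPoint C l)}

theorem finite_cellValues {κ : Type*} [Finite κ] {p : ℕ} (w : Fin p → ℝ)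
    (C : κ → Set (ℝ × (Fin p → ℝ))) (O : Finset (Bool × κ)) : (cellValues w C O).Finite := by
  refine (Set.finite_range fun kl : κ × κ =>
    pairFun w (cellPoint C kl.1) (cellPoint C kl.2)).subset ?_
  rintro a ⟨k, l, -, -, rfl⟩
  exact ⟨(k, l), rfl⟩

/-- The configurations of occupied cells that avoid the unbounded cells and contain a pair of
value larger than `-M`. -/
def goodCells {m N p : ℕ} (w : Fin p → ℝ)
    (C : Option (Fin m) × Option (Fin N) → Set (ℝ × (Fin p → ℝ))) (M : ℝ)
    (O : Finset (Bool × (Option (Fin m) × Option (Fin N)))) : Prop :=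
  (∀ sk ∈ O, sk.2.1 ≠ none ∧ sk.2.2 ≠ none) ∧ ∃ a ∈ cellValues w C O, -M < a

/-- A Poisson process hits `B` with probability `1 - e^{-Λ(B)}`, which is at most `Λ(B)`. -/
theorem measureReal_exists_mem_le {Ω : Type*} [MeasurableSpace Ω] {P : Measure Ω} {p : ℕ}
    [IsProbabilityMeasure P] {Γ : ℕ → Ω → ℝ} {G : ℕ → Ω → Fin p → ℝ}
    (h : IsPoissonProcess P (markedIntensity p) (pointMeasure Γ G)) {B : Set (ℝ × (Fin p → ℝ))}
    (hB : MeasurableSet B) (hfin : markedIntensity p B < ⊤) :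
    P.real {ω | ∃ i, (Γ i ω, G i ω) ∈ B} ≤ (markedIntensity p B).toReal := by
  have h1 : {ω | ∃ i, (Γ i ω, G i ω) ∈ B} = {ω | pointMeasure Γ G ω B = 0}ᶜ := by
    ext ω
    simp [pointMeasure_eq_zero_iff Γ G ω hB]
  have h2 : MeasurableSet {ω | pointMeasure Γ G ω B = 0} :=
    h.measurable_apply hB (measurableSet_singleton 0)
  rw [h1, probReal_compl_eq_one_sub h2, measureReal_def, h.measure_eq_zero hB hfin,
    ENNReal.toReal_ofReal (Real.exp_nonneg _)]
  linarith [Real.add_one_le_exp (-(markedIntensity p B).toReal)]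

theorem exists_measureReal_compl_closedBall_lt {p : ℕ} {ε : ℝ} (hε : 0 < ε) :
    ∃ R : ℝ, 0 ≤ R ∧ (stdGauss p).real (Metric.closedBall 0 R)ᶜ < ε := by
  have h1 : Tendsto (fun n : ℕ => stdGauss p (Metric.closedBall 0 (n : ℝ))) atTop
      (𝓝 (stdGauss p (⋃ n : ℕ, Metric.closedBall 0 (n : ℝ)))) :=
    tendsto_measure_iUnion_atTop fun i j hij =>
      Metric.closedBall_subset_closedBall (by exact_mod_cast hij)
  rw [Metric.iUnion_closedBall_nat, measure_univ] at h1
  have h2 := (ENNReal.tendsto_toReal ENNReal.one_ne_top).comp h1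
  have h3 : ∀ᶠ n : ℕ in atTop, 1 - ε < (stdGauss p).real (Metric.closedBall 0 (n : ℝ)) :=
    h2.eventually_const_lt (by simpa using hε)
  obtain ⟨n, hn⟩ := h3.exists
  refine ⟨n, by positivity, ?_⟩
  rw [probReal_compl_eq_one_sub Metric.isClosed_closedBall.measurableSet]
  linarith

theorem exists_measureReal_le_neg_lt {Ω : Type*} [MeasurableSpace Ω] {P : Measure Ω}
    [IsProbabilityMeasure P] {D : Ω → ℝ} (hD : Measurable D) {ε : ℝ} (hε : 0 < ε) :
    ∃ M : ℝ, 0 ≤ M ∧ P.real {ω | D ω ≤ -M} < ε := by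
  have h1 : Tendsto (fun n : ℕ => P {ω | -(n : ℝ) < D ω}) atTop
      (𝓝 (P (⋃ n : ℕ, {ω | -(n : ℝ) < D ω}))) :=
    tendsto_measure_iUnion_atTop fun i j hij ω hω => by
      have : (i : ℝ) ≤ j := by exact_mod_cast hij
      simp only [Set.mem_ofPred_eq] at hω ⊢
      linarith
  have h0 : (⋃ n : ℕ, {ω | -(n : ℝ) < D ω}) = Set.univ := by
    refine Set.eq_univ_of_forall fun ω => ?_
    obtain ⟨n, hn⟩ := exists_nat_gt (-D ω)
    exact Set.mem_iUnion.2 ⟨n, by simp only [Set.mem_ofPred_eq]; linarith⟩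
  rw [h0, measure_univ] at h1
  have h2 := (ENNReal.tendsto_toReal ENNReal.one_ne_top).comp h1
  have h3 : ∀ᶠ n : ℕ in atTop, 1 - ε < P.real {ω | -(n : ℝ) < D ω} :=
    h2.eventually_const_lt (by simpa using hε)
  obtain ⟨n, hn⟩ := h3.exists
  refine ⟨n, by positivity, ?_⟩
  have : {ω | D ω ≤ -(n : ℝ)} = {ω | -(n : ℝ) < D ω}ᶜ := by ext; simp
  rw [this, probReal_compl_eq_one_sub (measurableSet_lt measurable_const hD)]
  linarith

/-! ### Meshes adapted to the modulus of continuity of `pairFun`. -/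

section Mesh

variable {p m N : ℕ} {w : Fin p → ℝ} {c : ℕ → ℝ} {E : Fin N → Set (Fin p → ℝ)} {R δ ε : ℝ}

theorem prodCell_some_subset (hc : Monotone c) (hE : (⋃ k, E k) = Metric.closedBall 0 R)
    {k : Option (Fin m) × Option (Fin N)} (h1 : k.1 ≠ none) (h2 : k.2 ≠ none) :
    prodCell c E k ⊆ Set.Ioc (c 0) (c m) ×ˢ Metric.closedBall 0 R := by
  obtain ⟨k1, k2⟩ := k
  obtain ⟨j, rfl⟩ := Option.ne_none_iff_exists'.1 h1
  obtain ⟨l, rfl⟩ := Option.ne_none_iff_exists'.1 h2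
  refine Set.prod_mono ?_ ?_
  · exact Set.Ioc_subset_Ioc (hc (Nat.zero_le _)) (hc j.2)
  · rw [← hE]; exact Set.subset_iUnion E l

theorem dist_cellPoint_lt (hcδ : ∀ i, c (i + 1) - c i < δ)
    (hEδ : ∀ k, ∀ x ∈ E k, ∀ y ∈ E k, dist x y < δ)
    {k : Option (Fin m) × Option (Fin N)} (h1 : k.1 ≠ none) (h2 : k.2 ≠ none)
    {z z' : ℝ × (Fin p → ℝ)} (hz : z ∈ prodCell c E k) (hz' : z' ∈ prodCell c E k) :
    dist z z' < δ := by
  obtain ⟨k1, k2⟩ := k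
  obtain ⟨j, rfl⟩ := Option.ne_none_iff_exists'.1 h1
  obtain ⟨l, rfl⟩ := Option.ne_none_iff_exists'.1 h2
  rw [Prod.dist_eq, max_lt_iff]
  refine ⟨?_, hEδ l _ hz.2 _ hz'.2⟩
  have h3 := hz.1
  have h4 := hz'.1
  simp only [levelCell, Set.mem_Ioc] at h3 h4
  have := hcδ j
  rw [Real.dist_eq, abs_lt]
  constructor <;> linarith

theorem abs_pairFun_sub_cellPoint_le (hc : Monotone c) (hE : (⋃ k, E k) = Metric.closedBall 0 R)
    (hcδ : ∀ i, c (i + 1) - c i < δ) (hEδ : ∀ k, ∀ x ∈ E k, ∀ y ∈ E k, dist x y < δ)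
    (hunif : ∀ z ∈ Set.Icc (c 0) (c m) ×ˢ Metric.closedBall (0 : Fin p → ℝ) R,
      ∀ z₁ ∈ Set.Icc (c 0) (c m) ×ˢ Metric.closedBall (0 : Fin p → ℝ) R,
      ∀ z' ∈ Set.Icc (c 0) (c m) ×ˢ Metric.closedBall (0 : Fin p → ℝ) R,
      ∀ z₁' ∈ Set.Icc (c 0) (c m) ×ˢ Metric.closedBall (0 : Fin p → ℝ) R,
      dist z z₁ < δ → dist z' z₁' < δ → |pairFun w z z' - pairFun w z₁ z₁'| ≤ ε)
    {k l : Option (Fin m) × Option (Fin N)} (hk1 : k.1 ≠ none) (hk2 : k.2 ≠ none)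
    (hl1 : l.1 ≠ none) (hl2 : l.2 ≠ none) {z z' : ℝ × (Fin p → ℝ)} (hz : z ∈ prodCell c E k)
    (hz' : z' ∈ prodCell c E l) :
    |pairFun w z z' - pairFun w (cellPoint (prodCell c E) k) (cellPoint (prodCell c E) l)| ≤ ε := by
  have hsub : Set.Ioc (c 0) (c m) ×ˢ Metric.closedBall (0 : Fin p → ℝ) R ⊆
    Set.Icc (c 0) (c m) ×ˢ Metric.closedBall 0 R := Set.prod_mono Set.Ioc_subset_Icc_self subset_rfl
  have hk := cellPoint_mem ⟨z, hz⟩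
  have hl := cellPoint_mem ⟨z', hz'⟩
  exact hunif _ (hsub (prodCell_some_subset hc hE hk1 hk2 hz))
    _ (hsub (prodCell_some_subset hc hE hk1 hk2 hk))
    _ (hsub (prodCell_some_subset hc hE hl1 hl2 hz'))
    _ (hsub (prodCell_some_subset hc hE hl1 hl2 hl))
    (dist_cellPoint_lt hcδ hEδ hk1 hk2 hz hk) (dist_cellPoint_lt hcδ hEδ hl1 hl2 hz' hl)

/-- On the compact box `pairFun` is uniformly continuous, so cells smaller than its modulus may be
replaced by any of their points. The cells labelled `none` are unbounded and are left out of the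
estimate. -/
theorem exists_mesh (w : Fin p → ℝ) {a b R ε : ℝ} (hab : a ≤ b) (hε : 0 < ε) :
    ∃ (m N : ℕ) (c : ℕ → ℝ) (E : Fin N → Set (Fin p → ℝ)), Monotone c ∧ c 0 = a ∧ c m = b ∧
      (∀ k, MeasurableSet (E k)) ∧ Pairwise (fun k l => Disjoint (E k) (E l)) ∧
      (⋃ k, E k) = Metric.closedBall 0 R ∧
      ∀ k l : Option (Fin m) × Option (Fin N), k.1 ≠ none → k.2 ≠ none → l.1 ≠ none →
        l.2 ≠ none → ∀ z ∈ prodCell c E k, ∀ z' ∈ prodCell c E l,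
        |pairFun w z z' - pairFun w (cellPoint (prodCell c E) k) (cellPoint (prodCell c E) l)|
          ≤ ε := by
  set K : Set (ℝ × (Fin p → ℝ)) := Set.Icc a b ×ˢ Metric.closedBall 0 R
  have hK : IsCompact K := isCompact_Icc.prod (isCompact_closedBall _ _)
  have hu := (hK.prod hK).uniformContinuousOn_of_continuous (continuous_pairFun w).continuousOn
  obtain ⟨δ, hδ, hu⟩ := Metric.uniformContinuousOn_iff.1 hu ε hε
  obtain ⟨m, c, hc, hc0, hcm, hcδ⟩ := exists_monotone_subdivision hab hδ
  obtain ⟨N, E, hE, hEd, hEu, hEδ⟩ := (isCompact_closedBall (0 : Fin p → ℝ)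
    R).totallyBounded.exists_finite_measurable_partition Metric.isClosed_closedBall.measurableSet hδ
  refine ⟨m, N, c, E, hc, hc0, hcm, hE, hEd, hEu, ?_⟩
  intro k l hk1 hk2 hl1 hl2 z hz z' hz'
  refine abs_pairFun_sub_cellPoint_le hc hEu hcδ hEδ ?_ hk1 hk2 hl1 hl2 hz hz'
  rw [hc0, hcm]
  intro z hz z₁ hz₁ z' hz' z₁' hz₁' h1 h2
  have := hu (z, z') ⟨hz, hz'⟩ (z₁, z₁') ⟨hz₁, hz₁'⟩ (by rw [Prod.dist_eq]; exact max_lt h1 h2)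
  exact this.le

end Mesh

/-! ### Approximation of pair values by values of cells. -/

section LimitApprox

variable {m N p : ℕ} {w : Fin p → ℝ} {c : ℕ → ℝ} {E : Fin N → Set (Fin p → ℝ)} {M ε : ℝ}

/-- A family of pairs is approximated by the occupied cells when the cells are fine. -/
theorem exists_cellValues_near (hw : ∀ q, 0 ≤ w q)
    (hmesh : ∀ k l : Option (Fin m) × Option (Fin N), k.1 ≠ none → k.2 ≠ none → l.1 ≠ none →
        l.2 ≠ none → ∀ z ∈ prodCell c E k, ∀ z' ∈ prodCell c E l,
        |pairFun w z z' - pairFun w (cellPoint (prodCell c E) k) (cellPoint (prodCell c E) l)|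
          ≤ ε)
    (hcM : c 0 + c m ≤ -M - 1) {z z' : ℕ → ℝ × (Fin p → ℝ)}
    (hgood : ∀ sk ∈ occupiedPair (prodCell (m := m) c E) z z', sk.2.1 ≠ none ∧ sk.2.2 ≠ none)
    {i j : ℕ} (hv : -M - 1 < pairFun w (z i) (z' j)) :
    ∃ a ∈ cellValues w (prodCell c E) (occupiedPair (prodCell (m := m) c E) z z'),
      |pairFun w (z i) (z' j) - a| ≤ ε := by
  have hcell : ∀ (s : Bool) (i : ℕ), c 0 < ((bif s then z else z') i).1 →
      ∃ k, (bif s then z else z') i ∈ prodCell (m := m) c E k ∧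
        (s, k) ∈ occupiedPair (prodCell (m := m) c E) z z' := by
    intro s i hi
    obtain ⟨j, hj⟩ := exists_mem_levelCell (m := m) hi
    obtain ⟨k, hk⟩ := exists_mem_markCell E ((bif s then z else z') i).2
    exact ⟨(j, k), ⟨hj, hk⟩, mem_occupiedPair.2 ⟨i, hj, hk⟩⟩
  have hle : ∀ (s : Bool) (i : ℕ), ((bif s then z else z') i).1 ≤ c m := by
    intro s i
    by_contra hlt
    rw [not_le] at hlt
    obtain ⟨k, hk⟩ := exists_mem_markCell E ((bif s then z else z') i).2
    exact (hgood (s, (none, k)) (mem_occupiedPair.2 ⟨i, hlt, hk⟩)).1 rfl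
  -- No point lies above `c m`, so a pair of value above `-M - 1 ≥ c 0 + c m` has both first
  -- coordinates above `c 0`; each of its points therefore lies in some cell.
  have h1 := pairFun_le hw (z i) (z' j)
  have h2 : (z i).1 ≤ c m := hle true i
  have h3 : (z' j).1 ≤ c m := hle false j
  obtain ⟨k, hk, hkO⟩ := hcell true i (show c 0 < (z i).1 by linarith)
  obtain ⟨l, hl, hlO⟩ := hcell false j (show c 0 < (z' j).1 by linarith)
  exact ⟨_, ⟨k, l, hkO, hlO, rfl⟩, hmesh k l (hgood _ hkO).1 (hgood _ hkO).2 (hgood _ hlO).1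
    (hgood _ hlO).2 _ hk _ hl⟩

end LimitApprox

/-! ### The abstract limit theorem for maxima over pairs. -/

/-- Weak convergence of the maximum of a function of pairs of sample points, when the sample
points, suitably normalised, behave asymptotically like two independent Poisson processes. -/
theorem tendstoInDistribution_pairs {Ω Ω' X₀ : Type*} [MeasurableSpace Ω] [MeasurableSpace Ω']
    [MeasurableSpace X₀] {P : Measure Ω} {P' : Measure Ω'} [IsProbabilityMeasure P]
    [IsProbabilityMeasure P'] {p : ℕ} {w : Fin p → ℝ} (hw : ∀ q, 0 ≤ w q)
    {μ : Measure X₀} [IsProbabilityMeasure μ] {X : ℕ → Ω → X₀} (hX : ∀ i, Measurable (X i))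
    (hind : iIndepFun X P) (hlaw : ∀ i, P.map (X i) = μ)
    {side : Bool → Set X₀} (hsm : ∀ s, MeasurableSet (side s))
    (hsd : Disjoint (side true) (side false)) (hside : ∀ᵐ x ∂μ, ∃ s, x ∈ side s)
    {u : ℕ → X₀ → ℝ} {g : ℕ → X₀ → Fin p → ℝ} (hu : ∀ n, Measurable (u n))
    (hg : ∀ n, Measurable (g n)) {v : ℕ → X₀ → X₀ → ℝ} (hvsymm : ∀ n x y, v n x y = v n y x)
    (hint : ∀ (s : Bool) (c : ℝ) (B : Set (Fin p → ℝ)), MeasurableSet B →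
      Tendsto (fun n : ℕ => (n : ℝ) * μ.real (side s ∩ {x | c < u n x} ∩ {x | g n x ∈ B})) atTop
        (𝓝 (Real.exp (-c) / 2 * (stdGauss p).real B)))
    (hvle : ∀ᶠ n in atTop, ∀ x y, v n x y ≤ u n x + u n y)
    (hvlim : ∀ K ε : ℝ, 0 < ε → ∀ᶠ n in atTop, ∀ x ∈ side true, ∀ y ∈ side false,
      |u n x| ≤ K → |u n y| ≤ K → ‖g n x‖ ≤ K → ‖g n y‖ ≤ K →
      |v n x y - pairFun w (u n x, g n x) (u n y, g n y)| ≤ ε)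
    (hvsame : ∀ K M : ℝ, ∀ᶠ n in atTop, ∀ s, ∀ x ∈ side s, ∀ y ∈ side s,
      |u n x| ≤ K → |u n y| ≤ K → ‖g n x‖ ≤ K → ‖g n y‖ ≤ K → v n x y ≤ -M)
    {D : ℕ → Ω → ℝ} (hDm : ∀ n, AEMeasurable (D n) P)
    (hD : ∀ᶠ n in atTop, ∀ ω, IsGreatest
      ((fun ij : ℕ × ℕ => v n (X ij.1 ω) (X ij.2 ω)) '' (Set.Iio n ×ˢ Set.Iio n)) (D n ω))
    {Γp Γm : ℕ → Ω' → ℝ} {Gp Gm : ℕ → Ω' → Fin p → ℝ}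
    (hΓp : ∀ i, Measurable (Γp i)) (hΓm : ∀ i, Measurable (Γm i))
    (hGp : ∀ i, Measurable (Gp i)) (hGm : ∀ i, Measurable (Gm i))
    (hNp : IsPoissonProcess P' (markedIntensity p) (pointMeasure Γp Gp))
    (hNm : IsPoissonProcess P' (markedIntensity p) (pointMeasure Γm Gm))
    (hN : IndepFun (pointMeasure Γp Gp) (pointMeasure Γm Gm) P') :
    TendstoInDistribution D atTop
      (fun ω => ⨆ ij : ℕ × ℕ, pairFun w (Γp ij.1 ω, Gp ij.1 ω) (Γm ij.2 ω, Gm ij.2 ω))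
      (fun _ => P) P' := by
  set D' : Ω' → ℝ := fun ω =>
    ⨆ ij : ℕ × ℕ, pairFun w (Γp ij.1 ω, Gp ij.1 ω) (Γm ij.2 ω, Gm ij.2 ω) with hD'
  have hD'm : Measurable D' := measurable_iSup_pairFun hΓp hΓm hGp hGm
  have hD'g := ae_isGreatest_pairFun hw hNp hNm
  refine tendstoInDistribution_of_finite_approx hDm hD'm.aemeasurable fun ε₀ hε₀ => ?_
  obtain ⟨ε, hε, hεε₀, hε1⟩ : ∃ ε : ℝ, 0 < ε ∧ ε ≤ ε₀ ∧ ε ≤ 1 :=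
    ⟨min ε₀ 1, by positivity, min_le_left _ _, min_le_right _ _⟩
  obtain ⟨M₁, hM₁, hM₁P⟩ := exists_measureReal_le_neg_lt hD'm (P := P') (ε := ε / 3) (by positivity)
  -- The extra unit leaves room for the discretisation: when the limit exceeds `-M₁`, its
  -- approximating cell value still exceeds `-M`.
  set M : ℝ := M₁ + 1 with hM
  obtain ⟨K, hK0, hKε⟩ : ∃ K : ℝ, 0 ≤ K ∧ Real.exp (-K) < ε / 3 := by
    have h1 : ∀ᶠ K : ℝ in atTop, Real.exp (-K) < ε / 3 :=
      (Real.tendsto_exp_neg_atTop_nhds_zero).eventually_lt_const (by positivity)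
    obtain ⟨K, hK⟩ := (h1.and (eventually_ge_atTop 0)).exists
    exact ⟨K, hK.2, hK.1⟩
  -- When both first coordinates are at most `K`, a pair above `-M - 1` has both of them above
  -- `-K'`. The interval from `-K'` to `K` is the one to be subdivided.
  set K' : ℝ := M + K + 1 with hK'
  -- The factor `e^{-K'}` compensates the intensity `e^{K'} / 2` of the points above `-K'`, so that
  -- marks outside radius `R` are rare among them.
  obtain ⟨R, hR0, hRε⟩ := exists_measureReal_compl_closedBall_lt (p := p)
    (ε := ε / 3 * Real.exp (-K')) (by positivity)
  obtain ⟨m, N, c, E, hc, hc0, hcm, hE, hEd, hEu, hmesh⟩ :=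
    exists_mesh w (a := -K') (b := K) (R := R) (ε := ε / 2) (by linarith) (by positivity)
  set C := prodCell (m := m) c E with hCdef
  have hCm : ∀ k, MeasurableSet (C k) := fun k =>
    (measurableSet_levelCell c m k.1).prod (measurableSet_markCell hE k.2)
  have hCd : Pairwise fun k l => Disjoint (C k) (C l) := pairwise_disjoint_prodCell hc hEd
  have hCfin : ∀ k, markedIntensity p (C k) < ⊤ := fun k =>
    (measure_mono (Set.prod_mono (levelCell_subset hc m k.1) (Set.subset_univ _))).trans_lt
      (markedIntensity_Ioi_prod_lt_top p (c 0) Set.univ)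
  -- Cells in the sample space: the same product cells read through the normalised coordinates, with
  -- the side playing the role of the label of the Poisson process.
  set CX : ℕ → Bool × (Option (Fin m) × Option (Fin N)) → Set X₀ := fun n sk =>
    side sk.1 ∩ {x | u n x ∈ levelCell c m sk.2.1} ∩ {x | g n x ∈ markCell E sk.2.2} with hCX
  have hCXm : ∀ n sk, MeasurableSet (CX n sk) := fun n sk =>
    ((hsm _).inter (hu n (measurableSet_levelCell c m _))).inter
      (hg n (measurableSet_markCell hE _))
  have hmemCX : ∀ {n s k x}, x ∈ CX n (s, k) ↔ x ∈ side s ∧ (u n x, g n x) ∈ C k := by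
    intro n s k x
    simp only [hCX, hCdef, prodCell, Set.mem_inter_iff, Set.mem_ofPred_eq, Set.mem_prod, and_assoc]
  have hCXd : ∀ n, Pairwise fun k l => Disjoint (CX n k) (CX n l) := by
    rintro n ⟨s, k⟩ ⟨s', k'⟩ hne
    refine Set.disjoint_left.2 fun x hx hx' => ?_
    rw [hmemCX] at hx hx'
    by_cases hss : s = s'
    · subst hss
      have hkk : k ≠ k' := fun h => hne (by rw [h])
      exact Set.disjoint_left.1 (hCd hkk) hx.2 hx'.2
    · have h1 := Set.disjoint_left.1 hsd
      cases s <;> cases s' <;> first | exact hss rfl | exact h1 hx.1 hx'.1 | exact h1 hx'.1 hx.1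
  classical
  set O : ℕ → Ω → Finset (Bool × (Option (Fin m) × Option (Fin N))) := fun n ω =>
    occupied (CX n) (Set.Iio n) fun i => X i ω with hO
  set O' : Ω' → Finset (Bool × (Option (Fin m) × Option (Fin N))) := fun ω =>
    occupiedPair C (fun i => (Γp i ω, Gp i ω)) (fun i => (Γm i ω, Gm i ω)) with hO'
  have hO'near : ∀ ω, (∀ sk ∈ O' ω, sk.2.1 ≠ none ∧ sk.2.2 ≠ none) → ∀ i j,
      -M - 1 < pairFun w (Γp i ω, Gp i ω) (Γm j ω, Gm j ω) →
      ∃ a ∈ cellValues w C (O' ω), |pairFun w (Γp i ω, Gp i ω) (Γm j ω, Gm j ω) - a| ≤ ε / 2 := by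
    intro ω hω i j hv
    exact exists_cellValues_near (z := fun i => (Γp i ω, Gp i ω)) (z' := fun i => (Γm i ω, Gm i ω))
      hw hmesh (by rw [hc0, hcm]; linarith) hω hv
  refine ⟨_, inferInstance, inferInstance, O, O', fun J => sSup (cellValues w C J),
    Finset.univ.filter (goodCells w C M), ?_, ?_, ?_, ?_, ?_, ?_⟩
  · exact fun n J => measurableSet_finset_eq
      (fun sk => measurableSet_mem_occupied hX (hCXm n) _ sk) J
  · refine fun J => measurableSet_finset_eq (fun sk => ?_) J
    obtain ⟨s, k⟩ := sk
    simp only [hO', mem_occupiedPair]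
    rw [Set.ofPred_exists]
    refine MeasurableSet.iUnion fun i => ?_
    cases s
    · exact ((hΓm i).prodMk (hGm i)) (hCm k)
    · exact ((hΓp i).prodMk (hGp i)) (hCm k)
  · intro J
    rw [measureReal_occupiedPair_subset hNp hNm hN hCm hCd hCfin J]
    refine tendsto_measureReal_occupied_subset hX hind hlaw hCXm hCXd (fun sk => ?_) J
    exact tendsto_measureReal_levelCell (hsm sk.1) hu hg (hint sk.1) hc m sk.2.1
      (measurableSet_markCell hE sk.2.2)
  · set K₂ : ℝ := max (max K K') R with hK₂
    filter_upwards [hD, hvle, hvlim K₂ (ε / 2) (by positivity), hvsame K₂ (M + 1)]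
      with n hDn hvlen hvlimn hvsamen
    have hae : ∀ᵐ ω ∂P, ∀ i, ∃ s, X i ω ∈ side s := by
      refine ae_all_iff.2 fun i => ?_
      rw [← hlaw i] at hside
      exact ae_of_ae_map (hX i).aemeasurable hside
    filter_upwards [hae] with ω hω hgood
    rw [Finset.mem_filter] at hgood
    obtain ⟨-, hbad, a₀, ha₀, ha₀M⟩ := hgood
    have hbox : ∀ {s k x}, (s, k) ∈ O n ω → x ∈ CX n (s, k) →
        |u n x| ≤ K₂ ∧ ‖g n x‖ ≤ K₂ := by
      intro s k x hk hx
      have h1 := prodCell_some_subset hc hEu (hbad _ hk).1 (hbad _ hk).2 (hmemCX.1 hx).2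
      rw [hc0, hcm] at h1
      have h2 := h1.1
      have h3 := h1.2
      rw [mem_closedBall_zero_iff] at h3
      refine ⟨abs_le.2 ⟨?_, ?_⟩, h3.trans (le_max_right _ _)⟩
      · have := (le_max_right K K').trans (le_max_left _ R)
        have h4 : -K' < u n x := h2.1
        linarith
      · have := (le_max_left K K').trans (le_max_left _ R)
        have h4 : u n x ≤ K := h2.2
        linarith
    have hnear : ∀ {k l x y}, (true, k) ∈ O n ω → (false, l) ∈ O n ω → x ∈ CX n (true, k) →
        y ∈ CX n (false, l) →
        |v n x y - pairFun w (cellPoint C k) (cellPoint C l)| ≤ ε := by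
      intro k l x y hk hl hx hy
      obtain ⟨hx1, hx2⟩ := hbox hk hx
      obtain ⟨hy1, hy2⟩ := hbox hl hy
      have h1 := hvlimn x (hmemCX.1 hx).1 y (hmemCX.1 hy).1 hx1 hy1 hx2 hy2
      have h2 := hmesh k l (hbad _ hk).1 (hbad _ hk).2 (hbad _ hl).1 (hbad _ hl).2 _
        (hmemCX.1 hx).2 _ (hmemCX.1 hy).2
      have := abs_sub_le (v n x y) (pairFun w (u n x, g n x) (u n y, g n y))
        (pairFun w (cellPoint C k) (cellPoint C l))
      linarith
    refine (abs_sub_csSup_le (hDn ω) (finite_cellValues w C _) ha₀ ha₀M hε1 ?_ ?_).trans hεε₀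
    · rintro _ ⟨⟨i, j⟩, ⟨hi, hj⟩, rfl⟩ hv
      simp only at hi hj hv ⊢
      have hcell : ∀ i ∈ Set.Iio n, -K' < u n (X i ω) →
          ∃ s k, X i ω ∈ CX n (s, k) ∧ (s, k) ∈ O n ω := by
        intro i hi hi'
        obtain ⟨j, hj⟩ := exists_mem_levelCell (c := c) (m := m) (by rw [hc0]; exact hi')
        obtain ⟨k, hk⟩ := exists_mem_markCell E (g n (X i ω))
        obtain ⟨s, hs⟩ := hω i
        exact ⟨s, (j, k), hmemCX.2 ⟨hs, hj, hk⟩,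
          mem_occupied.2 ⟨i, hi, hmemCX.2 ⟨hs, hj, hk⟩⟩⟩
      have hleK : ∀ i ∈ Set.Iio n, u n (X i ω) ≤ K := by
        intro i hi
        by_contra hlt
        rw [not_le] at hlt
        obtain ⟨k, hk⟩ := exists_mem_markCell E (g n (X i ω))
        obtain ⟨s, hs⟩ := hω i
        refine (hbad (s, (none, k)) (mem_occupied.2 ⟨i, hi, hmemCX.2 ⟨hs, ?_, hk⟩⟩)).1 rfl
        rw [← hcm] at hlt
        exact hlt
      have h1 := hvlen (X i ω) (X j ω)
      have h2 := hleK i hi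
      have h3 := hleK j hj
      obtain ⟨s, k, hxk, hkO⟩ := hcell i hi (by linarith)
      obtain ⟨t, l, hyl, hlO⟩ := hcell j hj (by linarith)
      obtain ⟨hx1, hx2⟩ := hbox hkO hxk
      obtain ⟨hy1, hy2⟩ := hbox hlO hyl
      -- Pairs on one side, including a point paired with itself, have value at most `-(M + 1)`, too
      -- low to be considered here.
      have hsame : s ≠ t := by
        rintro rfl
        have := hvsamen s _ (hmemCX.1 hxk).1 _ (hmemCX.1 hyl).1 hx1 hy1 hx2 hy2
        linarith
      cases s <;> cases t
      · exact absurd rfl hsame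
      · refine ⟨_, ⟨l, k, hlO, hkO, rfl⟩, ?_⟩
        rw [hvsymm]
        exact hnear hlO hkO hyl hxk
      · exact ⟨_, ⟨k, l, hkO, hlO, rfl⟩, hnear hkO hlO hxk hyl⟩
      · exact absurd rfl hsame
    · rintro _ ⟨k, l, hk, hl, rfl⟩
      obtain ⟨i, hi, hxi⟩ := mem_occupied.1 hk
      obtain ⟨j, hj, hyj⟩ := mem_occupied.1 hl
      exact ⟨_, ⟨(i, j), ⟨hi, hj⟩, rfl⟩, hnear hk hl hxi hyj⟩
  · filter_upwards [hD'g] with ω hω hgood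
    rw [Finset.mem_filter] at hgood
    obtain ⟨-, hbad, a₀, ha₀, ha₀M⟩ := hgood
    refine (abs_sub_csSup_le hω (finite_cellValues w C _) ha₀ ha₀M hε1 ?_ ?_).trans hεε₀
    · rintro _ ⟨⟨i, j⟩, rfl⟩ hv
      obtain ⟨a, ha, hva⟩ := hO'near ω hbad i j hv
      exact ⟨a, ha, hva.trans (by linarith)⟩
    · rintro _ ⟨k, l, hk, hl, rfl⟩
      obtain ⟨i, hi⟩ := mem_occupiedPair.1 hk
      obtain ⟨j, hj⟩ := mem_occupiedPair.1 hl
      exact ⟨_, ⟨(i, j), rfl⟩, (hmesh k l (hbad _ hk).1 (hbad _ hk).2 (hbad _ hl).1 (hbad _ hl).2 _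
        hi _ hj).trans (by linarith)⟩
  -- A bad configuration requires a point above `K`, a point above `-K'` with mark outside the ball,
  -- or a limit at most `-M₁`. The first two cost `ε / 6` each for each process, and the third costs
  -- `ε / 3`.
  · set B₁ : Set (ℝ × (Fin p → ℝ)) := Set.Ioi K ×ˢ Set.univ with hB₁
    set B₂ : Set (ℝ × (Fin p → ℝ)) := Set.Ioi (-K') ×ˢ (Metric.closedBall 0 R)ᶜ with hB₂
    have hB₁m : MeasurableSet B₁ := measurableSet_Ioi.prod .univ
    have hB₂m : MeasurableSet B₂ :=
      measurableSet_Ioi.prod Metric.isClosed_closedBall.measurableSet.compl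
    have hb₁ : (markedIntensity p B₁).toReal ≤ ε / 6 := by
      rw [hB₁, markedIntensity_Ioi_prod, measure_univ, mul_one,
        ENNReal.toReal_ofReal (by positivity)]
      linarith
    have hb₂ : (markedIntensity p B₂).toReal ≤ ε / 6 := by
      rw [hB₂, markedIntensity_Ioi_prod, ENNReal.toReal_mul, ENNReal.toReal_ofReal (by positivity)]
      have h1 : Real.exp (- -K') / 2 * (stdGauss p).real (Metric.closedBall 0 R)ᶜ
        ≤ Real.exp (- -K') / 2 * (ε / 3 * Real.exp (-K')) :=
        mul_le_mul_of_nonneg_left hRε.le (by positivity)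
      refine h1.trans (le_of_eq ?_)
      rw [neg_neg, Real.exp_neg]
      field_simp
      norm_num
    have hbad : ∀ {Γ : ℕ → Ω' → ℝ} {G : ℕ → Ω' → Fin p → ℝ},
        IsPoissonProcess P' (markedIntensity p) (pointMeasure Γ G) →
        P'.real {ω | ∃ i, (Γ i ω, G i ω) ∈ B₁} + P'.real {ω | ∃ i, (Γ i ω, G i ω) ∈ B₂}
          ≤ ε / 3 := by
      intro Γ G h
      have h1 := measureReal_exists_mem_le h hB₁m (markedIntensity_Ioi_prod_lt_top _ _ _)
      have h2 := measureReal_exists_mem_le h hB₂m (markedIntensity_Ioi_prod_lt_top _ _ _)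
      linarith
    set Bad : Set Ω' := (({ω | ∃ i, (Γp i ω, Gp i ω) ∈ B₁} ∪ {ω | ∃ i, (Γp i ω, Gp i ω) ∈ B₂}) ∪
        ({ω | ∃ i, (Γm i ω, Gm i ω) ∈ B₁} ∪ {ω | ∃ i, (Γm i ω, Gm i ω) ∈ B₂})) ∪
        {ω | D' ω ≤ -M₁} with hBad
    have hsub : ∀ᵐ ω ∂P', O' ω ∉ Finset.univ.filter (goodCells w C M) → ω ∈ Bad := by
      filter_upwards [hD'g] with ω hω hnot
      by_contra hcon
      refine hnot (Finset.mem_filter.2 ⟨Finset.mem_univ _, ?_⟩)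
      have hcon' : ω ∉ Bad := hcon
      simp only [hBad, Set.mem_union, Set.mem_ofPred_eq, not_or, not_le, not_exists] at hcon'
      obtain ⟨⟨⟨hp1, hp2⟩, hm1, hm2⟩, hDM⟩ := hcon'
      have hbadO : ∀ sk ∈ O' ω, sk.2.1 ≠ none ∧ sk.2.2 ≠ none := by
        rintro ⟨s, k1, k2⟩ hk
        obtain ⟨i, hi⟩ := mem_occupiedPair.1 hk
        have hi1 := hi.1
        have hi2 := hi.2
        constructor
        · rintro rfl
          have h5 : K < ((bif s then fun i => (Γp i ω, Gp i ω) else fun i => (Γm i ω, Gm i ω)) i).1 := by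
            rw [← hcm]; exact hi1
          cases s
          · exact hm1 i ⟨h5, trivial⟩
          · exact hp1 i ⟨h5, trivial⟩
        · rintro rfl
          have h5 := levelCell_subset hc m k1 hi1
          rw [hc0] at h5
          have h6 : ((bif s then fun i => (Γp i ω, Gp i ω) else fun i => (Γm i ω, Gm i ω)) i).2
            ∈ (Metric.closedBall 0 R)ᶜ := by rw [← hEu]; exact hi2
          cases s
          · exact hm2 i ⟨h5, h6⟩
          · exact hp2 i ⟨h5, h6⟩
      refine ⟨hbadO, ?_⟩
      obtain ⟨⟨i, j⟩, hij⟩ := hω.1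
      simp only at hij
      have hDij : D' ω = pairFun w (Γp i ω, Gp i ω) (Γm j ω, Gm j ω) := hij.symm
      obtain ⟨a, ha, hva⟩ := hO'near ω hbadO i j (by rw [← hDij]; linarith)
      refine ⟨a, ha, ?_⟩
      rw [← hDij, abs_le] at hva
      linarith
    have h1 : P'.real {ω | O' ω ∉ Finset.univ.filter (goodCells w C M)} ≤
        P'.real Bad :=
      ENNReal.toReal_mono (measure_ne_top _ _) (measure_mono_ae hsub)
    have h2 := measureReal_union_le (μ := P') (({ω | ∃ i, (Γp i ω, Gp i ω) ∈ B₁} ∪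
        {ω | ∃ i, (Γp i ω, Gp i ω) ∈ B₂}) ∪
        ({ω | ∃ i, (Γm i ω, Gm i ω) ∈ B₁} ∪ {ω | ∃ i, (Γm i ω, Gm i ω) ∈ B₂})) {ω | D' ω ≤ -M₁}
    have h3 := measureReal_union_le (μ := P') ({ω | ∃ i, (Γp i ω, Gp i ω) ∈ B₁} ∪
        {ω | ∃ i, (Γp i ω, Gp i ω) ∈ B₂})
        ({ω | ∃ i, (Γm i ω, Gm i ω) ∈ B₁} ∪ {ω | ∃ i, (Γm i ω, Gm i ω) ∈ B₂})
    have h4 := measureReal_union_le (μ := P') {ω | ∃ i, (Γp i ω, Gp i ω) ∈ B₁}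
        {ω | ∃ i, (Γp i ω, Gp i ω) ∈ B₂}
    have h5 := measureReal_union_le (μ := P') {ω | ∃ i, (Γm i ω, Gm i ω) ∈ B₁}
        {ω | ∃ i, (Γm i ω, Gm i ω) ∈ B₂}
    have h6 := hbad hNp
    have h7 := hbad hNm
    linarith

/-! ### Tails in the Gumbel domain of attraction. -/

section Tails

variable {Ω : Type*} [MeasurableSpace Ω] {P : Measure Ω} [IsProbabilityMeasure P] {T : Ω → ℝ}
  {ψ : ℝ → ℝ}

/-- The tail of a random variable. -/
noncomputable def tailProb (P : Measure Ω) (T : Ω → ℝ) (x : ℝ) : ℝ := P.real {ω | x < T ω}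

theorem tailProb_antitone : Antitone (tailProb P T) := fun _ _ hxy =>
  measureReal_mono fun _ hω => lt_of_le_of_lt hxy hω

theorem tailProb_nonneg (x : ℝ) : 0 ≤ tailProb P T x := measureReal_nonneg

theorem IsGumbelAuxiliary.tendsto_ratio (h : IsGumbelAuxiliary P T ψ) (z : ℝ) :
    Tendsto (fun x => tailProb P T (x + ψ x * z) / tailProb P T x) atTop
      (𝓝 (Real.exp (-z))) :=
  (tendstoLocallyUniformlyOn_univ.2 h.2).tendsto_at (Set.mem_univ z)

/-- At `z = 0` the ratio tends to one, whereas division by zero would return zero. The tail is thus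
nonzero arbitrarily far out, and monotonicity extends this to every level. -/
theorem IsGumbelAuxiliary.tailProb_pos (h : IsGumbelAuxiliary P T ψ) (x : ℝ) :
    0 < tailProb P T x := by
  have h1 : ∀ᶠ y in atTop, 0 < tailProb P T (y + ψ y * 0) / tailProb P T y :=
    (h.tendsto_ratio 0).eventually_const_lt (Real.exp_pos _)
  obtain ⟨y, hy, hxy⟩ := (h1.and (eventually_ge_atTop x)).exists
  refine lt_of_lt_of_le ?_ (tailProb_antitone hxy)
  rcases (tailProb_nonneg (P := P) (T := T) y).lt_or_eq with h2 | h2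
  · exact h2
  · rw [← h2] at hy
    simp at hy

/-- No sign of `ψ` is assumed. At `z = 1` the ratio tends to `e^{-1} < 1`, but a nonpositive `ψ x`
would make it at least one. -/
theorem IsGumbelAuxiliary.eventually_pos (h : IsGumbelAuxiliary P T ψ) :
    ∀ᶠ x in atTop, 0 < ψ x := by
  have h1 : ∀ᶠ y in atTop, tailProb P T (y + ψ y * 1) / tailProb P T y < 1 :=
    (h.tendsto_ratio 1).eventually_lt_const (by simp)
  filter_upwards [h1] with x hx
  by_contra hle
  rw [div_lt_one (h.tailProb_pos x)] at hx
  exact absurd hx (not_lt.2 (tailProb_antitone (by linarith)))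

/-- Two successive unit steps keep more than `e^{-2-ε/2}` of the tail. If the second step were
longer than `(1 + ε) ψ x`, the end point would lie beyond `x + (2 + ε) ψ x`, where less than that
fraction is left. -/
theorem IsGumbelAuxiliary.eventually_le_mul (h : IsGumbelAuxiliary P T ψ) {ε : ℝ} (hε : 0 < ε) :
    ∀ᶠ x in atTop, ψ (x + ψ x) ≤ (1 + ε) * ψ x := by
  have hy : Tendsto (fun x => x + ψ x) atTop atTop :=
    tendsto_atTop_mono' _ (h.eventually_pos.mono fun x hx => by simp only [id]; linarith) tendsto_id
  have h1 : ∀ᶠ y in atTop, Real.exp (-1 - ε / 4) < tailProb P T (y + ψ y * 1) / tailProb P T y :=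
    (h.tendsto_ratio 1).eventually_const_lt (Real.exp_lt_exp.2 (by linarith))
  have h2 : ∀ᶠ y in atTop, tailProb P T (y + ψ y * (2 + ε)) / tailProb P T y <
      Real.exp (-2 - ε / 2) :=
    (h.tendsto_ratio (2 + ε)).eventually_lt_const (Real.exp_lt_exp.2 (by linarith))
  filter_upwards [h1, hy.eventually h1, h2] with x hx1 hx2 hx3
  by_contra hlt
  rw [not_le] at hlt
  rw [lt_div_iff₀ (h.tailProb_pos _)] at hx1 hx2
  rw [div_lt_iff₀ (h.tailProb_pos _)] at hx3
  have h3 : tailProb P T (x + ψ x + ψ (x + ψ x) * 1) ≤ tailProb P T (x + ψ x * (2 + ε)) :=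
    tailProb_antitone (by nlinarith)
  rw [mul_one] at hx1
  have h4 : Real.exp (-1 - ε / 4) * (Real.exp (-1 - ε / 4) * tailProb P T x)
      < Real.exp (-1 - ε / 4) * tailProb P T (x + ψ x) :=
    mul_lt_mul_of_pos_left hx1 (Real.exp_pos _)
  have h5 : Real.exp (-2 - ε / 2) = Real.exp (-1 - ε / 4) * Real.exp (-1 - ε / 4) := by
    rw [← Real.exp_add]; congr 1; ring
  rw [h5] at hx3
  linarith

/-- A Potter-type bound for the tail of a random variable in the Gumbel domain of attraction. -/
theorem IsGumbelAuxiliary.exists_tailProb_le_pow (h : IsGumbelAuxiliary P T ψ) (N : ℕ) :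
    ∃ C : ℝ, 0 < C ∧ ∀ᶠ x in atTop, ∀ s, 0 ≤ s →
      tailProb P T (x + ψ x * s) ≤ C * tailProb P T x * ((1 + s) ^ N)⁻¹ := by
  obtain ⟨ε, hε, hε1, hεN⟩ : ∃ ε : ℝ, 0 < ε ∧ ε ≤ 1 ∧ (1 + ε) ^ N < Real.exp (1 / 2) := by
    have h1 : Tendsto (fun ε : ℝ => (1 + ε) ^ N) (𝓝[>] 0) (𝓝 ((1 + 0) ^ N)) :=
      (Continuous.tendsto (by fun_prop) 0).mono_left nhdsWithin_le_nhds
    have h2 : (1 + 0 : ℝ) ^ N < Real.exp (1 / 2) := by simp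
    have h3 : ∀ᶠ ε : ℝ in 𝓝[>] 0, ε ∈ Set.Ioc (0 : ℝ) 1 := Ioc_mem_nhdsGT one_pos
    obtain ⟨ε, hε, hε'⟩ := ((h1.eventually_lt_const h2).and h3).exists
    exact ⟨ε, hε'.1, hε'.2, hε⟩
  have h1 : ∀ᶠ y in atTop, tailProb P T (y + ψ y * 1) / tailProb P T y < Real.exp (-(1 / 2)) :=
    (h.tendsto_ratio 1).eventually_lt_const (Real.exp_lt_exp.2 (by norm_num))
  obtain ⟨x₀, hx₀⟩ := eventually_atTop.1 (h1.and (h.eventually_pos.and (h.eventually_le_mul hε)))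
  refine ⟨((1 + ε) / ε) ^ N, by positivity, ?_⟩
  filter_upwards [eventually_ge_atTop x₀] with x hx s hs
  -- Iterate `y ↦ y + ψ y` from `x`. Each step multiplies the tail by at most `e^{-1/2} ≤ (1 +
  -- ε)^{-N}`, while the step lengths grow at most geometrically with ratio `1 + ε`. Hence the
  -- geometric sum in the bound on the position.
  have hseq : ∀ k : ℕ, ∃ y, x ≤ y ∧ ψ y ≤ (1 + ε) ^ k * ψ x ∧
      y ≤ x + ψ x * (((1 + ε) ^ k - 1) / ε) ∧
      tailProb P T y ≤ (((1 + ε) ^ N) ^ k)⁻¹ * tailProb P T x := by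
    intro k
    induction k with
    | zero => exact ⟨x, le_rfl, by simp, by simp, by simp⟩
    | succ k ih =>
      obtain ⟨y, hxy, hy1, hy2, hy3⟩ := ih
      obtain ⟨hr, hpos, hself⟩ := hx₀ y (hx.trans hxy)
      refine ⟨y + ψ y, by linarith, ?_, ?_, ?_⟩
      · rw [pow_succ]
        nlinarith
      · have : ψ x * (((1 + ε) ^ (k + 1) - 1) / ε)
            = ψ x * (((1 + ε) ^ k - 1) / ε) + (1 + ε) ^ k * ψ x := by
          field_simp
          ring
        rw [this]
        linarith
      · rw [mul_one, div_lt_iff₀ (h.tailProb_pos y)] at hr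
        have h2 : Real.exp (-(1 / 2)) ≤ ((1 + ε) ^ N)⁻¹ := by
          rw [Real.exp_neg]
          exact inv_anti₀ (by positivity) hεN.le
        have h3 : Real.exp (-(1 / 2)) * tailProb P T y ≤
            ((1 + ε) ^ N)⁻¹ * ((((1 + ε) ^ N) ^ k)⁻¹ * tailProb P T x) :=
          mul_le_mul h2 hy3 (tailProb_nonneg _) (by positivity)
        rw [pow_succ, mul_inv]
        linarith
  have hψ := (hx₀ x hx).2.1
  -- The number of steps is the last `k` with `(1 + ε)^k ≤ 1 + ε s`: the iterate has not passed `x +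
  -- ψ x * s`, yet `(1 + ε)^k` is comparable to `1 + s`.
  obtain ⟨k, hk1, hk2⟩ := exists_nat_pow_near (x := 1 + ε * s) (y := 1 + ε)
    (by nlinarith) (by linarith)
  obtain ⟨y, -, -, hy2, hy3⟩ := hseq k
  have h4 : ((1 + ε) ^ k - 1) / ε ≤ s := by rw [div_le_iff₀ hε]; linarith
  have h5 : y ≤ x + ψ x * s := by nlinarith
  refine (tailProb_antitone h5).trans (hy3.trans ?_)
  have h6 : ε * (1 + s) ≤ (1 + ε) ^ k * (1 + ε) := by
    rw [pow_succ] at hk2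
    nlinarith
  have h7 : (((1 + ε) ^ N) ^ k)⁻¹ ≤ ((1 + ε) / ε) ^ N * ((1 + s) ^ N)⁻¹ := by
    rw [← pow_mul, mul_comm N k, pow_mul, ← inv_pow ((1 + ε) ^ k) N, ← inv_pow (1 + s) N, ← mul_pow]
    refine pow_le_pow_left₀ (by positivity) ?_ N
    rw [inv_le_iff_one_le_mul₀ (by positivity)]
    have : (1 + ε) / ε * (1 + s)⁻¹ * (1 + ε) ^ k = ((1 + ε) ^ k * (1 + ε)) / (ε * (1 + s)) := by
      have : 0 < 1 + s := by linarith
      field_simp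
    rw [this, le_div_iff₀ (by positivity)]
    linarith
  calc (((1 + ε) ^ N) ^ k)⁻¹ * tailProb P T x
      ≤ (((1 + ε) / ε) ^ N * ((1 + s) ^ N)⁻¹) * tailProb P T x :=
        mul_le_mul_of_nonneg_right h7 (tailProb_nonneg _)
    _ = _ := by ring

/-- Negative levels `c` make negative `s` occur. For `-c ≤ s ≤ 0` the tail is at most its value at
`-c`, eventually below `2 e^c` times the tail at `x`; the shift by `c` keeps the polynomial factor
positive. -/
theorem IsGumbelAuxiliary.exists_tailProb_le_pow_of_neg_le (h : IsGumbelAuxiliary P T ψ) (N : ℕ)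
    {c : ℝ} (hc : 0 ≤ c) :
    ∃ C : ℝ, 0 < C ∧ ∀ᶠ x in atTop, ∀ s, -c ≤ s →
      tailProb P T (x + ψ x * s) ≤ C * tailProb P T x * ((1 + c + s) ^ N)⁻¹ := by
  obtain ⟨C, hC, hev⟩ := h.exists_tailProb_le_pow N
  have h1 : ∀ᶠ y in atTop, tailProb P T (y + ψ y * (-c)) / tailProb P T y < 2 * Real.exp c :=
    (h.tendsto_ratio (-c)).eventually_lt_const (by rw [neg_neg]; linarith [Real.exp_pos c])
  refine ⟨(C + 2 * Real.exp c) * (1 + c) ^ N, by positivity, ?_⟩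
  filter_upwards [hev, h1, h.eventually_pos] with x hx1 hx2 hψ s hs
  have hF := h.tailProb_pos x
  rcases le_total 0 s with h0 | h0
  · have h3 : ((1 + s) ^ N)⁻¹ ≤ (1 + c) ^ N * ((1 + c + s) ^ N)⁻¹ := by
      rw [← inv_pow, ← inv_pow, ← mul_pow]
      refine pow_le_pow_left₀ (by positivity) ?_ N
      rw [← div_eq_mul_inv, inv_eq_one_div, div_le_div_iff₀ (by positivity) (by positivity)]
      nlinarith
    calc tailProb P T (x + ψ x * s) ≤ C * tailProb P T x * ((1 + s) ^ N)⁻¹ := hx1 s h0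
      _ ≤ C * tailProb P T x * ((1 + c) ^ N * ((1 + c + s) ^ N)⁻¹) := by gcongr
      _ ≤ (C + 2 * Real.exp c) * tailProb P T x * ((1 + c) ^ N * ((1 + c + s) ^ N)⁻¹) := by
        have : C ≤ C + 2 * Real.exp c := by linarith [Real.exp_pos c]
        have h5 : 0 < 1 + c + s := by linarith
        gcongr
      _ = _ := by ring
  · rw [div_lt_iff₀ hF] at hx2
    have h5 : 0 < 1 + c + s := by linarith
    have h3 : 1 ≤ (1 + c) ^ N * ((1 + c + s) ^ N)⁻¹ := by
      rw [← inv_pow, ← mul_pow]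
      refine one_le_pow₀ ?_
      rw [← div_eq_mul_inv, le_div_iff₀ h5]
      linarith
    calc tailProb P T (x + ψ x * s) ≤ tailProb P T (x + ψ x * (-c)) :=
          tailProb_antitone (by nlinarith)
      _ ≤ 2 * Real.exp c * tailProb P T x * 1 := by linarith
      _ ≤ (C + 2 * Real.exp c) * tailProb P T x * ((1 + c) ^ N * ((1 + c + s) ^ N)⁻¹) := by
        have : 2 * Real.exp c ≤ C + 2 * Real.exp c := by linarith
        gcongr
      _ = _ := by ring

/-- This is where the local uniformity in `z` enters: the argument `s n` varies with `n` when a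
curved threshold is expanded. -/
theorem IsGumbelAuxiliary.tendsto_ratio_comp (h : IsGumbelAuxiliary P T ψ) {ι : Type*}
    {l : Filter ι} {α s : ι → ℝ} {z : ℝ} (hα : Tendsto α l atTop) (hs : Tendsto s l (𝓝 z)) :
    Tendsto (fun n => tailProb P T (α n + ψ (α n) * s n) / tailProb P T (α n)) l
      (𝓝 (Real.exp (-z))) := by
  refine tendsto_comp_of_locally_uniform_limit (f := fun z => Real.exp (-z))
    (F := fun n z => tailProb P T (α n + ψ (α n) * z) / tailProb P T (α n))
    (by fun_prop) hs fun u hu => ?_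
  obtain ⟨t, ht, htu⟩ := h.2 u hu z
  exact ⟨t, ht, hα.eventually htu⟩

end Tails

/-! ### Integration over the sphere by central projection. -/

section Sphere

variable {p : ℕ}

/-- The integral of a function that is homogeneous of degree zero over the unit ball. -/
theorem setLIntegral_ball_of_homogeneous {f : EuclideanSpace ℝ (Fin (p + 1)) → ENNReal}
    (hf : Measurable f) (hom : ∀ r : ℝ, 0 < r → ∀ x, f (r • x) = f x) :
    ∫⁻ x in Metric.ball 0 1, f x = (∫⁻ x, f x ∂(volume.toSphere.map Subtype.val)) *
      ENNReal.ofReal (1 / (p + 1)) := by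
  have hmp := (volume : Measure (EuclideanSpace ℝ (Fin (p + 1)))).measurePreserving_homeomorphUnitSphereProd
  rw [lintegral_map hf measurable_subtype_coe]
  have hfin : Module.finrank ℝ (EuclideanSpace ℝ (Fin (p + 1))) - 1 = p := by simp
  have hball : MeasurableSet (Metric.ball (0 : (EuclideanSpace ℝ (Fin (p + 1)))) 1) := Metric.isOpen_ball.measurableSet
  have h1 : ∫⁻ x in Metric.ball (0 : (EuclideanSpace ℝ (Fin (p + 1)))) 1, f x =
      ∫⁻ x, (Metric.ball (0 : (EuclideanSpace ℝ (Fin (p + 1)))) 1).indicator f x ∂(volume.restrict {0}ᶜ) := by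
    rw [restrict_compl_singleton, lintegral_indicator hball]
  -- In polar coordinates `f` depends on the direction only and the indicator of the ball on the
  -- radius only, so the integral factorises.
  have hi : ∀ x : ({0}ᶜ : Set (EuclideanSpace ℝ (Fin (p + 1)))), (Metric.ball (0 : (EuclideanSpace ℝ (Fin (p + 1)))) 1).indicator f x =
      (fun y : Metric.sphere (0 : (EuclideanSpace ℝ (Fin (p + 1)))) 1 × Set.Ioi (0 : ℝ) =>
        f y.1 * (Set.Iio ⟨1, Set.mem_Ioi.2 one_pos⟩ : Set (Set.Ioi (0 : ℝ))).indicator 1 y.2)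
        (homeomorphUnitSphereProd (EuclideanSpace ℝ (Fin (p + 1))) x) := by
    intro x
    have hx : 0 < ‖(x : (EuclideanSpace ℝ (Fin (p + 1))))‖ := by
      have hx0 : (x : (EuclideanSpace ℝ (Fin (p + 1)))) ≠ 0 := x.2
      exact norm_pos_iff.2 hx0
    have h2 : f ((homeomorphUnitSphereProd (EuclideanSpace ℝ (Fin (p + 1))) x).1 : (EuclideanSpace ℝ (Fin (p + 1)))) = f x := by
      rw [homeomorphUnitSphereProd_apply_fst_coe]
      exact hom _ (inv_pos.2 hx) _
    simp only [h2]
    by_cases hx1 : ‖(x : (EuclideanSpace ℝ (Fin (p + 1))))‖ < 1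
    · rw [Set.indicator_of_mem (by simpa using hx1), Set.indicator_of_mem]
      · simp
      · rw [Set.mem_Iio, ← Subtype.coe_lt_coe, homeomorphUnitSphereProd_apply_snd_coe]
        simpa using hx1
    · rw [Set.indicator_of_notMem (by simpa using hx1), Set.indicator_of_notMem]
      · simp
      · rw [Set.mem_Iio, ← Subtype.coe_lt_coe, homeomorphUnitSphereProd_apply_snd_coe]
        simpa using hx1
  rw [h1, ← lintegral_subtype_comap (measurableSet_singleton 0).compl]
  simp_rw [hi]
  rw [hmp.lintegral_comp (f := fun y : Metric.sphere (0 : (EuclideanSpace ℝ (Fin (p + 1)))) 1 × Set.Ioi (0 : ℝ) =>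
        f y.1 * (Set.Iio ⟨1, Set.mem_Ioi.2 one_pos⟩ : Set (Set.Ioi (0 : ℝ))).indicator 1 y.2)]
  · rw [lintegral_prod_mul (f := fun y : Metric.sphere (0 : (EuclideanSpace ℝ (Fin (p + 1)))) 1 => f y)
      (hf.comp measurable_subtype_coe).aemeasurable
      ((measurable_one.indicator measurableSet_Iio).aemeasurable),
      lintegral_indicator_one measurableSet_Iio, Measure.volumeIoiPow_apply_Iio, hfin]
    simp
  · exact ((hf.comp measurable_subtype_coe).comp measurable_fst).mul
      ((measurable_one.indicator measurableSet_Iio).comp measurable_snd)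

/-- The constant need not be known: the normalisation of `a_n` will eliminate it. That it is nonzero
gives the integrability of `projDensity`. -/
theorem exists_lintegral_uniformSphere_eq_ball (p : ℕ) : ∃ C : ENNReal, C ≠ 0 ∧ C ≠ ⊤ ∧
    ∀ f : EuclideanSpace ℝ (Fin (p + 1)) → ENNReal, Measurable f →
      (∀ r : ℝ, 0 < r → ∀ x, f (r • x) = f x) →
      ∫⁻ x, f x ∂(uniformSphere (p + 1)) = C * ∫⁻ x in Metric.ball 0 1, f x := by
  set σ : Measure (Metric.sphere (0 : (EuclideanSpace ℝ (Fin (p + 1)))) 1) := (volume : Measure (EuclideanSpace ℝ (Fin (p + 1)))).toSphere with hσ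
  have hd : ENNReal.ofReal (1 / (p + 1)) ≠ 0 := by
    rw [Ne, ENNReal.ofReal_eq_zero, not_le]; positivity
  refine ⟨(σ Set.univ)⁻¹ * (ENNReal.ofReal (1 / (p + 1)))⁻¹, ?_, ?_, fun f hf hom => ?_⟩
  · exact mul_ne_zero (ENNReal.inv_ne_zero.2 (measure_ne_top _ _))
      (ENNReal.inv_ne_zero.2 ENNReal.ofReal_ne_top)
  · have hσ0 : σ ≠ 0 := Measure.toSphere_ne_zero _
    exact ENNReal.mul_ne_top (ENNReal.inv_ne_top.2 (by simpa using hσ0)) (ENNReal.inv_ne_top.2 hd)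
  · rw [setLIntegral_ball_of_homogeneous hf hom, uniformSphere, ProbabilityTheory.cond,
      Measure.restrict_univ, Measure.map_smul, lintegral_smul_measure, smul_eq_mul, mul_assoc,
      mul_comm (∫⁻ x, f x ∂_) (ENNReal.ofReal _), ← mul_assoc (_)⁻¹ (ENNReal.ofReal _),
      ENNReal.inv_mul_cancel hd ENNReal.ofReal_ne_top, one_mul]

theorem lintegral_pi_succ {f : (Fin (p + 1) → ℝ) → ENNReal} (hf : Measurable f) :
    ∫⁻ x, f x = ∫⁻ t : ℝ, ∫⁻ y : Fin p → ℝ, f (Fin.cons t y) := by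
  have h := (volume_preserving_piFinSuccAbove (fun _ : Fin (p + 1) => ℝ) 0).symm
  rw [← h.lintegral_comp_emb (MeasurableEquiv.measurableEmbedding _), Measure.volume_eq_prod,
    lintegral_prod]
  · simp [MeasurableEquiv.piFinSuccAbove, Fin.insertNthEquiv]
  · exact (hf.comp (MeasurableEquiv.measurable _)).aemeasurable

theorem lintegral_comp_smul_pi (f : (Fin p → ℝ) → ENNReal) {t : ℝ} (ht : t ≠ 0) :
    ∫⁻ y, f y = ENNReal.ofReal (|t| ^ p) * ∫⁻ y, f (t • y) := by
  have h := Measure.map_addHaar_smul (volume : Measure (Fin p → ℝ)) ht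
  have h2 : ∫⁻ y, f (t • y) = ∫⁻ y, f y ∂(Measure.map (fun x => t • x) volume) := by
    exact ((MeasurableEquiv.smul₀ t ht).measurableEmbedding.lintegral_map f).symm
  rw [h2, h, lintegral_smul_measure, smul_eq_mul, ← mul_assoc,
    ← ENNReal.ofReal_mul (by positivity)]
  have : |t| ^ p * |(t ^ Module.finrank ℝ (Fin p → ℝ))⁻¹| = 1 := by
    rw [Module.finrank_fin_fun, abs_inv, abs_pow]
    exact mul_inv_cancel₀ (by positivity)
  rw [this]
  simp

/-- The point of the affine hyperplane through `v 0` with the given coordinates. -/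
noncomputable def tangentPoint
    (v : OrthonormalBasis (Fin (p + 1)) ℝ (EuclideanSpace ℝ (Fin (p + 1))))
    (τ : Fin p → ℝ) : EuclideanSpace ℝ (Fin (p + 1)) :=
  v.repr.symm (WithLp.toLp 2 (Fin.cons 1 τ))

theorem continuous_tangentPoint
    (v : OrthonormalBasis (Fin (p + 1)) ℝ (EuclideanSpace ℝ (Fin (p + 1)))) :
    Continuous (tangentPoint v) := by
  unfold tangentPoint
  refine v.repr.symm.continuous.comp ((PiLp.continuous_toLp 2 _).comp ?_)
  refine continuous_pi fun i => ?_
  refine Fin.cases ?_ (fun j => ?_) i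
  · simpa using continuous_const
  · simpa using continuous_apply j

theorem repr_symm_cons_smul
    (v : OrthonormalBasis (Fin (p + 1)) ℝ (EuclideanSpace ℝ (Fin (p + 1)))) (t : ℝ)
    (τ : Fin p → ℝ) : v.repr.symm (WithLp.toLp 2 (Fin.cons t (t • τ))) = t • tangentPoint v τ := by
  rw [tangentPoint, ← map_smul, ← WithLp.toLp_smul]
  congr 2
  ext i
  refine Fin.cases ?_ (fun j => ?_) i <;> simp

theorem norm_tangentPoint
    (v : OrthonormalBasis (Fin (p + 1)) ℝ (EuclideanSpace ℝ (Fin (p + 1))))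
    (τ : Fin p → ℝ) : ‖tangentPoint v τ‖ = √(1 + ∑ q, τ q ^ 2) := by
  rw [tangentPoint, LinearIsometryEquiv.norm_map, EuclideanSpace.norm_eq, Fin.sum_univ_succ]
  simp

theorem setLIntegral_Ioo_pow {r : ℝ} (hr : 0 ≤ r) (p : ℕ) :
    ∫⁻ t in Set.Ioo 0 r, ENNReal.ofReal (|t| ^ p) = ENNReal.ofReal (r ^ (p + 1) / (p + 1)) := by
  rw [restrict_Ioo_eq_restrict_Ioc, ← ofReal_integral_eq_lintegral_ofReal,
    ← intervalIntegral.integral_of_le hr]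
  · congr 1
    rw [intervalIntegral.integral_congr (g := fun t => t ^ p), integral_pow]
    · simp
    · intro t ht
      rw [Set.uIcc_of_le hr] at ht
      simp only [abs_of_nonneg ht.1]
  · have : Continuous fun t : ℝ => |t| ^ p := by fun_prop
    exact (this.intervalIntegrable 0 r).1
  · exact Eventually.of_forall fun t => by positivity

/-- On each line through the origin a function of the direction takes one value per half-line; `a`
and `b` are these two values, and only a moment of `|t|` remains. -/
theorem lintegral_radial {r : ℝ} (hr : 0 ≤ r) (p : ℕ) (F : ℝ → ENNReal) (a b : ENNReal)
    (h1 : ∀ t, 0 < t → t < r → F t = a) (h2 : ∀ t, 0 < t → t < r → F (-t) = b)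
    (h3 : ∀ t, r ≤ |t| → F t = 0) :
    ∫⁻ t : ℝ, ENNReal.ofReal (|t| ^ p) * F t =
      (a + b) * ENNReal.ofReal (r ^ (p + 1) / (p + 1)) := by
  have hhalf : ∀ (G : ℝ → ENNReal) (a : ENNReal), (∀ t, 0 < t → t < r → G t = a) →
      (∀ t, r ≤ |t| → G t = 0) →
      ∫⁻ t in Set.Ioi (0 : ℝ), ENNReal.ofReal (|t| ^ p) * G t =
        a * ENNReal.ofReal (r ^ (p + 1) / (p + 1)) := by
    intro G a hG hG'
    have e1 : ∫⁻ t in Set.Ioi (0 : ℝ), ENNReal.ofReal (|t| ^ p) * G t =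
        ∫⁻ t, (Set.Ioo 0 r).indicator (fun t => ENNReal.ofReal (|t| ^ p) * a) t := by
      rw [← lintegral_indicator measurableSet_Ioi]
      refine lintegral_congr fun t => ?_
      by_cases ht : 0 < t
      · rw [Set.indicator_of_mem (show t ∈ Set.Ioi 0 from ht)]
        by_cases htr : t < r
        · rw [Set.indicator_of_mem (show t ∈ Set.Ioo 0 r from ⟨ht, htr⟩), hG t ht htr]
        · rw [Set.indicator_of_notMem fun h => htr h.2, hG' t (by rw [abs_of_pos ht]; linarith),
            mul_zero]
      · rw [Set.indicator_of_notMem (by simpa using ht), Set.indicator_of_notMem fun h => ht h.1]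
    rw [e1, lintegral_indicator measurableSet_Ioo, lintegral_mul_const _ (by fun_prop),
      setLIntegral_Ioo_pow hr, mul_comm]
  have hsplit : ∫⁻ t : ℝ, ENNReal.ofReal (|t| ^ p) * F t =
      (∫⁻ t in Set.Ioi (0 : ℝ), ENNReal.ofReal (|t| ^ p) * F t) +
      ∫⁻ t in Set.Ioi (0 : ℝ), ENNReal.ofReal (|t| ^ p) * F (-t) := by
    rw [← lintegral_add_compl _ (measurableSet_Ioi (a := (0 : ℝ)))]
    congr 1
    rw [Set.compl_Ioi, ← restrict_Iio_eq_restrict_Iic, ← lintegral_indicator measurableSet_Iio,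
      ← lintegral_indicator measurableSet_Ioi, ← lintegral_neg_eq_self]
    refine lintegral_congr fun t => ?_
    by_cases ht : 0 < t
    · rw [Set.indicator_of_mem (by simpa using ht), Set.indicator_of_mem (by simpa using ht),
        abs_neg]
    · rw [Set.indicator_of_notMem (by simpa using ht), Set.indicator_of_notMem (by simpa using ht)]
  rw [hsplit, hhalf F a h1 h3, hhalf (fun t => F (-t)) b h2 fun t ht => h3 _ (by rwa [abs_neg]),
    add_mul]

/-- Integration over the unit sphere in the coordinates given by central projection onto a
tangent hyperplane. -/
theorem exists_lintegral_uniformSphere (p : ℕ) : ∃ C : ENNReal, C ≠ 0 ∧ C ≠ ⊤ ∧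
    ∀ (v : OrthonormalBasis (Fin (p + 1)) ℝ (EuclideanSpace ℝ (Fin (p + 1))))
      (f : EuclideanSpace ℝ (Fin (p + 1)) → ENNReal), Measurable f →
      (∀ r : ℝ, 0 < r → ∀ x, f (r • x) = f x) →
      ∫⁻ x, f x ∂(uniformSphere (p + 1)) =
        C * ∫⁻ τ : Fin p → ℝ, (f (tangentPoint v τ) + f (-tangentPoint v τ)) *
          ENNReal.ofReal ((√(1 + ∑ q, τ q ^ 2) ^ (p + 1))⁻¹) := by
  obtain ⟨C, hC0, hCt, hC⟩ := exists_lintegral_uniformSphere_eq_ball p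
  refine ⟨C * ENNReal.ofReal (1 / (p + 1)), mul_ne_zero hC0 ?_,
    ENNReal.mul_ne_top hCt ENNReal.ofReal_ne_top, fun v f hf hom => ?_⟩
  · rw [Ne, ENNReal.ofReal_eq_zero, not_le]; positivity
  rw [hC f hf hom, mul_assoc]
  congr 1
  set f₁ : (EuclideanSpace ℝ (Fin (p + 1))) → ENNReal := (Metric.ball (0 : (EuclideanSpace ℝ (Fin (p + 1)))) 1).indicator f with hf₁
  have hf₁m : Measurable f₁ := hf.indicator Metric.isOpen_ball.measurableSet
  rw [← lintegral_indicator Metric.isOpen_ball.measurableSet,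
    ← (v.measurePreserving_repr_symm).lintegral_comp hf₁m,
    ← (PiLp.volume_preserving_toLp (Fin (p + 1))).lintegral_comp
      (f := fun x => f₁ (v.repr.symm x)) (hf₁m.comp v.repr.symm.continuous.measurable),
    lintegral_pi_succ]
  swap
  · exact (hf₁m.comp v.repr.symm.continuous.measurable).comp (WithLp.measurable_toLp 2 _)
  -- On the slice with first coordinate `t`, the substitution `y = t τ` turns the point into `t •
  -- tangentPoint v τ`, with Jacobian `|t|^p`.
  have h1 : ∀ t : ℝ, t ≠ 0 → ∫⁻ y : Fin p → ℝ, f₁ (v.repr.symm (WithLp.toLp 2 (Fin.cons t y))) =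
      ∫⁻ τ : Fin p → ℝ, ENNReal.ofReal (|t| ^ p) * f₁ (t • tangentPoint v τ) := by
    intro t ht
    rw [lintegral_comp_smul_pi _ ht, ← lintegral_const_mul']
    · simp_rw [repr_symm_cons_smul]
    · exact ENNReal.ofReal_ne_top
  have h2 : ∫⁻ t : ℝ, ∫⁻ y : Fin p → ℝ, f₁ (v.repr.symm (WithLp.toLp 2 (Fin.cons t y))) =
      ∫⁻ t : ℝ, ∫⁻ τ : Fin p → ℝ, ENNReal.ofReal (|t| ^ p) * f₁ (t • tangentPoint v τ) := by
    refine lintegral_congr_ae ?_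
    filter_upwards [Measure.ae_ne volume (0 : ℝ)] with t ht
    exact h1 t ht
  refine h2.trans ?_
  rw [lintegral_lintegral_swap]
  swap
  · refine Measurable.aemeasurable ?_
    refine Measurable.mul (f := fun z : ℝ × (Fin p → ℝ) => ENNReal.ofReal (|z.1| ^ p))
      (by fun_prop) (hf₁m.comp ?_)
    exact (continuous_fst.smul ((continuous_tangentPoint v).comp continuous_snd)).measurable
  rw [← lintegral_const_mul']
  swap
  · exact ENNReal.ofReal_ne_top
  refine lintegral_congr fun τ => ?_
  set n : ℝ := √(1 + ∑ q, τ q ^ 2) with hn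
  have hn0 : 0 < n := Real.sqrt_pos.2 (by
    have : 0 ≤ ∑ q, τ q ^ 2 := Finset.sum_nonneg fun q _ => sq_nonneg _
    linarith)
  -- After the exchange of integrals the direction is fixed, and the unit ball restricts `t` to
  -- `|t|` below the inverse of the norm of the tangent point. Its power `p + 1` is the density.
  have hball : ∀ t : ℝ, t • tangentPoint v τ ∈ Metric.ball (0 : (EuclideanSpace ℝ (Fin (p + 1)))) 1 ↔ |t| < n⁻¹ := by
    intro t
    rw [mem_ball_zero_iff, norm_smul, norm_tangentPoint, ← hn, Real.norm_eq_abs, inv_eq_one_div,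
      lt_div_iff₀ hn0]
  rw [lintegral_radial (r := n⁻¹) (by positivity) p (fun t => f₁ (t • tangentPoint v τ))
    (f (tangentPoint v τ)) (f (-tangentPoint v τ))]
  · rw [mul_left_comm, ← ENNReal.ofReal_mul (by positivity)]
    congr 2
    rw [inv_pow]
    ring
  · intro t ht htr
    rw [hf₁, Set.indicator_of_mem ((hball t).2 (by rwa [abs_of_pos ht])), hom t ht]
  · intro t ht htr
    rw [hf₁, Set.indicator_of_mem ((hball (-t)).2 (by rwa [abs_neg, abs_of_pos ht])), neg_smul,
      ← smul_neg, hom t ht]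
  · intro t ht
    rw [hf₁, Set.indicator_of_notMem]
    rw [hball t]
    exact not_lt.2 ht

end Sphere

/-! ### The Gaussian weight under a diagonal change of variables. -/

section GaussianDensity

variable {p : ℕ}

theorem pi_withDensity_ofReal {f : Fin p → ℝ → ℝ} (hf : ∀ q, Integrable (f q))
    (hf0 : ∀ q x, 0 ≤ f q x) :
    Measure.pi (fun q => (volume : Measure ℝ).withDensity fun x => ENNReal.ofReal (f q x)) =
      (volume : Measure (Fin p → ℝ)).withDensity fun y => ENNReal.ofReal (∏ q, f q (y q)) := by
  refine Measure.pi_eq fun s hs => ?_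
  have h0 : ∀ y : Fin p → ℝ, 0 ≤ ∏ q, f q (y q) := fun y => Finset.prod_nonneg fun q _ => hf0 q _
  have hr : (volume : Measure (Fin p → ℝ)).restrict (Set.univ.pi s) =
      Measure.pi fun q => volume.restrict (s q) := by
    rw [volume_pi, Measure.restrict_pi_pi]
  have hint : Integrable (fun y : Fin p → ℝ => ∏ q, f q (y q)) :=
    Integrable.fintype_prod (μ := fun _ : Fin p => (volume : Measure ℝ)) hf
  rw [withDensity_apply _ (MeasurableSet.univ_pi hs),
    ← ofReal_integral_eq_lintegral_ofReal hint.integrableOn (Eventually.of_forall h0), hr,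
    integral_fintype_prod_eq_prod,
    ENNReal.ofReal_prod_of_nonneg fun q _ => integral_nonneg fun x => hf0 q x]
  refine Finset.prod_congr rfl fun q _ => ?_
  rw [withDensity_apply _ (hs q), ofReal_integral_eq_lintegral_ofReal (hf q).integrableOn
    (Eventually.of_forall (hf0 q))]

/-- The Gaussian integral over the preimage of a set under a diagonal map. -/
theorem exists_setIntegral_exp_eq_stdGauss {σ : Fin p → ℝ} (hσ : ∀ q, 0 < σ q) :
    ∃ K : ℝ, 0 < K ∧ ∀ B : Set (Fin p → ℝ), MeasurableSet B →
      ∫ y in {y : Fin p → ℝ | (fun q => σ q * y q) ∈ B},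
        Real.exp (-(1 / 2 * ∑ q, (σ q * y q) ^ 2)) = K * (stdGauss p).real B := by
  -- With variance `σ_q^{-2}`, multiplication by `σ_q` produces a standard Gaussian, and `K` is the
  -- product of the normalising constants.
  set v : Fin p → NNReal := fun q => ⟨(σ q ^ 2)⁻¹, by positivity⟩ with hv
  have hvpos : ∀ q, (0 : ℝ) < v q := fun q => by
    have := hσ q
    show (0 : ℝ) < (σ q ^ 2)⁻¹
    positivity
  have hv0 : ∀ q, v q ≠ 0 := fun q h => by
    have := hvpos q
    rw [h] at this
    simp at this
  set K : ℝ := ∏ q, √(2 * Real.pi * v q) with hK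
  have hK0 : 0 < K := Finset.prod_pos fun q _ => Real.sqrt_pos.2 (by
    have := hvpos q
    positivity)
  have hpdf : ∀ y : Fin p → ℝ, K * ∏ q, gaussianPDFReal 0 (v q) (y q) =
      Real.exp (-(1 / 2 * ∑ q, (σ q * y q) ^ 2)) := by
    intro y
    rw [hK, ← Finset.prod_mul_distrib, Finset.mul_sum, ← Finset.sum_neg_distrib, Real.exp_sum]
    refine Finset.prod_congr rfl fun q _ => ?_
    rw [gaussianPDFReal_def]
    have h1 : √(2 * Real.pi * v q) ≠ 0 := (Real.sqrt_pos.2 (by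
      have := hvpos q
      positivity)).ne'
    have h2 : (v q : ℝ) = (σ q ^ 2)⁻¹ := rfl
    rw [mul_inv_cancel_left₀ h1, h2]
    congr 1
    have := (hσ q).ne'
    field_simp
    ring
  have hmap : (Measure.pi fun q => gaussianReal 0 (v q)).map (fun y q => σ q * y q) =
      stdGauss p := by
    rw [Measure.pi_map_pi (f := fun q x => σ q * x) (fun q => by fun_prop)]
    congr 1
    ext q : 1
    rw [gaussianReal_map_const_mul]
    congr 1
    · simp
    · ext
      show σ q ^ 2 * (σ q ^ 2)⁻¹ = 1
      have := (hσ q).ne'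
      field_simp
  refine ⟨K, hK0, fun B hB => ?_⟩
  have hm : Measurable fun (y : Fin p → ℝ) q => σ q * y q := by fun_prop
  have hden : (Measure.pi fun q => gaussianReal 0 (v q)) =
      (volume : Measure (Fin p → ℝ)).withDensity fun y =>
        ENNReal.ofReal (∏ q, gaussianPDFReal 0 (v q) (y q)) := by
    rw [← pi_withDensity_ofReal (fun q => integrable_gaussianPDFReal 0 (v q))
      (fun q x => gaussianPDFReal_nonneg 0 (v q) x)]
    congr 1
    ext q : 1
    rw [gaussianReal_of_var_ne_zero _ (hv0 q)]
    rfl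
  have hint : Integrable (fun y : Fin p → ℝ => ∏ q, gaussianPDFReal 0 (v q) (y q)) :=
    Integrable.fintype_prod (μ := fun _ : Fin p => (volume : Measure ℝ))
      fun q => integrable_gaussianPDFReal 0 (v q)
  have h0 : ∀ y : Fin p → ℝ, 0 ≤ ∏ q, gaussianPDFReal 0 (v q) (y q) := fun y =>
    Finset.prod_nonneg fun q _ => gaussianPDFReal_nonneg _ _ _
  simp_rw [← hpdf]
  rw [integral_const_mul]
  congr 1
  rw [measureReal_def, ← hmap, Measure.map_apply hm hB, hden, withDensity_apply _ (hm hB),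
    ← ofReal_integral_eq_lintegral_ofReal hint.integrableOn (Eventually.of_forall h0),
    ENNReal.toReal_ofReal (integral_nonneg h0)]
  rfl

end GaussianDensity

/-! ### Singular bases of the matrix. -/

section EigenBasis

variable {p : ℕ} (A : Matrix (Fin (p + 1)) (Fin (p + 1)) ℝ)

theorem orderedEigenvalues_antitone : Antitone (orderedEigenvalues A) := by
  intro i j hij
  exact Matrix.IsHermitian.eigenvalues₀_antitone _ (by simpa using hij)

/-- An orthonormal basis of eigenvectors of `Aᵀ A`. -/
theorem exists_eigenbasis :
    ∃ v : OrthonormalBasis (Fin (p + 1)) ℝ (EuclideanSpace ℝ (Fin (p + 1))), ∀ q r,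
      inner ℝ (Matrix.toEuclideanLin A (v q)) (Matrix.toEuclideanLin A (v r)) =
        if q = r then orderedEigenvalues A q else 0 := by
  have hH : (A.transpose * A).IsHermitian := by
    simpa using Matrix.isHermitian_conjTranspose_mul_self A
  -- The eigenvector basis is indexed through an arbitrary enumeration of `Fin (p + 1)`; `e` brings
  -- it back to the decreasing order of the eigenvalues.
  set e : Fin (p + 1) ≃ Fin (p + 1) :=
    (finCongr (Fintype.card_fin (p + 1)).symm).trans
      (Fintype.equivOfCardEq (Fintype.card_fin _)) with he
  have hlam : ∀ q, orderedEigenvalues A q = hH.eigenvalues (e q) := by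
    intro q
    simp only [orderedEigenvalues, Matrix.IsHermitian.eigenvalues, he, Equiv.trans_apply,
      Equiv.symm_apply_apply]
    rfl
  refine ⟨hH.eigenvectorBasis.reindex e.symm, fun q r => ?_⟩
  set v := hH.eigenvectorBasis.reindex e.symm with hv
  have hAv : Matrix.toEuclideanLin (A.transpose * A) (v r) = orderedEigenvalues A r • v r := by
    rw [hlam, hv, OrthonormalBasis.reindex_apply, Equiv.symm_symm]
    have := hH.mulVec_eigenvectorBasis (e r)
    ext i
    have h2 := congrFun this i
    simpa [Matrix.toLpLin_apply] using h2
  have hadj : inner ℝ (Matrix.toEuclideanLin A (v q)) (Matrix.toEuclideanLin A (v r)) =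
      inner ℝ (v q) (Matrix.toEuclideanLin (A.transpose * A) (v r)) := by
    have h1 : Matrix.toEuclideanLin A.transpose = (Matrix.toEuclideanLin A).adjoint := by
      rw [← Matrix.toEuclideanLin_conjTranspose_eq_adjoint, Matrix.conjTranspose_eq_transpose_of_trivial]
    rw [← LinearMap.adjoint_inner_right, ← h1]
    congr 1
    ext i
    simp [Matrix.toLpLin_apply]
  rw [hadj, hAv, inner_smul_right, v.inner_eq_ite]
  split_ifs with h
  · rw [h, mul_one]
  · rw [mul_zero]

theorem toEuclideanLin_injective {A : Matrix (Fin (p + 1)) (Fin (p + 1)) ℝ} (hA : IsUnit A.det) :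
    Function.Injective (Matrix.toEuclideanLin A) := by
  intro x y hxy
  have h1 : A.mulVec x = A.mulVec y := by
    have := congrArg WithLp.ofLp hxy
    simpa [Matrix.toLpLin_apply] using this
  have h2 := Matrix.mulVec_injective_iff_isUnit.2 ((Matrix.isUnit_iff_isUnit_det A).2 hA) h1
  ext i
  exact congrFun h2 i

theorem orderedEigenvalues_pos {A : Matrix (Fin (p + 1)) (Fin (p + 1)) ℝ} (hA : IsUnit A.det)
    (q : Fin (p + 1)) : 0 < orderedEigenvalues A q := by
  obtain ⟨v, hv⟩ := exists_eigenbasis A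
  have h1 := hv q q
  rw [if_pos rfl, real_inner_self_eq_norm_sq] at h1
  rw [← h1]
  have h2 : Matrix.toEuclideanLin A (v q) ≠ 0 := by
    rw [Ne, map_eq_zero_iff _ (toEuclideanLin_injective hA)]
    exact v.toBasis.ne_zero q |> fun h => by simpa using h
  positivity

/-- Singular value decomposition: orthonormal bases `v`, `u` with `A v_q = √λ_q u_q`. -/
theorem exists_singularBases {A : Matrix (Fin (p + 1)) (Fin (p + 1)) ℝ} (hA : IsUnit A.det) :
    ∃ v u : OrthonormalBasis (Fin (p + 1)) ℝ (EuclideanSpace ℝ (Fin (p + 1))), ∀ w q,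
      u.repr (Matrix.toEuclideanLin A w) q = √(orderedEigenvalues A q) * v.repr w q := by
  obtain ⟨v, hv⟩ := exists_eigenbasis A
  have hpos := orderedEigenvalues_pos hA
  set f : Fin (p + 1) → EuclideanSpace ℝ (Fin (p + 1)) := fun q =>
    (√(orderedEigenvalues A q))⁻¹ • Matrix.toEuclideanLin A (v q) with hf
  have hon : Orthonormal ℝ f := by
    rw [orthonormal_iff_ite]
    intro q r
    rw [hf, inner_smul_left, inner_smul_right, hv q r]
    split_ifs with h
    · subst h
      have h1 := Real.sqrt_pos.2 (hpos q)
      have h2 := Real.mul_self_sqrt (hpos q).le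
      simp only [conj_trivial]
      rw [← mul_assoc, ← mul_inv, h2, inv_mul_cancel₀ (hpos q).ne']
    · simp
  set u := (basisOfOrthonormalOfCardEqFinrank hon (by simp)).toOrthonormalBasis
    (by simpa using hon) with hu
  have hu' : ∀ q, u q = f q := fun q => by simp [hu]
  refine ⟨v, u, fun w q => ?_⟩
  have hAv : ∀ r, Matrix.toEuclideanLin A (v r) = √(orderedEigenvalues A r) • u r := fun r => by
    rw [hu', hf]
    simp only
    rw [smul_smul, mul_inv_cancel₀ (Real.sqrt_pos.2 (hpos r)).ne', one_smul]
  conv_lhs => rw [← v.sum_repr w]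
  simp only [map_sum, map_smul, hAv]
  simp [OrthonormalBasis.repr_self, Pi.single_apply, mul_comm]

end EigenBasis

/-! ### The density of the projection and the ratio of norms. -/

section Intensity

variable {p : ℕ}

/-- The density of the central projection of the uniform law on the sphere, up to a constant. -/
noncomputable def projDensity (τ : Fin p → ℝ) : ℝ := (√(1 + ∑ q, τ q ^ 2) ^ (p + 1))⁻¹

/-- The ratio of the norm of the point with projective coordinates `τ` to the norm of its image
under the diagonal matrix with squared singular values `1, ρ`. -/
noncomputable def normRatio (ρ τ : Fin p → ℝ) : ℝ :=
  √((1 + ∑ q, τ q ^ 2) / (1 + ∑ q, ρ q * τ q ^ 2))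

theorem projDensity_nonneg (τ : Fin p → ℝ) : 0 ≤ projDensity τ := by
  unfold projDensity; positivity

theorem sum_sq_nonneg' (τ : Fin p → ℝ) : 0 ≤ ∑ q, τ q ^ 2 :=
  Finset.sum_nonneg fun _ _ => sq_nonneg _

theorem continuous_projDensity : Continuous (projDensity (p := p)) := by
  unfold projDensity
  refine Continuous.inv₀ (by fun_prop) fun τ => ?_
  have := sum_sq_nonneg' τ
  positivity

theorem measurable_normRatio (ρ : Fin p → ℝ) : Measurable (normRatio ρ) := by
  unfold normRatio
  fun_prop

/-- Applied to the constant function one, the projection formula bounds this integral by the finite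
total mass of the sphere; no estimate of the density is needed. -/
theorem integrable_projDensity : Integrable (projDensity (p := p)) := by
  refine ⟨continuous_projDensity.aestronglyMeasurable, ?_⟩
  obtain ⟨C, hC0, hCt, hC⟩ := exists_lintegral_uniformSphere p
  have h1 := hC (EuclideanSpace.basisFun _ ℝ) (fun _ => 1) measurable_const fun _ _ _ => rfl
  rw [hasFiniteIntegral_iff_ofReal (Eventually.of_forall projDensity_nonneg)]
  have h2 : ∫⁻ _, 1 ∂uniformSphere (p + 1) < ⊤ := by
    rw [lintegral_one, uniformSphere, Measure.map_apply measurable_subtype_coe .univ]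
    exact measure_lt_top _ _
  rw [h1] at h2
  have h3 := ENNReal.lt_top_of_mul_ne_top_right h2.ne hC0
  refine lt_of_le_of_lt (lintegral_mono fun τ => ?_) h3
  exact le_mul_of_one_le_left zero_le (by norm_num)

variable {ρ : Fin p → ℝ}

theorem one_add_rho_pos (hρ : ∀ q, 0 < ρ q) (τ : Fin p → ℝ) : 0 < 1 + ∑ q, ρ q * τ q ^ 2 := by
  have : 0 ≤ ∑ q, ρ q * τ q ^ 2 := Finset.sum_nonneg fun q _ => mul_nonneg (hρ q).le (sq_nonneg _)
  linarith

theorem normRatio_sq (hρ : ∀ q, 0 < ρ q) (τ : Fin p → ℝ) :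
    normRatio ρ τ ^ 2 = (1 + ∑ q, τ q ^ 2) / (1 + ∑ q, ρ q * τ q ^ 2) :=
  Real.sq_sqrt (div_nonneg (by linarith [sum_sq_nonneg' τ]) (one_add_rho_pos hρ τ).le)

theorem normRatio_sq_sub_one (hρ : ∀ q, 0 < ρ q) (τ : Fin p → ℝ) :
    normRatio ρ τ ^ 2 - 1 = (∑ q, (1 - ρ q) * τ q ^ 2) / (1 + ∑ q, ρ q * τ q ^ 2) := by
  have h := (one_add_rho_pos hρ τ).ne'
  rw [normRatio_sq hρ, eq_div_iff h, sub_mul, div_mul_cancel₀ _ h]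
  simp only [sub_mul, one_mul, Finset.sum_sub_distrib]
  ring

theorem one_le_normRatio (hρ : ∀ q, 0 < ρ q) (hρ1 : ∀ q, ρ q < 1) (τ : Fin p → ℝ) :
    1 ≤ normRatio ρ τ := by
  have h1 : 0 ≤ normRatio ρ τ ^ 2 - 1 := by
    rw [normRatio_sq_sub_one hρ]
    refine div_nonneg (Finset.sum_nonneg fun q _ => ?_) (one_add_rho_pos hρ τ).le
    exact mul_nonneg (by linarith [hρ1 q]) (sq_nonneg _)
  have h2 : 0 ≤ normRatio ρ τ := Real.sqrt_nonneg _
  nlinarith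

theorem exists_pos_le_forall {f : Fin p → ℝ} (hf : ∀ q, 0 < f q) :
    ∃ c : ℝ, 0 < c ∧ c ≤ 1 ∧ ∀ q, c ≤ f q := by
  have h1 : ∀ᶠ c : ℝ in 𝓝[>] 0, ∀ q, c ≤ f q :=
    eventually_all.2 fun q => (nhdsWithin_le_nhds (eventually_le_nhds (hf q)))
  have h3 : ∀ᶠ ε : ℝ in 𝓝[>] 0, ε ∈ Set.Ioc (0 : ℝ) 1 := Ioc_mem_nhdsGT one_pos
  obtain ⟨c, hc, hc'⟩ := (h1.and h3).exists
  exact ⟨c, hc'.1, hc'.2, hc⟩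

theorem exists_normRatio_le (hρ : ∀ q, 0 < ρ q) : ∃ M : ℝ, 1 ≤ M ∧ ∀ τ, normRatio ρ τ ≤ M := by
  obtain ⟨c, hc, hc1, hcρ⟩ := exists_pos_le_forall hρ
  refine ⟨c⁻¹, (one_le_inv₀ hc).2 hc1, fun τ => ?_⟩
  have h1 : normRatio ρ τ ^ 2 ≤ c⁻¹ := by
    rw [normRatio_sq hρ, div_le_iff₀ (one_add_rho_pos hρ τ), ← div_eq_inv_mul, le_div_iff₀ hc]
    have : (∑ q, τ q ^ 2) * c ≤ ∑ q, ρ q * τ q ^ 2 := by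
      rw [Finset.sum_mul]
      exact Finset.sum_le_sum fun q _ => by nlinarith [hcρ q, sq_nonneg (τ q)]
    nlinarith
  have h2 : (1 : ℝ) ≤ c⁻¹ := (one_le_inv₀ hc).2 hc1
  nlinarith [Real.sqrt_nonneg ((1 + ∑ q, τ q ^ 2) / (1 + ∑ q, ρ q * τ q ^ 2)), sq_nonneg (normRatio ρ τ - 1)]

/-- A quadratic lower bound for `normRatio - 1`. -/
theorem exists_le_normRatio_sub_one (hρ : ∀ q, 0 < ρ q) (hρ1 : ∀ q, ρ q < 1) :
    ∃ c : ℝ, 0 < c ∧ c ≤ 1 ∧ ∀ τ,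
      c * ((∑ q, τ q ^ 2) / (1 + ∑ q, τ q ^ 2)) ≤ normRatio ρ τ - 1 := by
  obtain ⟨δ, hδ, hδ1, hδρ⟩ := exists_pos_le_forall (f := fun q => 1 - ρ q)
    fun q => by linarith [hρ1 q]
  obtain ⟨M, hM1, hM⟩ := exists_normRatio_le hρ
  refine ⟨δ / (M + 1), by positivity, by rw [div_le_one (by positivity)]; linarith, fun τ => ?_⟩
  have h0 := sum_sq_nonneg' τ
  have h1 : δ * ((∑ q, τ q ^ 2) / (1 + ∑ q, τ q ^ 2)) ≤ normRatio ρ τ ^ 2 - 1 := by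
    rw [normRatio_sq_sub_one hρ, mul_div_assoc']
    have e1 : δ * ∑ q, τ q ^ 2 ≤ ∑ q, (1 - ρ q) * τ q ^ 2 := by
      rw [Finset.mul_sum]
      exact Finset.sum_le_sum fun q _ => mul_le_mul_of_nonneg_right (hδρ q) (sq_nonneg _)
    have e2 : ∑ q, ρ q * τ q ^ 2 ≤ ∑ q, τ q ^ 2 :=
      Finset.sum_le_sum fun q _ => by nlinarith [hρ1 q, sq_nonneg (τ q)]
    have e3 : 0 ≤ δ * ∑ q, τ q ^ 2 := by positivity
    exact div_le_div₀ (e3.trans e1) e1 (one_add_rho_pos hρ τ) (by linarith)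
  have h2 := one_le_normRatio hρ hρ1 τ
  have h3 : normRatio ρ τ ^ 2 - 1 ≤ (normRatio ρ τ - 1) * (M + 1) := by nlinarith [hM τ]
  have h4 := h1.trans h3
  rw [div_mul_eq_mul_div, div_le_iff₀ (by positivity)]
  exact h4

/-- Since `R - 1 = (R² - 1) / (R + 1)` and `R² - 1` is explicit, `R - 1` is asymptotically `½ h² ∑
(1 - ρ_q) y_q²`. The combination with `c R` is the one that appears when `(α + ψ c) R` is written as
`α + ψ (c R + (R - 1) / h²)` with `h² = ψ / α`. -/
theorem tendsto_normRatio_smul (hρ : ∀ q, 0 < ρ q) {h : ℕ → ℝ} (hpos : ∀ᶠ n in atTop, 0 < h n)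
    (h0 : Tendsto h atTop (𝓝 0)) (c : ℝ) (y : Fin p → ℝ) :
    Tendsto (fun n => c * normRatio ρ (h n • y) + (normRatio ρ (h n • y) - 1) / h n ^ 2) atTop
      (𝓝 (c + 1 / 2 * ∑ q, (1 - ρ q) * y q ^ 2)) := by
  have hcont : Continuous fun t : ℝ => normRatio ρ (t • y) := by
    unfold normRatio
    refine Real.continuous_sqrt.comp (Continuous.div ?_ ?_ fun t =>
      (one_add_rho_pos hρ (t • y)).ne')
    · simp only [Pi.smul_apply]; fun_prop
    · simp only [Pi.smul_apply]; fun_prop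
  have hR : Tendsto (fun n => normRatio ρ (h n • y)) atTop (𝓝 1) := by
    have h1 := (hcont.tendsto 0).comp h0
    simpa [normRatio, Function.comp_def] using h1
  have hden : Tendsto (fun n => 1 + ∑ q, ρ q * (h n • y) q ^ 2) atTop (𝓝 1) := by
    have hc : Continuous fun t : ℝ => 1 + ∑ q, ρ q * (t • y) q ^ 2 := by
      simp only [Pi.smul_apply]; fun_prop
    have h1 := (hc.tendsto 0).comp h0
    simpa [Function.comp_def] using h1
  have h2 : Tendsto (fun n => (∑ q, (1 - ρ q) * y q ^ 2) /
      ((1 + ∑ q, ρ q * (h n • y) q ^ 2) * (normRatio ρ (h n • y) + 1))) atTop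
      (𝓝 ((∑ q, (1 - ρ q) * y q ^ 2) / (1 * (1 + 1)))) :=
    tendsto_const_nhds.div (hden.mul (hR.add_const 1)) (by norm_num)
  have h3 : Tendsto (fun n => (normRatio ρ (h n • y) - 1) / h n ^ 2) atTop
      (𝓝 ((∑ q, (1 - ρ q) * y q ^ 2) / (1 * (1 + 1)))) := by
    refine h2.congr' ?_
    filter_upwards [hpos] with n hn
    have e1 := normRatio_sq_sub_one hρ (h n • y)
    have e2 : ∑ q, (1 - ρ q) * (h n • y) q ^ 2 = h n ^ 2 * ∑ q, (1 - ρ q) * y q ^ 2 := by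
      rw [Finset.mul_sum]
      refine Finset.sum_congr rfl fun q _ => ?_
      simp only [Pi.smul_apply, smul_eq_mul]
      ring
    have e3 := one_add_rho_pos hρ (h n • y)
    have e4 : 0 < normRatio ρ (h n • y) + 1 := by
      have : 0 ≤ normRatio ρ (h n • y) := Real.sqrt_nonneg _
      linarith
    rw [e2, eq_div_iff e3.ne'] at e1
    rw [div_eq_div_iff (by positivity) (by positivity)]
    linear_combination -e1
  have h4 := (hR.const_mul c).add h3
  convert h4 using 2
  ring

end Intensity

/-! ### Domination and the limit of the rescaled integrals. -/

section Domination

variable {p : ℕ} {ρ : Fin p → ℝ} {Ω : Type*} [MeasurableSpace Ω] {P : Measure Ω}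
  [IsProbabilityMeasure P] {T : Ω → ℝ} {ψ : ℝ → ℝ}

/-- Let `S = |y|²` and `V = (1 + S) / (1 + h² S)`. The quadratic lower bound on the norm ratio makes
the shifted threshold at least a multiple of `V`, so the polynomial tail bound with exponent `p + 1`
decays at least like `√V^{-(p+1)}`. This factor is exactly what converts `projDensity (h • y)` into
the fixed integrable function `projDensity y`. -/
theorem exists_domination (hρ : ∀ q, 0 < ρ q) (hρ1 : ∀ q, ρ q < 1)
    (hψ : IsGumbelAuxiliary P T ψ) {α h : ℕ → ℝ} (hα : Tendsto α atTop atTop)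
    (hpos : ∀ᶠ n in atTop, 0 < h n) (h0 : Tendsto h atTop (𝓝 0))
    (hh : ∀ᶠ n in atTop, h n ^ 2 = ψ (α n) / α n) (c : ℝ) :
    ∃ C : ℝ, ∀ᶠ n in atTop, ∀ y : Fin p → ℝ,
      tailProb P T ((α n + ψ (α n) * c) * normRatio ρ (h n • y)) / tailProb P T (α n) *
        projDensity (h n • y) ≤ C * projDensity y := by
  obtain ⟨M, hM1, hM⟩ := exists_normRatio_le hρ
  obtain ⟨c₀, hc₀, hc₀1, hR⟩ := exists_le_normRatio_sub_one hρ hρ1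
  obtain ⟨C, hC, hev⟩ := hψ.exists_tailProb_le_pow_of_neg_le (p + 1) (c := |c| * M) (by positivity)
  refine ⟨C * (c₀⁻¹) ^ (p + 1), ?_⟩
  filter_upwards [hα.eventually hev, hpos, h0.eventually_lt_const one_pos, hh,
    hα.eventually_gt_atTop 0] with n hn hhn hhn1 hhn2 hαn y
  set R := normRatio ρ (h n • y) with hRdef
  have hR1 : 1 ≤ R := one_le_normRatio hρ hρ1 _
  set s : ℝ := c * R + (R - 1) / h n ^ 2 with hs
  have hψα : ψ (α n) = h n ^ 2 * α n := by rw [hhn2]; field_simp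
  have harg : (α n + ψ (α n) * c) * R = α n + ψ (α n) * s := by
    rw [hs, hψα]
    field_simp
    ring
  set S : ℝ := ∑ q, y q ^ 2 with hS
  have hS0 : 0 ≤ S := sum_sq_nonneg' y
  have hSh : ∑ q, (h n • y) q ^ 2 = h n ^ 2 * S := by
    rw [hS, Finset.mul_sum]
    refine Finset.sum_congr rfl fun q _ => ?_
    simp only [Pi.smul_apply, smul_eq_mul]
    ring
  have hRlow : c₀ * (S / (1 + h n ^ 2 * S)) ≤ (R - 1) / h n ^ 2 := by
    have h1 := hR (h n • y)
    rw [hSh] at h1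
    rw [le_div_iff₀ (by positivity)]
    refine le_trans (le_of_eq ?_) h1
    field_simp
  have hcR : -(|c| * M) ≤ c * R := by
    have h1 : |c * R| ≤ |c| * M := by
      rw [abs_mul, abs_of_nonneg (by linarith : 0 ≤ R)]
      exact mul_le_mul_of_nonneg_left (hM _) (abs_nonneg c)
    linarith [neg_abs_le (c * R)]
  have hfrac : 0 ≤ S / (1 + h n ^ 2 * S) := by positivity
  have hsge : -(|c| * M) ≤ s := by
    have : 0 ≤ c₀ * (S / (1 + h n ^ 2 * S)) := by positivity
    linarith
  have hF := hψ.tailProb_pos (α n)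
  have h1 := hn s hsge
  rw [← harg] at h1
  have h2 : c₀ * ((1 + S) / (1 + h n ^ 2 * S)) ≤ 1 + |c| * M + s := by
    have e1 : (1 + S) / (1 + h n ^ 2 * S) ≤ 1 + S / (1 + h n ^ 2 * S) := by
      rw [add_div]
      gcongr
      rw [div_le_one (by positivity)]
      have : 0 ≤ h n ^ 2 * S := by positivity
      linarith
    have e2 := mul_le_mul_of_nonneg_left e1 hc₀.le
    nlinarith
  set V : ℝ := (1 + S) / (1 + h n ^ 2 * S) with hV
  have hV1 : 1 ≤ V := by
    rw [hV, le_div_iff₀ (by positivity)]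
    have : h n ^ 2 ≤ 1 := by nlinarith
    nlinarith
  have hden : (0 : ℝ) < (1 + |c| * M + s) ^ (p + 1) := by
    have : 0 < c₀ * V := by positivity
    have := this.trans_le h2
    positivity
  have h3 : ((1 + |c| * M + s) ^ (p + 1))⁻¹ ≤ c₀⁻¹ ^ (p + 1) * (√V ^ (p + 1))⁻¹ := by
    rw [← inv_pow √V, ← mul_pow, ← inv_pow]
    refine pow_le_pow_left₀ (inv_nonneg.2 (by nlinarith)) ?_ _
    rw [← mul_inv]
    -- Here `V ≥ 1`, so replacing `V` by `√V` only weakens the bound.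
    refine inv_anti₀ (by positivity) (le_trans ?_ h2)
    refine mul_le_mul_of_nonneg_left ?_ hc₀.le
    rw [Real.sqrt_le_left (by linarith)]
    nlinarith
  have h4 : (√V ^ (p + 1))⁻¹ * projDensity (h n • y) = projDensity y := by
    rw [projDensity, projDensity, hSh, ← mul_inv, ← mul_pow, ← Real.sqrt_mul (by linarith), hV,
      div_mul_cancel₀ _ (by positivity)]
  have h5 : tailProb P T ((α n + ψ (α n) * c) * R) / tailProb P T (α n) ≤
      C * (c₀⁻¹ ^ (p + 1) * (√V ^ (p + 1))⁻¹) := by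
    rw [div_le_iff₀ hF]
    calc _ ≤ C * tailProb P T (α n) * ((1 + |c| * M + s) ^ (p + 1))⁻¹ := h1
      _ ≤ C * tailProb P T (α n) * (c₀⁻¹ ^ (p + 1) * (√V ^ (p + 1))⁻¹) := by gcongr
      _ = _ := by ring
  calc _ ≤ C * (c₀⁻¹ ^ (p + 1) * (√V ^ (p + 1))⁻¹) * projDensity (h n • y) :=
        mul_le_mul_of_nonneg_right h5 (projDensity_nonneg _)
    _ = C * c₀⁻¹ ^ (p + 1) * ((√V ^ (p + 1))⁻¹ * projDensity (h n • y)) := by ring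
    _ = _ := by rw [h4]

/-- The limit of the normalised intensity, in projective coordinates. -/
theorem tendsto_setIntegral_tailProb (hρ : ∀ q, 0 < ρ q) (hρ1 : ∀ q, ρ q < 1)
    (hψ : IsGumbelAuxiliary P T ψ) {α h : ℕ → ℝ} (hα : Tendsto α atTop atTop)
    (hpos : ∀ᶠ n in atTop, 0 < h n) (h0 : Tendsto h atTop (𝓝 0))
    (hh : ∀ᶠ n in atTop, h n ^ 2 = ψ (α n) / α n) (c : ℝ) (S : Set (Fin p → ℝ)) :
    Tendsto (fun n => ∫ y in S,
      tailProb P T ((α n + ψ (α n) * c) * normRatio ρ (h n • y)) / tailProb P T (α n) *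
        projDensity (h n • y)) atTop
      (𝓝 (∫ y in S, Real.exp (-(c + 1 / 2 * ∑ q, (1 - ρ q) * y q ^ 2)))) := by
  obtain ⟨C, hC⟩ := exists_domination hρ hρ1 hψ hα hpos h0 hh c
  refine tendsto_integral_filter_of_dominated_convergence (fun y => C * projDensity y) ?_ ?_ ?_ ?_
  · refine Eventually.of_forall fun n => Measurable.aestronglyMeasurable ?_
    have hm : Measurable (tailProb P T) := tailProb_antitone.measurable
    have h1 : Measurable fun y : Fin p → ℝ => h n • y := by fun_prop
    exact ((hm.comp (((measurable_normRatio ρ).comp h1).const_mul _)).div_const _).mul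
      (continuous_projDensity.measurable.comp h1)
  · filter_upwards [hC] with n hn
    refine Eventually.of_forall fun y => ?_
    rw [Real.norm_of_nonneg]
    · exact hn y
    · exact mul_nonneg (div_nonneg (tailProb_nonneg _) (tailProb_nonneg _)) (projDensity_nonneg _)
  · exact (integrable_projDensity.const_mul C).integrableOn
  · refine Eventually.of_forall fun y => ?_
    have h1 := hψ.tendsto_ratio_comp hα (tendsto_normRatio_smul hρ hpos h0 c y)
    have h2 : Tendsto (fun n => projDensity (h n • y)) atTop (𝓝 1) := by
      have hc : Continuous fun t : ℝ => projDensity (t • y) :=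
        continuous_projDensity.comp (by fun_prop)
      have := (hc.tendsto 0).comp h0
      simpa [projDensity, Function.comp_def] using this
    have h3 := h1.mul h2
    rw [mul_one] at h3
    refine h3.congr' ?_
    filter_upwards [hpos, hh, hα.eventually_gt_atTop 0] with n hn hhn hαn
    have hψα : ψ (α n) = h n ^ 2 * α n := by rw [hhn]; field_simp
    congr 3
    rw [hψα]
    field_simp
    ring

end Domination

/-! ### Distances between nearly opposite vectors. -/

section Geometry

variable {p : ℕ}

/-- The projective coordinates of a vector. -/
noncomputable def projCoord (x : EuclideanSpace ℝ (Fin (p + 1))) (q : Fin p) : ℝ := x q.succ / x 0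

theorem measurable_projCoord : Measurable (projCoord (p := p)) := by
  unfold projCoord
  fun_prop

theorem inner_eq_projCoord {x y : EuclideanSpace ℝ (Fin (p + 1))} (hx : x 0 ≠ 0) (hy : y 0 ≠ 0) :
    inner ℝ x y = x 0 * y 0 * (1 + ∑ q, projCoord x q * projCoord y q) := by
  rw [PiLp.inner_apply, Fin.sum_univ_succ, mul_add, Finset.mul_sum]
  congr 1
  · simp [mul_comm]
  · refine Finset.sum_congr rfl fun q _ => ?_
    simp only [projCoord, RCLike.inner_apply, conj_trivial]
    field_simp

theorem norm_eq_projCoord {x : EuclideanSpace ℝ (Fin (p + 1))} (hx : x 0 ≠ 0) :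
    ‖x‖ = |x 0| * √(1 + ∑ q, projCoord x q ^ 2) := by
  rw [norm_eq_sqrt_real_inner, inner_eq_projCoord hx hx, Real.sqrt_mul (mul_self_nonneg _),
    Real.sqrt_mul_self_eq_abs]
  simp only [sq]

/-- The defect `1 + cos` of the angle between two nearly opposite vectors with projective
coordinates `h ζ` and `h ζ'`, divided by `h²`. -/
noncomputable def angleDefect (h : ℝ) (ζ ζ' : Fin p → ℝ) : ℝ :=
  (∑ q, (ζ q - ζ' q) ^ 2 + h ^ 2 * ((∑ q, ζ q ^ 2) * (∑ q, ζ' q ^ 2) - (∑ q, ζ q * ζ' q) ^ 2)) /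
    (√(1 + h ^ 2 * ∑ q, ζ q ^ 2) * √(1 + h ^ 2 * ∑ q, ζ' q ^ 2) *
      (√(1 + h ^ 2 * ∑ q, ζ q ^ 2) * √(1 + h ^ 2 * ∑ q, ζ' q ^ 2) + (1 + h ^ 2 * ∑ q, ζ q * ζ' q)))

/-- The defect in the triangle inequality for nearly opposite vectors of norms `1 + h² u`,
`1 + h² u'` and projective coordinates `h ζ`, `h ζ'`, divided by `h²`. -/
noncomputable def triangleDefect (h u u' : ℝ) (ζ ζ' : Fin p → ℝ) : ℝ :=
  2 * ((1 + h ^ 2 * u) * (1 + h ^ 2 * u')) * angleDefect h ζ ζ' /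
    (2 + h ^ 2 * (u + u') + √((2 + h ^ 2 * (u + u')) ^ 2 -
      2 * ((1 + h ^ 2 * u) * (1 + h ^ 2 * u')) * (h ^ 2 * angleDefect h ζ ζ')))

/-- Let `S` be the product of the square roots and `C` the inner product of `ζ` and `ζ'`. Then `S² -
(1 + h² C)²` is `h²` times the numerator of the defect. Writing `S - (1 + h² C)` through its
conjugate gives a form without division by `h`, hence continuous at `h = 0`. -/
theorem sq_mul_angleDefect (h : ℝ) (ζ ζ' : Fin p → ℝ) :
    √(1 + h ^ 2 * ∑ q, ζ q ^ 2) * √(1 + h ^ 2 * ∑ q, ζ' q ^ 2) * (1 - h ^ 2 * angleDefect h ζ ζ') =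
      1 + h ^ 2 * ∑ q, ζ q * ζ' q := by
  have hA : 0 ≤ ∑ q, ζ q ^ 2 := sum_sq_nonneg' ζ
  have hB : 0 ≤ ∑ q, ζ' q ^ 2 := sum_sq_nonneg' ζ'
  have hC := Finset.sum_mul_sq_le_sq_mul_sq Finset.univ ζ ζ'
  have hsum : ∑ q, (ζ q - ζ' q) ^ 2 = ∑ q, ζ q ^ 2 + ∑ q, ζ' q ^ 2 - 2 * ∑ q, ζ q * ζ' q := by
    rw [Finset.mul_sum, ← Finset.sum_add_distrib, ← Finset.sum_sub_distrib]
    exact Finset.sum_congr rfl fun q _ => by ring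
  unfold angleDefect
  rw [hsum]
  set A := ∑ q, ζ q ^ 2
  set B := ∑ q, ζ' q ^ 2
  set C := ∑ q, ζ q * ζ' q
  set S := √(1 + h ^ 2 * A) * √(1 + h ^ 2 * B) with hS
  have hS2 : S ^ 2 = (1 + h ^ 2 * A) * (1 + h ^ 2 * B) := by
    rw [hS, mul_pow, Real.sq_sqrt (by positivity), Real.sq_sqrt (by positivity)]
  have hS0 : 0 < S := by positivity
  -- Cauchy–Schwarz gives `|h² C| ≤ S`, so the conjugate is bounded below by one.
  have hSC : 0 < S + (1 + h ^ 2 * C) := by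
    have h1 : (h ^ 2 * C) ^ 2 ≤ S ^ 2 := by
      rw [hS2]
      have h2 : (h ^ 2 * C) ^ 2 ≤ h ^ 2 * A * (h ^ 2 * B) := by
        calc (h ^ 2 * C) ^ 2 = h ^ 4 * C ^ 2 := by ring
          _ ≤ h ^ 4 * (A * B) := by gcongr
          _ = _ := by ring
      have h3 : 0 ≤ h ^ 2 * A := by positivity
      have h4 : 0 ≤ h ^ 2 * B := by positivity
      nlinarith
    have := abs_le_of_sq_le_sq' h1 hS0.le
    linarith
  field_simp
  linear_combination hS2

theorem norm_sub_sq_eq {h a u u' : ℝ} {ζ ζ' : Fin p → ℝ} {x y : EuclideanSpace ℝ (Fin (p + 1))}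
    (hx : 0 < x 0) (hy : y 0 < 0) (hxu : ‖x‖ = a * (1 + h ^ 2 * u))
    (hyu : ‖y‖ = a * (1 + h ^ 2 * u')) (hxs : ∀ q, projCoord x q = h * ζ q)
    (hys : ∀ q, projCoord y q = h * ζ' q) :
    ‖x - y‖ ^ 2 = a ^ 2 * ((2 + h ^ 2 * (u + u')) ^ 2 -
      2 * ((1 + h ^ 2 * u) * (1 + h ^ 2 * u')) * (h ^ 2 * angleDefect h ζ ζ')) := by
  have e1 : ∑ q, projCoord x q * projCoord y q = h ^ 2 * ∑ q, ζ q * ζ' q := by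
    rw [Finset.mul_sum]
    exact Finset.sum_congr rfl fun q _ => by rw [hxs, hys]; ring
  have e2 : ∑ q, projCoord x q ^ 2 = h ^ 2 * ∑ q, ζ q ^ 2 := by
    rw [Finset.mul_sum]
    exact Finset.sum_congr rfl fun q _ => by rw [hxs]; ring
  have e3 : ∑ q, projCoord y q ^ 2 = h ^ 2 * ∑ q, ζ' q ^ 2 := by
    rw [Finset.mul_sum]
    exact Finset.sum_congr rfl fun q _ => by rw [hys]; ring
  have h1 : inner ℝ x y = -(‖x‖ * ‖y‖ * (1 - h ^ 2 * angleDefect h ζ ζ')) := by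
    rw [inner_eq_projCoord hx.ne' hy.ne, norm_eq_projCoord hx.ne', norm_eq_projCoord hy.ne, e1, e2, e3,
      ← sq_mul_angleDefect, abs_of_pos hx, abs_of_neg hy]
    ring
  rw [norm_sub_sq_real, h1, hxu, hyu]
  ring

/-- The law of cosines gives the squared distance. The difference between `2 + h² (u + u')` and its
square root is rationalised, which cancels the factor `h²` exactly and leaves an expression regular
at `h = 0`. -/
theorem dist_eq_triangleDefect {h a u u' : ℝ} (hh : 0 < h) (ha : 0 < a) {ζ ζ' : Fin p → ℝ}
    {x y : EuclideanSpace ℝ (Fin (p + 1))}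
    (hx : 0 < x 0) (hy : y 0 < 0) (hxu : ‖x‖ = a * (1 + h ^ 2 * u))
    (hyu : ‖y‖ = a * (1 + h ^ 2 * u')) (hxs : ∀ q, projCoord x q = h * ζ q)
    (hys : ∀ q, projCoord y q = h * ζ' q) :
    (‖x - y‖ - 2 * a) / (h ^ 2 * a) = u + u' - triangleDefect h u u' ζ ζ' := by
  have h1 := norm_sub_sq_eq hx hy hxu hyu hxs hys
  unfold triangleDefect
  set κ := angleDefect h ζ ζ'
  set δ2 := (2 + h ^ 2 * (u + u')) ^ 2 - 2 * ((1 + h ^ 2 * u) * (1 + h ^ 2 * u')) * (h ^ 2 * κ)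
    with hδ2
  have hδ : ‖x - y‖ = a * √δ2 := by
    rw [← Real.sqrt_sq (norm_nonneg (x - y)), h1, Real.sqrt_mul (sq_nonneg _), Real.sqrt_sq ha.le]
  have hδ0 : 0 ≤ δ2 := by
    have h2 : 0 ≤ a ^ 2 * δ2 := h1 ▸ sq_nonneg _
    exact nonneg_of_mul_nonneg_right h2 (by positivity)
  have hs : 0 < 2 + h ^ 2 * (u + u') := by
    have h2 : 0 < ‖x‖ := norm_pos_iff.2 fun h => by simp [h] at hx
    have h3 : 0 ≤ ‖y‖ := norm_nonneg _
    have h4 : 0 < a * (2 + h ^ 2 * (u + u')) := by rw [hxu] at h2; rw [hyu] at h3; linarith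
    exact pos_of_mul_pos_right h4 ha.le
  have hden : 0 < 2 + h ^ 2 * (u + u') + √δ2 := by positivity
  have hsq := Real.sq_sqrt hδ0
  rw [hδ]
  rw [div_eq_iff (by positivity), sub_mul, div_mul_eq_mul_div, eq_sub_iff_add_eq,
    ← eq_sub_iff_add_eq', div_eq_iff hden.ne']
  rw [hδ2] at hsq
  linear_combination a * hsq

/-- At `h = 0` the angle defect is half of `∑ (ζ_q - ζ'_q)²` and the triangle defect a quarter of
it. Both are jointly continuous there, and compactness of the box makes the convergence uniform. -/
theorem eventually_triangleDefect (K : ℝ) {ε : ℝ} (hε : 0 < ε) :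
    ∀ᶠ h : ℝ in 𝓝 0, ∀ (u u' : ℝ) (ζ ζ' : Fin p → ℝ), |u| ≤ K → |u'| ≤ K → ‖ζ‖ ≤ K → ‖ζ'‖ ≤ K →
      |triangleDefect h u u' ζ ζ' - 1 / 4 * ∑ q, (ζ q - ζ' q) ^ 2| ≤ ε := by
  have hc : IsCompact (Metric.closedBall (0 : ℝ × ℝ × (Fin p → ℝ) × (Fin p → ℝ)) K) :=
    isCompact_closedBall _ _
  have key : ∀ k ∈ Metric.closedBall (0 : ℝ × ℝ × (Fin p → ℝ) × (Fin p → ℝ)) K,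
      ∀ᶠ z : ℝ × (ℝ × ℝ × (Fin p → ℝ) × (Fin p → ℝ)) in 𝓝 (0, k),
        |triangleDefect z.1 z.2.1 z.2.2.1 z.2.2.2.1 z.2.2.2.2 -
          1 / 4 * ∑ q, (z.2.2.2.1 q - z.2.2.2.2 q) ^ 2| ≤ ε := by
    rintro ⟨u, u', ζ, ζ'⟩ _
    have hA : ContinuousAt (fun z : ℝ × (ℝ × ℝ × (Fin p → ℝ) × (Fin p → ℝ)) =>
        angleDefect z.1 z.2.2.2.1 z.2.2.2.2) (0, u, u', ζ, ζ') := by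
      unfold angleDefect
      exact ContinuousAt.div (by fun_prop) (by fun_prop) (by simp)
    have hT : ContinuousAt (fun z : ℝ × (ℝ × ℝ × (Fin p → ℝ) × (Fin p → ℝ)) =>
        triangleDefect z.1 z.2.1 z.2.2.1 z.2.2.2.1 z.2.2.2.2) (0, u, u', ζ, ζ') := by
      unfold triangleDefect
      exact ContinuousAt.div (by fun_prop) (by fun_prop) (by simp)
    have h0 : triangleDefect 0 u u' ζ ζ' - 1 / 4 * ∑ q, (ζ q - ζ' q) ^ 2 = 0 := by
      have h4 : √(2 ^ 2 : ℝ) = 2 := Real.sqrt_sq (by norm_num)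
      simp [triangleDefect, angleDefect, h4]
      ring
    have h1 : ContinuousAt (fun z : ℝ × (ℝ × ℝ × (Fin p → ℝ) × (Fin p → ℝ)) =>
        |triangleDefect z.1 z.2.1 z.2.2.1 z.2.2.2.1 z.2.2.2.2 -
          1 / 4 * ∑ q, (z.2.2.2.1 q - z.2.2.2.2 q) ^ 2|) (0, u, u', ζ, ζ') :=
      (hT.sub (by fun_prop)).abs
    refine h1.eventually_le_const ?_
    simpa only [h0, abs_zero] using hε
  have hev := hc.eventually_forall_of_forall_eventually
    (P := fun h k => |triangleDefect h k.1 k.2.1 k.2.2.1 k.2.2.2 -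
      1 / 4 * ∑ q, (k.2.2.1 q - k.2.2.2 q) ^ 2| ≤ ε) key
  refine hev.mono fun h hh u u' ζ ζ' h1 h2 h3 h4 => ?_
  refine hh (u, u', ζ, ζ') ?_
  simp only [mem_closedBall_zero_iff, Prod.norm_def, sup_le_iff, Real.norm_eq_abs]
  exact ⟨h1, h2, h3, h4⟩

/-- Small projective coordinates on the same side make the inner product nonnegative, so the angle
is at most a right angle. -/
theorem norm_sub_sq_le_of_same_side {h : ℝ} {ζ ζ' : Fin p → ℝ}
    {x y : EuclideanSpace ℝ (Fin (p + 1))} (hxy : 0 < x 0 * y 0)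
    (hxs : ∀ q, projCoord x q = h * ζ q) (hys : ∀ q, projCoord y q = h * ζ' q) {K : ℝ}
    (hζ : ‖ζ‖ ≤ K) (hζ' : ‖ζ'‖ ≤ K) (hK : h ^ 2 * (p * K ^ 2) ≤ 1) :
    ‖x - y‖ ^ 2 ≤ ‖x‖ ^ 2 + ‖y‖ ^ 2 := by
  have hx0 : x 0 ≠ 0 := fun h0 => by simp [h0] at hxy
  have hy0 : y 0 ≠ 0 := fun h0 => by simp [h0] at hxy
  have hK0 : 0 ≤ K := (norm_nonneg _).trans hζ
  have e1 : ∑ q, projCoord x q * projCoord y q = h ^ 2 * ∑ q, ζ q * ζ' q := by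
    rw [Finset.mul_sum]
    exact Finset.sum_congr rfl fun q _ => by rw [hxs, hys]; ring
  have h1 : |∑ q, ζ q * ζ' q| ≤ p * K ^ 2 := by
    refine (Finset.abs_sum_le_sum_abs _ _).trans ?_
    have h2 : ∀ q ∈ Finset.univ, |ζ q * ζ' q| ≤ K ^ 2 := fun q _ => by
      rw [abs_mul, sq]
      exact mul_le_mul ((norm_le_pi_norm ζ q).trans hζ) ((norm_le_pi_norm ζ' q).trans hζ')
        (abs_nonneg _) hK0
    simpa using Finset.sum_le_card_nsmul _ _ _ h2
  have h2 : 0 ≤ inner ℝ x y := by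
    rw [inner_eq_projCoord hx0 hy0, e1]
    refine mul_nonneg hxy.le ?_
    have h3 := (abs_le.1 h1).1
    nlinarith [sq_nonneg h]
  rw [norm_sub_sq_real]
  linarith

end Geometry

/-! ### The elliptical vector in cones, and the growth of quantiles. -/

section Intensity

variable {p : ℕ} {A : Matrix (Fin (p + 1)) (Fin (p + 1)) ℝ}
  {Ω₀ : Type*} [MeasurableSpace Ω₀] {P₀ : Measure Ω₀} [IsProbabilityMeasure P₀]
  {T : Ω₀ → ℝ} {W : Ω₀ → EuclideanSpace ℝ (Fin (p + 1))}

theorem ae_norm_eq_one_uniformSphere (d : ℕ) : ∀ᵐ x ∂uniformSphere d, ‖x‖ = 1 := by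
  rw [uniformSphere, ae_map_iff measurable_subtype_coe.aemeasurable
    (measurableSet_eq_fun (by fun_prop) (by fun_prop))]
  exact Eventually.of_forall fun x => by simp

theorem continuous_toEuclideanLin : Continuous (Matrix.toEuclideanLin A) :=
  LinearMap.continuous_of_finiteDimensional _

theorem aemeasurable_ellipticalVector (hT : Measurable T)
    (hW : HasLaw W (uniformSphere (p + 1)) P₀) : AEMeasurable (ellipticalVector A T W) P₀ := by
  have h1 : AEMeasurable (fun ω => Matrix.toEuclideanLin A (W ω)) P₀ :=
    continuous_toEuclideanLin.measurable.comp_aemeasurable hW.aemeasurable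
  exact hT.aemeasurable.smul h1

/-- The probability that the elliptical vector lies in a cone, outside a ball. -/
theorem measure_ellipticalVector_cone (hA : IsUnit A.det) (hT : Measurable T)
    (hTpos : ∀ᵐ ω ∂P₀, 0 < T ω) (hW : HasLaw W (uniformSphere (p + 1)) P₀)
    (hTW : IndepFun T W P₀) {S : Set (EuclideanSpace ℝ (Fin (p + 1)))} (hS : MeasurableSet S)
    (hom : ∀ t : ℝ, 0 < t → ∀ x, t • x ∈ S ↔ x ∈ S) (r : ℝ) :
    P₀ {ω | ellipticalVector A T W ω ∈ S ∧ r < ‖ellipticalVector A T W ω‖} =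
      ∫⁻ w, {w | Matrix.toEuclideanLin A w ∈ S}.indicator
        (fun w => ENNReal.ofReal (tailProb P₀ T (r * (‖w‖ / ‖Matrix.toEuclideanLin A w‖)))) w
        ∂uniformSphere (p + 1) := by
  have hcA : Measurable (Matrix.toEuclideanLin A) := continuous_toEuclideanLin.measurable
  -- Almost surely `‖W‖ = 1`; the factor `‖w‖` is inserted to make the integrand homogeneous of
  -- degree zero, as the projection formula requires.
  set R : Set (ℝ × EuclideanSpace ℝ (Fin (p + 1))) :=
    {z | Matrix.toEuclideanLin A z.2 ∈ S ∧ r * (‖z.2‖ / ‖Matrix.toEuclideanLin A z.2‖) < z.1}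
    with hR
  have hRm : MeasurableSet R :=
    ((hcA.comp measurable_snd) hS).inter (measurableSet_lt (by fun_prop) measurable_fst)
  have hW1 : ∀ᵐ ω ∂P₀, ‖W ω‖ = 1 :=
    ae_of_ae_map hW.aemeasurable (hW.map_eq ▸ ae_norm_eq_one_uniformSphere (p + 1))
  have h1 : {ω | ellipticalVector A T W ω ∈ S ∧ r < ‖ellipticalVector A T W ω‖} =ᵐ[P₀]
      (fun ω => (T ω, W ω)) ⁻¹' R := by
    filter_upwards [hTpos, hW1] with ω hω1 hω2
    have hpos : 0 < ‖Matrix.toEuclideanLin A (W ω)‖ := by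
      rw [norm_pos_iff, Ne, map_eq_zero_iff _ (toEuclideanLin_injective hA)]
      intro h0
      simp [h0] at hω2
    refine propext (and_congr (hom _ hω1 _) ?_)
    rw [ellipticalVector, norm_smul, Real.norm_of_nonneg hω1.le, hω2, ← div_lt_iff₀ hpos]
    simp only [mul_one_div]
  rw [measure_congr h1, ← Measure.map_apply_of_aemeasurable
    (hT.aemeasurable.prodMk hW.aemeasurable) hRm,
    (indepFun_iff_map_prod_eq_prod_map_map hT.aemeasurable hW.aemeasurable).1 hTW, hW.map_eq]
  have : IsProbabilityMeasure (uniformSphere (p + 1)) :=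
    hW.map_eq ▸ Measure.isProbabilityMeasure_map hW.aemeasurable
  rw [Measure.prod_apply_symm hRm]
  refine lintegral_congr fun w => ?_
  rw [Measure.map_apply hT (measurable_prodMk_right hRm)]
  by_cases hw : Matrix.toEuclideanLin A w ∈ S
  · rw [Set.indicator_of_mem (show w ∈ {w | Matrix.toEuclideanLin A w ∈ S} from hw), tailProb,
      ofReal_measureReal]
    congr 1
    ext ω
    exact ⟨fun h => h.2, fun h => ⟨hw, h⟩⟩
  · rw [Set.indicator_of_notMem (show w ∉ {w | Matrix.toEuclideanLin A w ∈ S} from hw)]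
    convert measure_empty (μ := P₀)
    ext ω
    exact ⟨fun h => hw h.1, fun h => h.elim⟩

theorem measure_norm_ellipticalVector_pos (hA : IsUnit A.det) (hT : Measurable T)
    (hTpos : ∀ᵐ ω ∂P₀, 0 < T ω) (hW : HasLaw W (uniformSphere (p + 1)) P₀)
    (hTW : IndepFun T W P₀) (hpos : ∀ x, 0 < tailProb P₀ T x) (r : ℝ) :
    0 < P₀ {ω | r < ‖ellipticalVector A T W ω‖} := by
  have h1 := measure_ellipticalVector_cone hA hT hTpos hW hTW MeasurableSet.univ
    (fun _ _ _ => Iff.rfl) r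
  simp only [Set.mem_univ, true_and, Set.ofPred_true, Set.indicator_univ] at h1
  have : IsProbabilityMeasure (uniformSphere (p + 1)) :=
    hW.map_eq ▸ Measure.isProbabilityMeasure_map hW.aemeasurable
  have hcA : Measurable (Matrix.toEuclideanLin A) := continuous_toEuclideanLin.measurable
  have hm : Measurable (tailProb P₀ T) := tailProb_antitone.measurable
  rw [h1, pos_iff_ne_zero, Ne, lintegral_eq_zero_iff (by fun_prop)]
  intro h2
  obtain ⟨w, hw⟩ := h2.exists
  have := hpos (r * (‖w‖ / ‖Matrix.toEuclideanLin A w‖))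
  simp only [Pi.zero_apply, ENNReal.ofReal_eq_zero] at hw
  linarith

/-- If `a n ≤ R`, then `n F(a n) ≥ n F(R)`, which is unbounded because `F` never vanishes. -/
theorem tendsto_atTop_of_quantile {F : ℝ → ℝ} (hF : Antitone F) (hpos : ∀ x, 0 < F x) {a : ℕ → ℝ}
    {l : ℝ} (ha : Tendsto (fun n : ℕ => (n : ℝ) * F (a n)) atTop (𝓝 l)) :
    Tendsto a atTop atTop := by
  refine tendsto_atTop.2 fun R => ?_
  have h1 : Tendsto (fun n : ℕ => (n : ℝ) * F R) atTop atTop :=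
    tendsto_natCast_atTop_atTop.atTop_mul_const (hpos R)
  filter_upwards [h1.eventually_gt_atTop (l + 1), ha.eventually_lt_const (lt_add_one l)] with n h2 h3
  by_contra h4
  have := mul_le_mul_of_nonneg_left (hF (not_le.1 h4).le) (Nat.cast_nonneg (α := ℝ) n)
  linarith

end Intensity

/-! ### Rescaled projective coordinates in the singular bases. -/

section Coordinates

variable {p : ℕ} {A : Matrix (Fin (p + 1)) (Fin (p + 1)) ℝ}

/-- The half-spaces on either side of the hyperplane orthogonal to the first basis vector. -/
def halfSide (u : OrthonormalBasis (Fin (p + 1)) ℝ (EuclideanSpace ℝ (Fin (p + 1)))) (s : Bool) :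
    Set (EuclideanSpace ℝ (Fin (p + 1))) :=
  if s then {x | 0 < u.repr x 0} else {x | u.repr x 0 < 0}

/-- The projective coordinates rescaled by `h` and by the weights `w`. -/
noncomputable def scaledCoord (u : OrthonormalBasis (Fin (p + 1)) ℝ (EuclideanSpace ℝ (Fin (p + 1))))
    (w : Fin p → ℝ) (h : ℝ) (x : EuclideanSpace ℝ (Fin (p + 1))) (q : Fin p) : ℝ :=
  projCoord (u.repr x) q / (h * √(w q))

theorem measurable_scaledCoord
    (u : OrthonormalBasis (Fin (p + 1)) ℝ (EuclideanSpace ℝ (Fin (p + 1)))) (w : Fin p → ℝ) (h : ℝ) :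
    Measurable (scaledCoord u w h) := by
  have h1 : Measurable fun x => projCoord (u.repr x) :=
    measurable_projCoord.comp u.repr.continuous.measurable
  unfold scaledCoord
  fun_prop

theorem measurable_repr_zero
    (u : OrthonormalBasis (Fin (p + 1)) ℝ (EuclideanSpace ℝ (Fin (p + 1)))) :
    Measurable fun x => u.repr x 0 := by
  have := u.repr.continuous.measurable
  fun_prop

theorem measurableSet_halfSide
    (u : OrthonormalBasis (Fin (p + 1)) ℝ (EuclideanSpace ℝ (Fin (p + 1)))) (s : Bool) :
    MeasurableSet (halfSide u s) := by
  have h := measurable_repr_zero u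
  cases s
  · exact measurableSet_lt h measurable_const
  · exact measurableSet_lt measurable_const h

theorem scaledCoord_smul (u : OrthonormalBasis (Fin (p + 1)) ℝ (EuclideanSpace ℝ (Fin (p + 1))))
    (w : Fin p → ℝ) (h : ℝ) {t : ℝ} (ht : t ≠ 0) (x : EuclideanSpace ℝ (Fin (p + 1))) :
    scaledCoord u w h (t • x) = scaledCoord u w h x := by
  funext q
  simp only [scaledCoord, projCoord, map_smul, PiLp.smul_apply, smul_eq_mul]
  rw [mul_div_mul_left _ _ ht]

theorem smul_mem_halfSide_iff
    (u : OrthonormalBasis (Fin (p + 1)) ℝ (EuclideanSpace ℝ (Fin (p + 1)))) (s : Bool) {t : ℝ}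
    (ht : 0 < t) (x : EuclideanSpace ℝ (Fin (p + 1))) :
    t • x ∈ halfSide u s ↔ x ∈ halfSide u s := by
  cases s
  · show u.repr (t • x) 0 < 0 ↔ u.repr x 0 < 0
    simp only [map_smul, PiLp.smul_apply, smul_eq_mul]
    exact smul_neg_iff_of_pos_left ht
  · show 0 < u.repr (t • x) 0 ↔ 0 < u.repr x 0
    simp only [map_smul, PiLp.smul_apply, smul_eq_mul]
    exact mul_pos_iff_of_pos_left ht

variable {v u : OrthonormalBasis (Fin (p + 1)) ℝ (EuclideanSpace ℝ (Fin (p + 1)))}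

theorem repr_image_tangentPoint_zero
    (huv : ∀ w q, u.repr (Matrix.toEuclideanLin A w) q = √(orderedEigenvalues A q) * v.repr w q)
    (τ : Fin p → ℝ) :
    u.repr (Matrix.toEuclideanLin A (tangentPoint v τ)) 0 = √(orderedEigenvalues A 0) := by
  rw [huv, tangentPoint, LinearIsometryEquiv.apply_symm_apply]
  simp

/-- The matrix multiplies the projective coordinate by `√(λ_q / λ₁)`, and division by `√(λ_q / (λ₁ -
λ_q))` leaves `√(1 - λ_q / λ₁)`. This is the scaling that makes the limiting weight standard
Gaussian, and it explains the weights in the pair values. -/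
theorem scaledCoord_image_tangentPoint (hA : IsUnit A.det)
    (huv : ∀ w q, u.repr (Matrix.toEuclideanLin A w) q = √(orderedEigenvalues A q) * v.repr w q)
    (hlam : ∀ q : Fin p, orderedEigenvalues A q.succ < orderedEigenvalues A 0)
    (τ : Fin p → ℝ) (h : ℝ) (q : Fin p) :
    scaledCoord u (gapWeight (orderedEigenvalues A)) h (Matrix.toEuclideanLin A (tangentPoint v τ)) q =
      √(1 - orderedEigenvalues A q.succ / orderedEigenvalues A 0) * (τ q / h) := by
  have h0 := orderedEigenvalues_pos hA 0
  have hq := orderedEigenvalues_pos hA q.succ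
  have hlq := hlam q
  rw [scaledCoord, projCoord, repr_image_tangentPoint_zero huv, huv, tangentPoint,
    LinearIsometryEquiv.apply_symm_apply, gapWeight]
  simp only [Fin.cons_succ]
  rw [one_sub_div h0.ne', Real.sqrt_div hq.le, Real.sqrt_div (sub_nonneg.2 hlq.le)]
  have e1 : √(orderedEigenvalues A q.succ) ≠ 0 := by positivity
  have e2 : √(orderedEigenvalues A 0) ≠ 0 := by positivity
  have e3 : √(orderedEigenvalues A 0 - orderedEigenvalues A q.succ) ≠ 0 :=
    (Real.sqrt_pos.2 (by linarith)).ne'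
  field_simp

theorem norm_div_norm_image_tangentPoint (hA : IsUnit A.det)
    (huv : ∀ w q, u.repr (Matrix.toEuclideanLin A w) q = √(orderedEigenvalues A q) * v.repr w q)
    (τ : Fin p → ℝ) :
    ‖tangentPoint v τ‖ / ‖Matrix.toEuclideanLin A (tangentPoint v τ)‖ =
      (√(orderedEigenvalues A 0))⁻¹ *
        normRatio (fun q : Fin p => orderedEigenvalues A q.succ / orderedEigenvalues A 0) τ := by
  have h0 := orderedEigenvalues_pos hA 0
  have hq := fun q : Fin p => orderedEigenvalues_pos hA q.succ
  have h1 : ‖Matrix.toEuclideanLin A (tangentPoint v τ)‖ = √(orderedEigenvalues A 0) *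
      √(1 + ∑ q : Fin p, orderedEigenvalues A q.succ / orderedEigenvalues A 0 * τ q ^ 2) := by
    rw [← u.repr.norm_map, norm_eq_projCoord (by
      rw [repr_image_tangentPoint_zero huv]; positivity), repr_image_tangentPoint_zero huv,
      abs_of_nonneg (Real.sqrt_nonneg _)]
    congr 3
    refine Finset.sum_congr rfl fun q _ => ?_
    rw [projCoord, repr_image_tangentPoint_zero huv, huv, tangentPoint,
      LinearIsometryEquiv.apply_symm_apply]
    simp only [Fin.cons_succ]
    rw [div_pow, mul_pow, Real.sq_sqrt (hq q).le, Real.sq_sqrt h0.le]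
    ring
  rw [h1, norm_tangentPoint, normRatio, Real.sqrt_div (by linarith [sum_sq_nonneg' τ])]
  field_simp

end Coordinates

/-! ### Probabilities of cells as integrals over the tangent hyperplane. -/

section CellProbability

variable {p : ℕ} {A : Matrix (Fin (p + 1)) (Fin (p + 1)) ℝ}
  {Ω₀ : Type*} [MeasurableSpace Ω₀] {P₀ : Measure Ω₀} [IsProbabilityMeasure P₀]
  {T : Ω₀ → ℝ} {W : Ω₀ → EuclideanSpace ℝ (Fin (p + 1))}
  {v u : OrthonormalBasis (Fin (p + 1)) ℝ (EuclideanSpace ℝ (Fin (p + 1)))}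

/-- The ratios `λ_q / λ_1`. -/
noncomputable def eigenRatio (A : Matrix (Fin (p + 1)) (Fin (p + 1)) ℝ) (q : Fin p) : ℝ :=
  orderedEigenvalues A q.succ / orderedEigenvalues A 0

/-- Of two antipodal points exactly one maps to a given side, while the norm ratio and the
projective coordinates do not see the sign. Both sides thus get the same integral, the origin of the
factor one half in each intensity. -/
theorem indicator_tangentPoint_add (hA : IsUnit A.det)
    (huv : ∀ w q, u.repr (Matrix.toEuclideanLin A w) q = √(orderedEigenvalues A q) * v.repr w q)
    (hlam : ∀ q : Fin p, orderedEigenvalues A q.succ < orderedEigenvalues A 0)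
    (s : Bool) (B : Set (Fin p → ℝ)) (h : ℝ) (F : ℝ → ENNReal) (τ : Fin p → ℝ) :
    {w | Matrix.toEuclideanLin A w ∈
        halfSide u s ∩ scaledCoord u (gapWeight (orderedEigenvalues A)) h ⁻¹' B}.indicator
      (fun w => F (‖w‖ / ‖Matrix.toEuclideanLin A w‖)) (tangentPoint v τ) +
    {w | Matrix.toEuclideanLin A w ∈
        halfSide u s ∩ scaledCoord u (gapWeight (orderedEigenvalues A)) h ⁻¹' B}.indicator
      (fun w => F (‖w‖ / ‖Matrix.toEuclideanLin A w‖)) (-tangentPoint v τ) =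
    {τ : Fin p → ℝ | (fun q => √(1 - eigenRatio A q) * (τ q / h)) ∈ B}.indicator
      (fun τ => F ((√(orderedEigenvalues A 0))⁻¹ * normRatio (eigenRatio A) τ)) τ := by
  have h0 := Real.sqrt_pos.2 (orderedEigenvalues_pos hA 0)
  have hz := repr_image_tangentPoint_zero huv τ
  have hneg : Matrix.toEuclideanLin A (-tangentPoint v τ) =
      (-1 : ℝ) • Matrix.toEuclideanLin A (tangentPoint v τ) := by rw [map_neg, neg_one_smul]
  have hzn : u.repr (Matrix.toEuclideanLin A (-tangentPoint v τ)) 0 =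
      -√(orderedEigenvalues A 0) := by
    rw [hneg, map_smul, PiLp.smul_apply, hz]; simp
  have hc := funext (scaledCoord_image_tangentPoint hA huv hlam τ h)
  have hcn : scaledCoord u (gapWeight (orderedEigenvalues A)) h
      (Matrix.toEuclideanLin A (-tangentPoint v τ)) =
      fun q => √(1 - eigenRatio A q) * (τ q / h) := by
    rw [hneg, scaledCoord_smul u _ _ (by norm_num), hc]; rfl
  have hr := norm_div_norm_image_tangentPoint hA huv τ
  have hrn : ‖-tangentPoint v τ‖ / ‖Matrix.toEuclideanLin A (-tangentPoint v τ)‖ =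
      (√(orderedEigenvalues A 0))⁻¹ * normRatio (eigenRatio A) τ := by
    rw [map_neg, norm_neg, norm_neg, hr]; rfl
  replace hr : ‖tangentPoint v τ‖ / ‖Matrix.toEuclideanLin A (tangentPoint v τ)‖ =
      (√(orderedEigenvalues A 0))⁻¹ * normRatio (eigenRatio A) τ := hr
  replace hc : scaledCoord u (gapWeight (orderedEigenvalues A)) h
      (Matrix.toEuclideanLin A (tangentPoint v τ)) =
      fun q => √(1 - eigenRatio A q) * (τ q / h) := hc
  classical
  simp only [Set.indicator_apply, Set.mem_ofPred_eq, Set.mem_inter_iff, Set.mem_preimage, hc, hcn,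
    hr, hrn]
  cases s
  · have e1 : ¬ Matrix.toEuclideanLin A (tangentPoint v τ) ∈ halfSide u false := by
      show ¬ u.repr _ 0 < 0
      rw [hz]; linarith
    have e2 : Matrix.toEuclideanLin A (-tangentPoint v τ) ∈ halfSide u false := by
      show u.repr _ 0 < 0
      rw [hzn]; linarith
    simp only [e1, e2, true_and, false_and, if_false, zero_add]
  · have e1 : Matrix.toEuclideanLin A (tangentPoint v τ) ∈ halfSide u true := by
      show 0 < u.repr _ 0
      rw [hz]; linarith
    have e2 : ¬ Matrix.toEuclideanLin A (-tangentPoint v τ) ∈ halfSide u true := by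
      show ¬ 0 < u.repr _ 0
      rw [hzn]; linarith
    simp only [e1, e2, true_and, false_and, if_false, add_zero]

/-- The probability of a cell, as an integral over the rescaled projective coordinates. -/
theorem exists_measureReal_cell (hA : IsUnit A.det)
    (huv : ∀ w q, u.repr (Matrix.toEuclideanLin A w) q = √(orderedEigenvalues A q) * v.repr w q)
    (hlam : ∀ q : Fin p, orderedEigenvalues A q.succ < orderedEigenvalues A 0)
    (hT : Measurable T) (hTpos : ∀ᵐ ω ∂P₀, 0 < T ω) (hW : HasLaw W (uniformSphere (p + 1)) P₀)
    (hTW : IndepFun T W P₀) :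
    ∃ C : ℝ, ∀ (s : Bool) (h : ℝ), 0 < h → ∀ (B : Set (Fin p → ℝ)), MeasurableSet B → ∀ r : ℝ,
      (P₀.map (ellipticalVector A T W)).real
        (halfSide u s ∩ {x | scaledCoord u (gapWeight (orderedEigenvalues A)) h x ∈ B} ∩
          {x | r < ‖x‖}) =
      C * h ^ p * ∫ y in {y : Fin p → ℝ | (fun q => √(1 - eigenRatio A q) * y q) ∈ B},
        tailProb P₀ T (r / √(orderedEigenvalues A 0) * normRatio (eigenRatio A) (h • y)) *
          projDensity (h • y) := by
  obtain ⟨C, hC0, hCt, hC⟩ := exists_lintegral_uniformSphere p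
  refine ⟨C.toReal, fun s h hh B hB r => ?_⟩
  have hcA : Measurable (Matrix.toEuclideanLin A) := continuous_toEuclideanLin.measurable
  have hm : Measurable (tailProb P₀ T) := tailProb_antitone.measurable
  have hg := measurable_scaledCoord u (gapWeight (orderedEigenvalues A)) h
  have hS : MeasurableSet (halfSide u s ∩
      scaledCoord u (gapWeight (orderedEigenvalues A)) h ⁻¹' B) :=
    (measurableSet_halfSide u s).inter (hg hB)
  have hom : ∀ t : ℝ, 0 < t → ∀ x, t • x ∈ halfSide u s ∩
      scaledCoord u (gapWeight (orderedEigenvalues A)) h ⁻¹' B ↔ x ∈ halfSide u s ∩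
      scaledCoord u (gapWeight (orderedEigenvalues A)) h ⁻¹' B := fun t ht x => by
    simp only [Set.mem_inter_iff, Set.mem_preimage, scaledCoord_smul u _ _ ht.ne',
      smul_mem_halfSide_iff u s ht]
  set σ : Fin p → ℝ := fun q => √(1 - eigenRatio A q) with hσ
  have hnR := measurable_normRatio (eigenRatio A)
  have hpd := (continuous_projDensity (p := p)).measurable
  set I : (Fin p → ℝ) → ENNReal := fun τ =>
    {τ : Fin p → ℝ | (fun q => σ q * (τ q / h)) ∈ B}.indicator (fun τ => ENNReal.ofReal
      (tailProb P₀ T (r * ((√(orderedEigenvalues A 0))⁻¹ * normRatio (eigenRatio A) τ)) *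
        projDensity τ)) τ with hI
  have key : P₀.map (ellipticalVector A T W) (halfSide u s ∩
      {x | scaledCoord u (gapWeight (orderedEigenvalues A)) h x ∈ B} ∩ {x | r < ‖x‖}) =
      C * (ENNReal.ofReal (|h| ^ p) * ∫⁻ y, I (h • y)) := by
    refine (Measure.map_apply_of_aemeasurable (aemeasurable_ellipticalVector hT hW)
      (hS.inter (measurableSet_lt measurable_const measurable_norm))).trans ?_
    refine (measure_ellipticalVector_cone hA hT hTpos hW hTW hS hom r).trans ?_
    rw [hC v]
    · rw [← lintegral_comp_smul_pi I hh.ne']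
      congr 1
      refine lintegral_congr fun τ => ?_
      rw [indicator_tangentPoint_add hA huv hlam s B h
        (fun x => ENNReal.ofReal (tailProb P₀ T (r * x))) τ]
      simp only [hI]
      by_cases hτ : τ ∈ {τ : Fin p → ℝ | (fun q => σ q * (τ q / h)) ∈ B}
      · rw [Set.indicator_of_mem hτ]
        rw [Set.indicator_of_mem hτ, ENNReal.ofReal_mul (tailProb_nonneg _)]
        rfl
      · rw [Set.indicator_of_notMem hτ]
        rw [Set.indicator_of_notMem hτ, zero_mul]
    · exact Measurable.indicator (by fun_prop) (hcA hS)
    · intro t ht x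
      have e1 : ‖t • x‖ / ‖Matrix.toEuclideanLin A (t • x)‖ =
          ‖x‖ / ‖Matrix.toEuclideanLin A x‖ := by
        rw [map_smul, norm_smul, norm_smul, mul_div_mul_left _ _ (by simpa using ht.ne')]
      classical
      simp only [Set.indicator_apply, Set.mem_ofPred_eq, e1]
      rw [map_smul]
      simp only [hom t ht]
  rw [Measure.real, key, ENNReal.toReal_mul, ENNReal.toReal_mul,
    ENNReal.toReal_ofReal (by positivity), abs_of_pos hh, mul_assoc]
  congr 2
  have hmB : MeasurableSet {y : Fin p → ℝ | (fun q => σ q * y q) ∈ B} :=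
    (show Measurable fun y : Fin p → ℝ => fun q => σ q * y q by fun_prop) hB
  rw [integral_eq_lintegral_of_nonneg_ae]
  · rw [← lintegral_indicator hmB]
    congr 1
    refine lintegral_congr fun y => ?_
    have e2 : (fun q => σ q * ((h • y) q / h)) = fun q => σ q * y q := by
      funext q
      rw [Pi.smul_apply, smul_eq_mul, mul_div_cancel_left₀ _ hh.ne']
    classical
    simp only [hI, Set.indicator_apply, Set.mem_ofPred_eq, e2]
    simp only [div_eq_mul_inv, mul_assoc]
  · exact Eventually.of_forall fun y => mul_nonneg (tailProb_nonneg _) (projDensity_nonneg _)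
  · have h1 : Measurable fun y : Fin p → ℝ => h • y := by fun_prop
    exact ((hm.comp ((hnR.comp h1).const_mul _)).mul (hpd.comp h1)).aestronglyMeasurable

theorem ae_mem_halfSide (hA : IsUnit A.det)
    (huv : ∀ w q, u.repr (Matrix.toEuclideanLin A w) q = √(orderedEigenvalues A q) * v.repr w q)
    (hT : Measurable T) (hTpos : ∀ᵐ ω ∂P₀, 0 < T ω) (hW : HasLaw W (uniformSphere (p + 1)) P₀)
    (hTW : IndepFun T W P₀) :
    ∀ᵐ x ∂P₀.map (ellipticalVector A T W), ∃ s, x ∈ halfSide u s := by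
  have hcA : Measurable (Matrix.toEuclideanLin A) := continuous_toEuclideanLin.measurable
  have hm : Measurable (tailProb P₀ T) := tailProb_antitone.measurable
  have hS : MeasurableSet {x | u.repr x 0 = 0} :=
    measurableSet_eq_fun (measurable_repr_zero u) measurable_const
  have hom : ∀ t : ℝ, 0 < t → ∀ x, t • x ∈ {x | u.repr x 0 = 0} ↔ x ∈ {x | u.repr x 0 = 0} :=
    fun t ht x => by simp [ht.ne']
  -- The radius `-1` makes the condition on the norm vacuous. The resulting integral vanishes
  -- because every tangent point is mapped to a vector with first coordinate `±√λ₁ ≠ 0`.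
  have h1 := measure_ellipticalVector_cone hA hT hTpos hW hTW hS hom (-1)
  obtain ⟨C, hC0, hCt, hC⟩ := exists_lintegral_uniformSphere p
  have h0 := Real.sqrt_pos.2 (orderedEigenvalues_pos hA 0)
  have h2 : P₀ {ω | ellipticalVector A T W ω ∈ {x | u.repr x 0 = 0} ∧
      -1 < ‖ellipticalVector A T W ω‖} = 0 := by
    rw [h1, hC v]
    · have h3 : ∀ τ, Matrix.toEuclideanLin A (tangentPoint v τ) ∉ {x | u.repr x 0 = 0} :=
        fun τ => by
          rw [Set.mem_ofPred_eq, repr_image_tangentPoint_zero huv]; exact h0.ne'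
      classical
      simp only [Set.indicator_apply, Set.mem_ofPred_eq] at h3 ⊢
      simp [h3]
    · exact Measurable.indicator (by fun_prop) (hcA hS)
    · intro t ht x
      have e1 : ‖t • x‖ / ‖Matrix.toEuclideanLin A (t • x)‖ =
          ‖x‖ / ‖Matrix.toEuclideanLin A x‖ := by
        rw [map_smul, norm_smul, norm_smul, mul_div_mul_left _ _ (by simpa using ht.ne')]
      classical
      simp only [Set.indicator_apply, e1]
      congr 1
      exact propext (by simpa using hom t ht (Matrix.toEuclideanLin A x))
  have hset : MeasurableSet {x | ∃ s, x ∈ halfSide u s} := by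
    rw [Set.ofPred_exists]
    exact MeasurableSet.iUnion fun s => measurableSet_halfSide u s
  refine (ae_map_iff (aemeasurable_ellipticalVector hT hW) hset).2 ?_
  refine measure_mono_null (fun ω hω => ?_) h2
  refine ⟨?_, by linarith [norm_nonneg (ellipticalVector A T W ω)]⟩
  by_contra h3
  rcases lt_or_gt_of_ne h3 with h4 | h4
  · exact hω ⟨false, h4⟩
  · exact hω ⟨true, h4⟩

end CellProbability

/-! ### Convergence of the rescaled intensities. -/

section CellLimit

variable {p : ℕ} {A : Matrix (Fin (p + 1)) (Fin (p + 1)) ℝ}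
  {Ω₀ : Type*} [MeasurableSpace Ω₀] {P₀ : Measure Ω₀} [IsProbabilityMeasure P₀]
  {T : Ω₀ → ℝ} {W : Ω₀ → EuclideanSpace ℝ (Fin (p + 1))}
  {v u : OrthonormalBasis (Fin (p + 1)) ℝ (EuclideanSpace ℝ (Fin (p + 1)))}

theorem tendsto_sqrt_auxiliary {ψ : ℝ → ℝ} (hψ : IsGumbelAuxiliary P₀ T ψ) {α : ℕ → ℝ}
    (hα : Tendsto α atTop atTop) :
    Tendsto (fun n => √(ψ (α n) / α n)) atTop (𝓝 0) ∧
    (∀ᶠ n in atTop, 0 < √(ψ (α n) / α n)) ∧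
    ∀ᶠ n in atTop, √(ψ (α n) / α n) ^ 2 = ψ (α n) / α n := by
  have h1 : ∀ᶠ n in atTop, 0 < ψ (α n) / α n := by
    filter_upwards [hα.eventually hψ.eventually_pos, hα.eventually_gt_atTop 0] with n h1 h2
    positivity
  refine ⟨?_, h1.mono fun n hn => Real.sqrt_pos.2 hn, h1.mono fun n hn => Real.sq_sqrt hn.le⟩
  have h2 := (Real.continuous_sqrt.tendsto 0).comp (hψ.1.comp hα)
  simpa only [Real.sqrt_zero, Function.comp_def] using h2

theorem tendsto_atTop_quantile_ellipticalVector (hA : IsUnit A.det) (hT : Measurable T)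
    (hTpos : ∀ᵐ ω ∂P₀, 0 < T ω) (hW : HasLaw W (uniformSphere (p + 1)) P₀)
    (hTW : IndepFun T W P₀) {ψ : ℝ → ℝ} (hψ : IsGumbelAuxiliary P₀ T ψ) {a : ℕ → ℝ}
    (ha : Tendsto (fun n : ℕ => (n : ℝ) * P₀.real {ω | a n < ‖ellipticalVector A T W ω‖})
      atTop (𝓝 1)) : Tendsto a atTop atTop := by
  refine tendsto_atTop_of_quantile (F := fun r => P₀.real {ω | r < ‖ellipticalVector A T W ω‖})
    (fun r r' hr => measureReal_mono fun ω hω => lt_of_le_of_lt hr hω) (fun r => ?_) ha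
  exact ENNReal.toReal_pos
    (measure_norm_ellipticalVector_pos hA hT hTpos hW hTW hψ.tailProb_pos r).ne' (measure_ne_top _ _)

theorem disjoint_halfSide : Disjoint (halfSide u true) (halfSide u false) :=
  Set.disjoint_left.2 fun x h1 h2 =>
    lt_asymm (show 0 < u.repr x 0 from h1) (show u.repr x 0 < 0 from h2)

/-- The intensity of the rescaled points converges to that of the limiting Poisson processes. -/
theorem tendsto_cell_intensity (hA : IsUnit A.det)
    (huv : ∀ w q, u.repr (Matrix.toEuclideanLin A w) q = √(orderedEigenvalues A q) * v.repr w q)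
    (hlam : ∀ q : Fin p, orderedEigenvalues A q.succ < orderedEigenvalues A 0)
    (hT : Measurable T) (hTpos : ∀ᵐ ω ∂P₀, 0 < T ω) (hW : HasLaw W (uniformSphere (p + 1)) P₀)
    (hTW : IndepFun T W P₀) {ψ : ℝ → ℝ} (hψ : IsGumbelAuxiliary P₀ T ψ) {a b α : ℕ → ℝ}
    (ha : Tendsto (fun n : ℕ => (n : ℝ) * P₀.real {ω | a n < ‖ellipticalVector A T W ω‖})
      atTop (𝓝 1))
    (hα : ∀ n, α n = a n / √(orderedEigenvalues A 0))
    (hb : ∀ n, b n = √(orderedEigenvalues A 0) * ψ (α n))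
    (s : Bool) (c : ℝ) {B : Set (Fin p → ℝ)} (hB : MeasurableSet B) :
    Tendsto (fun n : ℕ => (n : ℝ) * (P₀.map (ellipticalVector A T W)).real
      (halfSide u s ∩ {x | c < (‖x‖ - a n) / b n} ∩
        {x | scaledCoord u (gapWeight (orderedEigenvalues A)) (√(ψ (α n) / α n)) x ∈ B})) atTop
      (𝓝 (Real.exp (-c) / 2 * (stdGauss p).real B)) := by
  have hl0 := Real.sqrt_pos.2 (orderedEigenvalues_pos hA 0)
  have haT := tendsto_atTop_quantile_ellipticalVector hA hT hTpos hW hTW hψ ha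
  have hαT : Tendsto α atTop atTop := by
    rw [funext hα]
    exact haT.atTop_div_const hl0
  obtain ⟨h0, hpos, hh⟩ := tendsto_sqrt_auxiliary hψ hαT
  set h : ℕ → ℝ := fun n => √(ψ (α n) / α n) with hhdef
  have hρ : ∀ q, 0 < eigenRatio A q := fun q =>
    div_pos (orderedEigenvalues_pos hA _) (orderedEigenvalues_pos hA 0)
  have hρ1 : ∀ q, eigenRatio A q < 1 := fun q =>
    (div_lt_one (orderedEigenvalues_pos hA 0)).2 (hlam q)
  have hbpos : ∀ᶠ n in atTop, 0 < b n := by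
    filter_upwards [hαT.eventually hψ.eventually_pos] with n hn
    rw [hb]; positivity
  obtain ⟨K, hK, hKB⟩ := exists_setIntegral_exp_eq_stdGauss
    (σ := fun q => √(1 - eigenRatio A q)) fun q => Real.sqrt_pos.2 (by linarith [hρ1 q])
  obtain ⟨C, hC⟩ := exists_measureReal_cell hA huv hlam hT hTpos hW hTW
  set J : ℝ → Set (Fin p → ℝ) → ℕ → ℝ := fun c B n =>
    ∫ y in {y : Fin p → ℝ | (fun q => √(1 - eigenRatio A q) * y q) ∈ B},
      tailProb P₀ T ((α n + ψ (α n) * c) * normRatio (eigenRatio A) (h n • y)) /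
        tailProb P₀ T (α n) * projDensity (h n • y) with hJ
  -- All the factors that depend neither on the side nor on the level nor on the set of marks.
  set κ : ℕ → ℝ := fun n => n * (C * h n ^ p * tailProb P₀ T (α n)) with hκ
  have hJlim : ∀ c B, MeasurableSet B →
      Tendsto (J c B) atTop (𝓝 (Real.exp (-c) * (K * (stdGauss p).real B))) := by
    intro c B hB
    have h1 := tendsto_setIntegral_tailProb hρ hρ1 hψ hαT hpos h0 hh c
      {y : Fin p → ℝ | (fun q => √(1 - eigenRatio A q) * y q) ∈ B}
    convert h1 using 2
    rw [← hKB B hB, ← integral_const_mul]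
    refine integral_congr_ae (Eventually.of_forall fun y => ?_)
    simp only
    rw [← Real.exp_add]
    congr 1
    rw [neg_add]
    congr 3
    refine Finset.sum_congr rfl fun q _ => ?_
    rw [mul_pow, Real.sq_sqrt (by linarith [hρ1 q])]
  have hcell : ∀ s c B, MeasurableSet B → ∀ᶠ n : ℕ in atTop,
      (n : ℝ) * (P₀.map (ellipticalVector A T W)).real (halfSide u s ∩
        {x | scaledCoord u (gapWeight (orderedEigenvalues A)) (h n) x ∈ B} ∩
        {x | a n + b n * c < ‖x‖}) = κ n * J c B n := by
    intro s c B hB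
    filter_upwards [hpos] with n hn
    have e1 : (a n + b n * c) / √(orderedEigenvalues A 0) = α n + ψ (α n) * c := by
      rw [hb, hα]; field_simp
    have e2 : J c B n = (∫ y in {y : Fin p → ℝ | (fun q => √(1 - eigenRatio A q) * y q) ∈ B},
      tailProb P₀ T ((α n + ψ (α n) * c) * normRatio (eigenRatio A) (h n • y)) *
        projDensity (h n • y)) / tailProb P₀ T (α n) := by
      rw [hJ, ← integral_div]
      refine integral_congr_ae (Eventually.of_forall fun y => ?_)
      simp only
      ring
    have hne := (hψ.tailProb_pos (α n)).ne'
    rw [hC s (h n) hn B hB, e1, e2, hκ]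
    field_simp
  -- With `c = 0` and all marks, the two sides together give `n P(‖X‖ > a_n) → 1`. This identifies
  -- the limit of `κ` without knowing the constant of the sphere or the asymptotics of the tail of
  -- `T`.
  have hκlim : Tendsto κ atTop (𝓝 (1 / (2 * K))) := by
    have h1 : Tendsto (fun n => κ n * (2 * J 0 Set.univ n)) atTop (𝓝 1) := by
      refine ha.congr' ?_
      filter_upwards [hcell true 0 .univ MeasurableSet.univ,
        hcell false 0 .univ MeasurableSet.univ] with n h1 h2
      have hmX : AEMeasurable (ellipticalVector A T W) P₀ := aemeasurable_ellipticalVector hT hW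
      have hmn : MeasurableSet {x : EuclideanSpace ℝ (Fin (p + 1)) | a n < ‖x‖} :=
        measurableSet_lt measurable_const measurable_norm
      have e1 : P₀.real {ω | a n < ‖ellipticalVector A T W ω‖} =
          (P₀.map (ellipticalVector A T W)).real {x | a n < ‖x‖} :=
        (map_measureReal_apply_of_aemeasurable hmX hmn).symm
      have e2 : (P₀.map (ellipticalVector A T W)).real {x | a n < ‖x‖} =
          (P₀.map (ellipticalVector A T W)).real (halfSide u true ∩ {x | a n < ‖x‖}) +
          (P₀.map (ellipticalVector A T W)).real (halfSide u false ∩ {x | a n < ‖x‖}) := by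
        have : IsProbabilityMeasure (P₀.map (ellipticalVector A T W)) :=
          Measure.isProbabilityMeasure_map hmX
        rw [← measureReal_union (disjoint_halfSide.mono Set.inter_subset_left Set.inter_subset_left)
          ((measurableSet_halfSide u false).inter hmn)]
        refine measureReal_congr ?_
        filter_upwards [ae_mem_halfSide hA huv hT hTpos hW hTW] with x hx
        refine propext ⟨fun h => ?_, fun h => h.elim And.right And.right⟩
        obtain ⟨s, hs⟩ := hx
        cases s
        · exact Or.inr ⟨hs, h⟩
        · exact Or.inl ⟨hs, h⟩
      simp only [Set.mem_univ, Set.ofPred_true, Set.inter_univ, mul_zero, add_zero] at h1 h2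
      rw [e1, e2, mul_add, h1, h2]
      ring
    have h2 := (hJlim 0 .univ MeasurableSet.univ).const_mul 2
    simp only [neg_zero, Real.exp_zero, one_mul, probReal_univ, mul_one] at h2
    have h3 := h1.div h2 (by positivity)
    refine h3.congr' ?_
    filter_upwards [h2.eventually_const_lt (show 0 < 2 * K by positivity)] with n hn
    exact mul_div_cancel_right₀ _ hn.ne'
  have h1 := hκlim.mul (hJlim c B hB)
  have e3 : 1 / (2 * K) * (Real.exp (-c) * (K * (stdGauss p).real B)) =
      Real.exp (-c) / 2 * (stdGauss p).real B := by field_simp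
  rw [e3] at h1
  refine h1.congr' ?_
  filter_upwards [hcell s c B hB, hbpos] with n hn hbn
  have e4 : {x : EuclideanSpace ℝ (Fin (p + 1)) | c < (‖x‖ - a n) / b n} =
      {x | a n + b n * c < ‖x‖} := by
    ext x
    simp only [Set.mem_ofPred_eq]
    rw [lt_div_iff₀ hbn]
    constructor <;> intro h <;> linarith
  rw [← hn, Set.inter_right_comm, e4]

end CellLimit

/-! ### The diameter as a maximum over pairs. -/

theorem isGreatest_cloudDiam {Ω : Type*} {d : ℕ} (X : ℕ → Ω → EuclideanSpace ℝ (Fin d)) {n : ℕ}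
    (hn : 0 < n) (ω : Ω) :
    IsGreatest ((fun ij : ℕ × ℕ => ‖X ij.1 ω - X ij.2 ω‖) '' (Set.Iio n ×ˢ Set.Iio n))
      (cloudDiam X n ω) := by
  have hfin : ((fun i => X i ω) '' Set.Iio n).Finite := (Set.finite_Iio n).image _
  have hpf : ((fun ij : ℕ × ℕ => ‖X ij.1 ω - X ij.2 ω‖) '' (Set.Iio n ×ˢ Set.Iio n)).Finite :=
    ((Set.finite_Iio n).prod (Set.finite_Iio n)).image _
  have hne : ((fun ij : ℕ × ℕ => ‖X ij.1 ω - X ij.2 ω‖) '' (Set.Iio n ×ˢ Set.Iio n)).Nonempty :=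
    ⟨_, (0, 0), ⟨hn, hn⟩, rfl⟩
  obtain ⟨m, hm, hmax⟩ := Set.exists_max_image _ id hpf hne
  have hle : cloudDiam X n ω ≤ m := by
    refine Metric.diam_le_of_forall_dist_le ?_ ?_
    · obtain ⟨ij, _, rfl⟩ := hm
      exact norm_nonneg _
    · rintro _ ⟨i, hi, rfl⟩ _ ⟨j, hj, rfl⟩
      rw [dist_eq_norm]
      exact hmax _ ⟨(i, j), ⟨hi, hj⟩, rfl⟩
  have hge : m ≤ cloudDiam X n ω := by
    obtain ⟨ij, ⟨hi, hj⟩, rfl⟩ := hm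
    simp only
    rw [← dist_eq_norm]
    exact Metric.dist_le_diam_of_mem hfin.isBounded ⟨_, hi, rfl⟩ ⟨_, hj, rfl⟩
  rw [le_antisymm hle hge]
  exact ⟨hm, fun y hy => hmax y hy⟩

theorem isGreatest_scaled_cloudDiam {Ω : Type*} {d : ℕ} (X : ℕ → Ω → EuclideanSpace ℝ (Fin d))
    {n : ℕ} (hn : 0 < n) (a : ℝ) {b : ℝ} (hb : 0 < b) (ω : Ω) :
    IsGreatest ((fun ij : ℕ × ℕ => (‖X ij.1 ω - X ij.2 ω‖ - 2 * a) / b) ''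
      (Set.Iio n ×ˢ Set.Iio n)) ((cloudDiam X n ω - 2 * a) / b) := by
  have h := isGreatest_cloudDiam X hn ω
  have hmono : Monotone fun x : ℝ => (x - 2 * a) / b := fun x y hxy =>
    div_le_div_of_nonneg_right (by linarith) hb.le
  have h1 := hmono.map_isGreatest h
  rwa [Set.image_image] at h1

section

variable {p : ℕ} {Ω : Type*} [MeasurableSpace Ω] {P : Measure Ω}

theorem measurable_cloudDiam {X : ℕ → Ω → EuclideanSpace ℝ (Fin p)} (hX : ∀ i, Measurable (X i))
    (n : ℕ) : Measurable (cloudDiam X n) := by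
  rcases Nat.eq_zero_or_pos n with rfl | hn
  · have : cloudDiam X 0 = fun _ => 0 := by
      funext ω
      rw [cloudDiam, show Set.Iio (0 : ℕ) = ∅ from Set.Iio_bot, Set.image_empty, Metric.diam_empty]
    rw [this]
    exact measurable_const
  · refine measurable_of_Iic fun c => ?_
    have : cloudDiam X n ⁻¹' Set.Iic c = ⋂ ij ∈ Set.Iio n ×ˢ Set.Iio n,
        {ω | ‖X ij.1 ω - X ij.2 ω‖ ≤ c} := by
      ext ω
      simp only [Set.mem_preimage, Set.mem_Iic, Set.mem_iInter, Set.mem_ofPred_eq]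
      have h := isGreatest_cloudDiam X hn ω
      constructor
      · intro h1 ij hij
        exact (h.2 ⟨ij, hij, rfl⟩).trans h1
      · intro h1
        obtain ⟨ij, hij, h2⟩ := h.1
        rw [← h2]
        exact h1 ij hij
    rw [this]
    refine MeasurableSet.biInter ((Set.finite_Iio n).prod (Set.finite_Iio n)).countable
      fun ij _ => ?_
    have h1 := hX ij.1
    have h2 := hX ij.2
    exact measurableSet_le (by fun_prop) measurable_const

end

/-! ### Normalised distances between sample points. -/

section ScaledDistance

variable {p : ℕ} (u : OrthonormalBasis (Fin (p + 1)) ℝ (EuclideanSpace ℝ (Fin (p + 1))))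
  {w : Fin p → ℝ}

theorem projCoord_eq_of_scaledCoord (hw : ∀ q, 0 < w q) {h : ℝ} (hh : 0 < h)
    (x : EuclideanSpace ℝ (Fin (p + 1))) (q : Fin p) :
    projCoord (u.repr x) q = h * (√(w q) * scaledCoord u w h x q) := by
  have := Real.sqrt_pos.2 (hw q)
  rw [scaledCoord]
  field_simp

theorem norm_sqrt_mul_le {g : Fin p → ℝ} {K : ℝ} (hg : ‖g‖ ≤ K) :
    ‖fun q => √(w q) * g q‖ ≤ (∑ q, √(w q)) * K := by
  have hK : 0 ≤ K := (norm_nonneg _).trans hg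
  have hs : ∀ q, 0 ≤ √(w q) := fun q => Real.sqrt_nonneg _
  refine (pi_norm_le_iff_of_nonneg (mul_nonneg (Finset.sum_nonneg fun q _ => hs q) hK)).2
    fun q => ?_
  rw [norm_mul, Real.norm_of_nonneg (hs q)]
  exact mul_le_mul (Finset.single_le_sum (fun q _ => hs q) (Finset.mem_univ q))
    ((norm_le_pi_norm g q).trans hg) (norm_nonneg _) (Finset.sum_nonneg fun q _ => hs q)

theorem pairFun_eq_sub_quarter (hw : ∀ q, 0 ≤ w q) (z z' : ℝ × (Fin p → ℝ)) :
    pairFun w z z' = z.1 + z'.1 - 1 / 4 * ∑ q, (√(w q) * z.2 q - √(w q) * z'.2 q) ^ 2 := by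
  rw [pairFun]
  congr 2
  refine Finset.sum_congr rfl fun q _ => ?_
  rw [← mul_sub, mul_pow, Real.sq_sqrt (hw q)]

variable {a b h : ℕ → ℝ}

/-- Because `b = h² a`, the normalised excess `u = (‖x‖ - a) / b` satisfies `‖x‖ = a (1 + h² u)`;
the exact distance formula then applies with `ζ_q = √(w_q) g_q`. -/
theorem eventually_scaledDist_sub_pairFun_le (hw : ∀ q, 0 < w q) (ha : ∀ᶠ n in atTop, 0 < a n)
    (hh : ∀ᶠ n in atTop, 0 < h n) (h0 : Tendsto h atTop (𝓝 0))
    (hb : ∀ᶠ n in atTop, b n = h n ^ 2 * a n) (K : ℝ) {ε : ℝ} (hε : 0 < ε) :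
    ∀ᶠ n in atTop, ∀ x ∈ halfSide u true, ∀ y ∈ halfSide u false,
      |(‖x‖ - a n) / b n| ≤ K → |(‖y‖ - a n) / b n| ≤ K →
      ‖scaledCoord u w (h n) x‖ ≤ K → ‖scaledCoord u w (h n) y‖ ≤ K →
      |(‖x - y‖ - 2 * a n) / b n - pairFun w ((‖x‖ - a n) / b n, scaledCoord u w (h n) x)
        ((‖y‖ - a n) / b n, scaledCoord u w (h n) y)| ≤ ε := by
  filter_upwards [ha, hh, hb, h0.eventually
    (eventually_triangleDefect (p := p) (max K ((∑ q, √(w q)) * K)) hε)] with n ha hh hb hT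
  intro x hx y hy h1 h2 h3 h4
  have hx' : 0 < u.repr x 0 := hx
  have hy' : u.repr y 0 < 0 := hy
  have hb0 : 0 < b n := by rw [hb]; positivity
  have hnorm : ∀ x : EuclideanSpace ℝ (Fin (p + 1)),
      ‖u.repr x‖ = a n * (1 + h n ^ 2 * ((‖x‖ - a n) / b n)) := fun x => by
    rw [LinearIsometryEquiv.norm_map, hb]
    field_simp
    ring
  have h5 := dist_eq_triangleDefect hh ha hx' hy' (hnorm x) (hnorm y)
    (projCoord_eq_of_scaledCoord u hw hh x) (projCoord_eq_of_scaledCoord u hw hh y)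
  rw [← map_sub, LinearIsometryEquiv.norm_map, ← hb] at h5
  have h6 := hT _ _ (fun q => √(w q) * scaledCoord u w (h n) x q)
    (fun q => √(w q) * scaledCoord u w (h n) y q) (h1.trans (le_max_left _ _))
    (h2.trans (le_max_left _ _)) ((norm_sqrt_mul_le h3).trans (le_max_right _ _))
    ((norm_sqrt_mul_le h4).trans (le_max_right _ _))
  rw [h5, pairFun_eq_sub_quarter fun q => (hw q).le, ← abs_neg]
  refine le_trans (le_of_eq ?_) h6
  congr 1
  ring

/-- Norms at most `11/10 a` and an angle that is not obtuse keep the distance below `8/5 a`. The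
deficit `2/5 a` divided by `b = h² a` tends to infinity. -/
theorem eventually_scaledDist_le_of_same_side (hw : ∀ q, 0 < w q) (ha : ∀ᶠ n in atTop, 0 < a n)
    (hh : ∀ᶠ n in atTop, 0 < h n) (h0 : Tendsto h atTop (𝓝 0))
    (hb : ∀ᶠ n in atTop, b n = h n ^ 2 * a n) (K M : ℝ) :
    ∀ᶠ n in atTop, ∀ s, ∀ x ∈ halfSide u s, ∀ y ∈ halfSide u s,
      |(‖x‖ - a n) / b n| ≤ K → |(‖y‖ - a n) / b n| ≤ K →
      ‖scaledCoord u w (h n) x‖ ≤ K → ‖scaledCoord u w (h n) y‖ ≤ K →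
      (‖x - y‖ - 2 * a n) / b n ≤ -M := by
  have h01 : Tendsto (fun n => h n ^ 2 * (p * ((∑ q, √(w q)) * K) ^ 2)) atTop (𝓝 0) := by
    simpa using (h0.pow 2).mul_const (p * ((∑ q, √(w q)) * K) ^ 2)
  have h02 : Tendsto (fun n => h n ^ 2 * K) atTop (𝓝 0) := by simpa using (h0.pow 2).mul_const K
  have h03 : Tendsto (fun n => h n ^ 2 * M) atTop (𝓝 0) := by simpa using (h0.pow 2).mul_const M
  filter_upwards [ha, hh, hb, h01.eventually_le_const one_pos,
    h02.eventually_le_const (show (0 : ℝ) < 1 / 10 by norm_num),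
    h03.eventually_le_const (show (0 : ℝ) < 1 / 10 by norm_num)] with n ha hh hb h1 h2 h3
  intro s x hx y hy hxK hyK hxg hyg
  have hb0 : 0 < b n := by rw [hb]; positivity
  have hxy : 0 < u.repr x 0 * u.repr y 0 := by
    cases s
    · exact mul_pos_of_neg_of_neg hx hy
    · exact mul_pos hx hy
  have h4 := norm_sub_sq_le_of_same_side hxy (projCoord_eq_of_scaledCoord u hw hh x)
    (projCoord_eq_of_scaledCoord u hw hh y) (norm_sqrt_mul_le hxg)
    (norm_sqrt_mul_le hyg) h1
  rw [← map_sub, LinearIsometryEquiv.norm_map, LinearIsometryEquiv.norm_map,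
    LinearIsometryEquiv.norm_map] at h4
  have hbd : ∀ x : EuclideanSpace ℝ (Fin (p + 1)), |(‖x‖ - a n) / b n| ≤ K →
      ‖x‖ ≤ 11 / 10 * a n := fun x hx => by
    have h5 := (div_le_iff₀ hb0).1 (le_of_abs_le hx)
    rw [hb] at h5
    nlinarith
  have h5 := hbd x hxK
  have h6 := hbd y hyK
  have h7 : ‖x - y‖ ≤ 8 / 5 * a n := by
    refine abs_le_of_sq_le_sq' (le_trans h4 ?_) (by positivity) |>.2
    nlinarith [norm_nonneg x, norm_nonneg y]
  rw [div_le_iff₀ hb0, hb]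
  nlinarith

end ScaledDistance

/-! ### Weak convergence of the diameter. -/

section Main

variable {p : ℕ} {A : Matrix (Fin (p + 1)) (Fin (p + 1)) ℝ}
  {Ω₀ : Type*} [MeasurableSpace Ω₀] {P₀ : Measure Ω₀} [IsProbabilityMeasure P₀]
  {T : Ω₀ → ℝ} {W : Ω₀ → EuclideanSpace ℝ (Fin (p + 1))}

theorem gapWeight_pos (hA : IsUnit A.det)
    (hlam : ∀ q : Fin p, orderedEigenvalues A q.succ < orderedEigenvalues A 0) (q : Fin p) :
    0 < gapWeight (orderedEigenvalues A) q :=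
  div_pos (orderedEigenvalues_pos hA _) (sub_pos.2 (hlam q))

theorem tendstoInDistribution_cloudDiam (hA : IsUnit A.det)
    (hlam : ∀ q : Fin p, orderedEigenvalues A q.succ < orderedEigenvalues A 0)
    (hT : Measurable T) (hTpos : ∀ᵐ ω ∂P₀, 0 < T ω) (hW : HasLaw W (uniformSphere (p + 1)) P₀)
    (hTW : IndepFun T W P₀) {ψ : ℝ → ℝ} (hψ : IsGumbelAuxiliary P₀ T ψ)
    {Ω : Type*} [MeasurableSpace Ω] {P : Measure Ω} [IsProbabilityMeasure P]
    {X : ℕ → Ω → EuclideanSpace ℝ (Fin (p + 1))} (hXindep : iIndepFun X P)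
    (hXlaw : ∀ i, IdentDistrib (X i) (ellipticalVector A T W) P P₀) {a b : ℕ → ℝ}
    (ha : Tendsto (fun n : ℕ => (n : ℝ) * P₀.real {ω | a n < ‖ellipticalVector A T W ω‖})
      atTop (𝓝 1))
    (hb : ∀ n, b n = √(orderedEigenvalues A 0) * ψ (a n / √(orderedEigenvalues A 0)))
    {Ω' : Type*} [MeasurableSpace Ω'] {P' : Measure Ω'} [IsProbabilityMeasure P']
    {Γp Γm : ℕ → Ω' → ℝ} {Gp Gm : ℕ → Ω' → Fin p → ℝ}
    (hΓp : ∀ i, Measurable (Γp i)) (hΓm : ∀ i, Measurable (Γm i))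
    (hGp : ∀ i, Measurable (Gp i)) (hGm : ∀ i, Measurable (Gm i))
    (hNp : IsPoissonProcess P' (markedIntensity p) (pointMeasure Γp Gp))
    (hNm : IsPoissonProcess P' (markedIntensity p) (pointMeasure Γm Gm))
    (hN : IndepFun (pointMeasure Γp Gp) (pointMeasure Γm Gm) P') :
    TendstoInDistribution (fun (n : ℕ) ω => (cloudDiam X n ω - 2 * a n) / b n) atTop
      (fun ω => ⨆ ij : ℕ × ℕ, pairFun (gapWeight (orderedEigenvalues A))
        (Γp ij.1 ω, Gp ij.1 ω) (Γm ij.2 ω, Gm ij.2 ω)) (fun _ => P) P' := by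
  obtain ⟨v, u, huv⟩ := exists_singularBases hA
  have hl0 := Real.sqrt_pos.2 (orderedEigenvalues_pos hA 0)
  have haT := tendsto_atTop_quantile_ellipticalVector hA hT hTpos hW hTW hψ ha
  set α : ℕ → ℝ := fun n => a n / √(orderedEigenvalues A 0) with hα
  have hαT : Tendsto α atTop atTop := haT.atTop_div_const hl0
  obtain ⟨h0, hpos, hh⟩ := tendsto_sqrt_auxiliary hψ hαT
  have hw := gapWeight_pos hA hlam
  have hmX : AEMeasurable (ellipticalVector A T W) P₀ := aemeasurable_ellipticalVector hT hW
  have hprob : IsProbabilityMeasure (P₀.map (ellipticalVector A T W)) :=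
    Measure.isProbabilityMeasure_map hmX
  have hapos := haT.eventually_gt_atTop 0
  have hbh : ∀ᶠ n in atTop, b n = √(ψ (α n) / α n) ^ 2 * a n := by
    filter_upwards [hh, hapos] with n hn han
    rw [hn, hb, hα]
    field_simp
  have hbpos : ∀ᶠ n in atTop, 0 < b n := by
    filter_upwards [hbh, hpos, hapos] with n h1 h2 h3
    rw [h1]; positivity
  -- The sample is only almost everywhere measurable; the limit theorem for pairs is applied to
  -- measurable versions, which almost surely give the same diameter.
  set Y : ℕ → Ω → EuclideanSpace ℝ (Fin (p + 1)) := fun i => (hXlaw i).aemeasurable_fst.mk _ with hY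
  have hYX : ∀ i, X i =ᵐ[P] Y i := fun i => (hXlaw i).aemeasurable_fst.ae_eq_mk
  have hYm : ∀ i, Measurable (Y i) := fun i => (hXlaw i).aemeasurable_fst.measurable_mk
  have hmain := tendstoInDistribution_pairs (P := P) (P' := P') (w := gapWeight (orderedEigenvalues A))
    (fun q => (hw q).le) (μ := P₀.map (ellipticalVector A T W)) (X := Y) hYm
    (hXindep.congr hYX)
    (fun i => by rw [← Measure.map_congr (hYX i), (hXlaw i).map_eq])
    (side := halfSide u) (measurableSet_halfSide u) disjoint_halfSide
    (ae_mem_halfSide hA huv hT hTpos hW hTW)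
    (u := fun n x => (‖x‖ - a n) / b n)
    (g := fun n => scaledCoord u (gapWeight (orderedEigenvalues A)) (√(ψ (α n) / α n)))
    (fun n => by fun_prop) (fun n => measurable_scaledCoord _ _ _)
    (v := fun n x y => (‖x - y‖ - 2 * a n) / b n)
    (fun n x y => by simp only [norm_sub_rev])
    (fun s c B hB => tendsto_cell_intensity hA huv hlam hT hTpos hW hTW hψ ha (fun _ => rfl) hb s c hB)
    (by
      filter_upwards [hbpos] with n hn x y
      rw [← add_div]
      exact div_le_div_of_nonneg_right (by linarith [norm_sub_le x y]) hn.le)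
    (fun K ε hε => eventually_scaledDist_sub_pairFun_le u hw hapos hpos h0 hbh K hε)
    (fun K M => eventually_scaledDist_le_of_same_side u hw hapos hpos h0 hbh K M)
    (D := fun n ω => (cloudDiam Y n ω - 2 * a n) / b n)
    (fun n => (((measurable_cloudDiam hYm n).sub_const _).div_const _).aemeasurable)
    (by
      filter_upwards [hbpos, eventually_gt_atTop 0] with n hn hn0 ω
      exact isGreatest_scaled_cloudDiam Y hn0 (a n) hn ω)
    hΓp hΓm hGp hGm hNp hNm hN
  refine hmain.congr (fun n => ?_) (ae_eq_refl _)
  filter_upwards [ae_all_iff.2 hYX] with ω hω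
  have : cloudDiam Y n ω = cloudDiam X n ω := by
    simp only [cloudDiam, hω]
  rw [this]

end Main

/-! ### The law of the limit as a Laplace transform. -/

section Mixture

variable {p : ℕ}

/-- The intensity, per unit of the second mark, of the points `(γ, g)` forming with `z` a pair of
positive value. -/
noncomputable def profile (w : Fin p → ℝ) (z : ℝ × (Fin p → ℝ)) (g : Fin p → ℝ) : ENNReal :=
  ENNReal.ofReal (Real.exp (pairFun w z (0, g)) / 2)

theorem measurable_profile (w : Fin p → ℝ) :
    Measurable fun zg : (ℝ × (Fin p → ℝ)) × (Fin p → ℝ) => profile w zg.1 zg.2 := by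
  have h := (continuous_pairFun w).measurable
  unfold profile
  have h2 : Measurable fun zg : (ℝ × (Fin p → ℝ)) × (Fin p → ℝ) => pairFun w zg.1 (0, zg.2) :=
    h.comp (measurable_fst.prodMk (measurable_const.prodMk measurable_snd))
  fun_prop

theorem pairFun_eq_add (w : Fin p → ℝ) (z : ℝ × (Fin p → ℝ)) (t : ℝ) (g : Fin p → ℝ) :
    pairFun w z (t, g) = t + pairFun w z (0, g) := by
  unfold pairFun
  ring

theorem halfExp_iUnion_Ioi (f : ℕ → ℝ) :
    halfExp (⋃ i, Set.Ioi (f i)) = ⨆ i, ENNReal.ofReal (Real.exp (-f i) / 2) := by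
  rw [Directed.measure_iUnion]
  · simp only [halfExp_Ioi]
  · intro i j
    rcases le_total (f i) (f j) with h | h
    · exact ⟨i, le_rfl, Set.Ioi_subset_Ioi h⟩
    · exact ⟨j, Set.Ioi_subset_Ioi h, le_rfl⟩

theorem isOpen_setOf_lt_pairFun (w : Fin p → ℝ) (z : ℕ → ℝ × (Fin p → ℝ)) (x : ℝ) :
    IsOpen {z' | ∃ i, x < pairFun w (z i) z'} := by
  rw [Set.ofPred_exists]
  refine isOpen_iUnion fun i => isOpen_lt continuous_const ?_
  exact (continuous_pairFun w).comp (continuous_const.prodMk continuous_id)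

/-- The intensity of the points forming with one of the points `z i` a pair of value above `x`. -/
theorem markedIntensity_lt_pairFun (w : Fin p → ℝ) (z : ℕ → ℝ × (Fin p → ℝ)) (x : ℝ) :
    markedIntensity p {z' | ∃ i, x < pairFun w (z i) z'} =
      ENNReal.ofReal (Real.exp (-x)) * ∫⁻ g, ⨆ i, profile w (z i) g ∂stdGauss p := by
  have hm : ∀ i, Measurable (profile w (z i)) := fun i =>
    (measurable_profile w).comp (measurable_const.prodMk measurable_id)
  have hms : Measurable fun g => ⨆ i, profile w (z i) g := Measurable.iSup hm
  rw [markedIntensity, Measure.prod_apply_symm (isOpen_setOf_lt_pairFun w z x).measurableSet,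
    ← lintegral_const_mul _ hms]
  refine lintegral_congr fun g => ?_
  -- For a fixed mark the admissible first coordinates form a union of upper half-lines, whose
  -- measure is the supremum of their measures; hence a supremum of profiles, not a sum.
  have h1 : (fun t : ℝ => (t, g)) ⁻¹' {z' | ∃ i, x < pairFun w (z i) z'} =
      ⋃ i, Set.Ioi (x - pairFun w (z i) (0, g)) := by
    ext t
    simp only [Set.mem_preimage, Set.mem_ofPred_eq, Set.mem_iUnion, Set.mem_Ioi, sub_lt_iff_lt_add]
    exact exists_congr fun i => by rw [pairFun_eq_add]
  rw [h1]
  refine (halfExp_iUnion_Ioi _).trans ?_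
  rw [ENNReal.mul_iSup]
  refine iSup_congr fun i => ?_
  rw [profile, ← ENNReal.ofReal_mul (Real.exp_nonneg _), mul_div_assoc', ← Real.exp_add]
  congr 3
  ring

variable {Ω : Type*} [MeasurableSpace Ω] {P : Measure Ω} [IsProbabilityMeasure P]
  {Γp Γm : ℕ → Ω → ℝ} {Gp Gm : ℕ → Ω → Fin p → ℝ}

/-- The event that all the pairs have value at most `x`, in terms of the two point measures. -/
theorem exists_measurableSet_forall_pairFun_le (w : Fin p → ℝ) (x : ℝ)
    (Γp Γm : ℕ → Ω → ℝ) (Gp Gm : ℕ → Ω → Fin p → ℝ) :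
    ∃ R : Set (Measure (ℝ × (Fin p → ℝ)) × Measure (ℝ × (Fin p → ℝ))), MeasurableSet R ∧
      ∀ ω ω', (pointMeasure Γp Gp ω, pointMeasure Γm Gm ω') ∈ R ↔
        ∀ i j, pairFun w (Γp i ω, Gp i ω) (Γm j ω', Gm j ω') ≤ x := by
  -- Independence concerns the point measures, not their enumerations, so the event must be read off
  -- the measures. The open set `O` is a countable union of basic open rectangles, and no pair lies
  -- in `O` exactly when each such rectangle has a factor without points of the corresponding
  -- process.
  set O : Set ((ℝ × (Fin p → ℝ)) × (ℝ × (Fin p → ℝ))) := {zz | x < pairFun w zz.1 zz.2} with hO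
  have hOo : IsOpen O := isOpen_lt continuous_const (continuous_pairFun w)
  set b := TopologicalSpace.countableBasis (ℝ × (Fin p → ℝ))
  have hb : TopologicalSpace.IsTopologicalBasis b := TopologicalSpace.isBasis_countableBasis _
  set I : Set (Set (ℝ × (Fin p → ℝ)) × Set (ℝ × (Fin p → ℝ))) :=
    {UV | UV ∈ b ×ˢ b ∧ UV.1 ×ˢ UV.2 ⊆ O} with hI
  have hIc : I.Countable :=
    ((TopologicalSpace.countable_countableBasis _).prod
      (TopologicalSpace.countable_countableBasis _)).mono fun UV h => h.1
  have hmeas : ∀ U ∈ b, MeasurableSet U := fun U hU => (hb.isOpen hU).measurableSet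
  refine ⟨⋂ UV ∈ I, {n | n.1 UV.1 = 0} ∪ {n | n.2 UV.2 = 0}, ?_, fun ω ω' => ?_⟩
  · refine MeasurableSet.biInter hIc fun UV hUV => MeasurableSet.union ?_ ?_
    · exact (Measure.measurable_coe (hmeas _ hUV.1.1)).comp measurable_fst
        (measurableSet_singleton 0)
    · exact (Measure.measurable_coe (hmeas _ hUV.1.2)).comp measurable_snd
        (measurableSet_singleton 0)
  · simp only [Set.mem_iInter, Set.mem_union, Set.mem_ofPred_eq]
    constructor
    · intro h i j
      by_contra hlt
      have hmem : ((Γp i ω, Gp i ω), (Γm j ω', Gm j ω')) ∈ O := not_le.1 hlt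
      obtain ⟨W, ⟨U, hU, V, hV, rfl⟩, hmW, hWO⟩ := (hb.prod hb).exists_subset_of_mem_open hmem hOo
      rcases h (U, V) ⟨⟨hU, hV⟩, hWO⟩ with h1 | h1
      · exact (pointMeasure_eq_zero_iff Γp Gp ω (hmeas U hU)).1 h1 i hmW.1
      · exact (pointMeasure_eq_zero_iff Γm Gm ω' (hmeas V hV)).1 h1 j hmW.2
    · rintro h ⟨U, V⟩ ⟨⟨hU, hV⟩, hUV⟩
      by_contra hne
      rw [not_or, pointMeasure_eq_zero_iff Γp Gp ω (hmeas U hU),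
        pointMeasure_eq_zero_iff Γm Gm ω' (hmeas V hV)] at hne
      push Not at hne
      obtain ⟨⟨i, hi⟩, ⟨j, hj⟩⟩ := hne
      have h1 : x < pairFun w (Γp i ω, Gp i ω) (Γm j ω', Gm j ω') := hUV (Set.mk_mem_prod hi hj)
      exact absurd (h i j) (not_le.2 h1)

/-- The total intensity, up to the factor `e^{-x}`, of the points forming a pair of value above `x`
with one of the points of the process. -/
noncomputable def totalMass (w : Fin p → ℝ) (Γ : ℕ → Ω → ℝ) (G : ℕ → Ω → Fin p → ℝ) (ω : Ω) :
    ENNReal :=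
  ∫⁻ g, ⨆ i, profile w (Γ i ω, G i ω) g ∂stdGauss p

theorem measurable_totalMass (w : Fin p → ℝ) {Γ : ℕ → Ω → ℝ} {G : ℕ → Ω → Fin p → ℝ}
    (hΓ : ∀ i, Measurable (Γ i)) (hG : ∀ i, Measurable (G i)) : Measurable (totalMass w Γ G) := by
  refine Measurable.lintegral_prod_right' (f := fun z : Ω × (Fin p → ℝ) =>
    ⨆ i, profile w (Γ i z.1, G i z.1) z.2) (Measurable.iSup fun i => ?_)
  exact (measurable_profile w).comp ((((hΓ i).comp measurable_fst).prodMk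
    ((hG i).comp measurable_fst)).prodMk measurable_snd)

theorem profile_le {w : Fin p → ℝ} (hw : ∀ q, 0 ≤ w q) (z : ℝ × (Fin p → ℝ)) (g : Fin p → ℝ) :
    profile w z g ≤ ENNReal.ofReal (Real.exp z.1 / 2) := by
  refine ENNReal.ofReal_le_ofReal ?_
  have := pairFun_le hw z (0, g)
  simp only [add_zero] at this
  gcongr

theorem totalMass_le {w : Fin p → ℝ} (hw : ∀ q, 0 ≤ w q) {Γ : ℕ → Ω → ℝ} {G : ℕ → Ω → Fin p → ℝ}
    {ω : Ω} {m : ℝ} (hm : ∀ i, Γ i ω ≤ m) :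
    totalMass w Γ G ω ≤ ENNReal.ofReal (Real.exp m / 2) := by
  have h1 : ∀ g, ⨆ i, profile w (Γ i ω, G i ω) g ≤ ENNReal.ofReal (Real.exp m / 2) := fun g =>
    iSup_le fun i => (profile_le hw _ g).trans (ENNReal.ofReal_le_ofReal (by
      have := Real.exp_le_exp.2 (hm i)
      simp only
      linarith))
  refine (lintegral_mono h1).trans ?_
  simp

theorem ae_totalMass_lt_top {w : Fin p → ℝ} (hw : ∀ q, 0 ≤ w q) {Γ : ℕ → Ω → ℝ}
    {G : ℕ → Ω → Fin p → ℝ}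
    (hN : IsPoissonProcess P (markedIntensity p) (pointMeasure Γ G)) :
    ∀ᵐ ω ∂P, totalMass w Γ G ω < ⊤ := by
  filter_upwards [ae_finite_above hN] with ω hω
  obtain ⟨m, hm⟩ := bddAbove_range_of_finite_above hω
  exact (totalMass_le hw fun i => hm ⟨i, rfl⟩).trans_lt ENNReal.ofReal_lt_top

/-- The distribution function of the largest value of the pairs is a Laplace transform. -/
theorem measure_iSup_pairFun_le {w : Fin p → ℝ} (hw : ∀ q, 0 ≤ w q)
    (hNp : IsPoissonProcess P (markedIntensity p) (pointMeasure Γp Gp))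
    (hNm : IsPoissonProcess P (markedIntensity p) (pointMeasure Γm Gm))
    (hN : IndepFun (pointMeasure Γp Gp) (pointMeasure Γm Gm) P) (x : ℝ) :
    P {ω | ⨆ ij : ℕ × ℕ, pairFun w (Γp ij.1 ω, Gp ij.1 ω) (Γm ij.2 ω, Gm ij.2 ω) ≤ x} =
      ∫⁻ ω, ENNReal.ofReal (Real.exp (-(Real.exp (-x) * (totalMass w Γp Gp ω).toReal))) ∂P := by
  obtain ⟨R, hR, hRiff⟩ := exists_measurableSet_forall_pairFun_le w x Γp Γm Gp Gm
  have h1 : {ω | ⨆ ij : ℕ × ℕ, pairFun w (Γp ij.1 ω, Gp ij.1 ω) (Γm ij.2 ω, Gm ij.2 ω) ≤ x} =ᵐ[P]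
      (fun ω => (pointMeasure Γp Gp ω, pointMeasure Γm Gm ω)) ⁻¹' R := by
    filter_upwards [ae_isGreatest_pairFun hw hNp hNm] with ω hω
    refine propext (Iff.trans ?_ (hRiff ω ω).symm)
    exact ⟨fun h i j => (hω.2 ⟨(i, j), rfl⟩).trans h, fun h => ciSup_le fun ij => h ij.1 ij.2⟩
  have : IsProbabilityMeasure (P.map (pointMeasure Γm Gm)) :=
    Measure.isProbabilityMeasure_map hNm.measurable.aemeasurable
  -- By independence the minus process is integrated out with the plus process frozen; what remains
  -- inside is a void probability.
  rw [measure_congr h1, ← Measure.map_apply (hNp.measurable.prodMk hNm.measurable) hR,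
    (indepFun_iff_map_prod_eq_prod_map_map hNp.measurable.aemeasurable
      hNm.measurable.aemeasurable).1 hN, Measure.prod_apply hR,
    lintegral_map (measurable_measure_prodMk_left hR) hNp.measurable]
  refine lintegral_congr_ae ?_
  filter_upwards [ae_totalMass_lt_top hw hNp] with ω hω
  have hUo := isOpen_setOf_lt_pairFun w (fun i => (Γp i ω, Gp i ω)) x
  have hU := markedIntensity_lt_pairFun w (fun i => (Γp i ω, Gp i ω)) x
  rw [Measure.map_apply hNm.measurable (measurable_prodMk_left hR)]
  have h2 : pointMeasure Γm Gm ⁻¹' (Prod.mk (pointMeasure Γp Gp ω) ⁻¹' R) =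
      {ω' | pointMeasure Γm Gm ω' {z' | ∃ i, x < pairFun w (Γp i ω, Gp i ω) z'} = 0} := by
    ext ω'
    simp only [Set.mem_preimage, hRiff, Set.mem_ofPred_eq,
      pointMeasure_eq_zero_iff Γm Gm ω' hUo.measurableSet, not_exists, not_lt]
    exact forall_comm
  rw [h2, hNm.measure_eq_zero hUo.measurableSet, hU, ENNReal.toReal_mul,
    ENNReal.toReal_ofReal (Real.exp_nonneg _)]
  · rfl
  · rw [hU]
    exact ENNReal.mul_lt_top ENNReal.ofReal_lt_top hω

/-- The tail of the largest value of the pairs, in terms of the tail of the total mass. -/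
theorem measure_lt_iSup_pairFun {w : Fin p → ℝ} (hw : ∀ q, 0 ≤ w q)
    (hΓp : ∀ i, Measurable (Γp i)) (hΓm : ∀ i, Measurable (Γm i))
    (hGp : ∀ i, Measurable (Gp i)) (hGm : ∀ i, Measurable (Gm i))
    (hNp : IsPoissonProcess P (markedIntensity p) (pointMeasure Γp Gp))
    (hNm : IsPoissonProcess P (markedIntensity p) (pointMeasure Γm Gm))
    (hN : IndepFun (pointMeasure Γp Gp) (pointMeasure Γm Gm) P) (x : ℝ) :
    P {ω | x < ⨆ ij : ℕ × ℕ, pairFun w (Γp ij.1 ω, Gp ij.1 ω) (Γm ij.2 ω, Gm ij.2 ω)} =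
      ∫⁻ ω, ENNReal.ofReal (1 - Real.exp (-(Real.exp (-x) * (totalMass w Γp Gp ω).toReal))) ∂P := by
  have hm : Measurable fun ω => (totalMass w Γp Gp ω).toReal :=
    (measurable_totalMass w hΓp hGp).ennreal_toReal
  have h1 : {ω | x < ⨆ ij : ℕ × ℕ, pairFun w (Γp ij.1 ω, Gp ij.1 ω) (Γm ij.2 ω, Gm ij.2 ω)} =
      {ω | ⨆ ij : ℕ × ℕ, pairFun w (Γp ij.1 ω, Gp ij.1 ω) (Γm ij.2 ω, Gm ij.2 ω) ≤ x}ᶜ := by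
    ext ω
    simp
  rw [h1, measure_compl (measurableSet_le (measurable_iSup_pairFun hΓp hΓm hGp hGm)
    measurable_const) (measure_ne_top _ _), measure_iSup_pairFun_le hw hNp hNm hN, measure_univ]
  simp only [ENNReal.ofReal_sub _ (Real.exp_nonneg _), ENNReal.ofReal_one]
  rw [lintegral_sub (by fun_prop)]
  · simp
  · refine ne_of_lt (lt_of_le_of_lt (lintegral_mono (g := fun _ => 1) fun ω => ?_) (by simp))
    rw [ENNReal.ofReal_le_one, Real.exp_le_one_iff]
    have := Real.exp_nonneg (-x)
    have := (totalMass w Γp Gp ω).toReal_nonneg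
    simp only [Left.neg_nonpos_iff]
    positivity
  · refine Eventually.of_forall fun ω => ?_
    rw [ENNReal.ofReal_le_one, Real.exp_le_one_iff]
    have := Real.exp_nonneg (-x)
    have := (totalMass w Γp Gp ω).toReal_nonneg
    simp only [Left.neg_nonpos_iff]
    positivity

end Mixture

/-! ### The dominant point and its Fréchet law. -/

section TopMass

variable {p : ℕ}

instance isOpenPosMeasure_gaussianReal : (gaussianReal 0 1).IsOpenPosMeasure :=
  (gaussianReal_absolutelyContinuous' 0 one_ne_zero).isOpenPosMeasure

instance isOpenPosMeasure_stdGauss : (stdGauss p).IsOpenPosMeasure := inferInstance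

/-- The mean of the profile of a point with first coordinate zero. -/
noncomputable def meanProfile (w : Fin p → ℝ) (g₀ : Fin p → ℝ) : ℝ :=
  (∫⁻ g, profile w (0, g₀) g ∂stdGauss p).toReal

theorem profile_eq_mul (w : Fin p → ℝ) (z : ℝ × (Fin p → ℝ)) (g : Fin p → ℝ) :
    profile w z g = ENNReal.ofReal (Real.exp z.1) * profile w (0, z.2) g := by
  rw [profile, profile, ← ENNReal.ofReal_mul (Real.exp_nonneg _), mul_div_assoc', ← Real.exp_add]
  congr 3
  unfold pairFun
  ring

theorem measurable_profile_right (w : Fin p → ℝ) (z : ℝ × (Fin p → ℝ)) :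
    Measurable (profile w z) :=
  (measurable_profile w).comp (measurable_const.prodMk measurable_id)

theorem lintegral_profile_le {w : Fin p → ℝ} (hw : ∀ q, 0 ≤ w q) (z : ℝ × (Fin p → ℝ)) :
    ∫⁻ g, profile w z g ∂stdGauss p ≤ ENNReal.ofReal (Real.exp z.1 / 2) := by
  refine (lintegral_mono fun g => profile_le hw z g).trans ?_
  simp

theorem lintegral_profile {w : Fin p → ℝ} (hw : ∀ q, 0 ≤ w q) (z : ℝ × (Fin p → ℝ)) :
    ∫⁻ g, profile w z g ∂stdGauss p = ENNReal.ofReal (Real.exp z.1 * meanProfile w z.2) := by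
  have h1 := lintegral_profile_le hw (0, z.2)
  rw [ENNReal.ofReal_mul (Real.exp_nonneg _), meanProfile,
    ENNReal.ofReal_toReal (h1.trans_lt ENNReal.ofReal_lt_top).ne,
    ← lintegral_const_mul _ (measurable_profile_right w _)]
  exact lintegral_congr fun g => profile_eq_mul w z g

theorem meanProfile_pos {w : Fin p → ℝ} (hw : ∀ q, 0 ≤ w q) (g₀ : Fin p → ℝ) :
    0 < meanProfile w g₀ := by
  have h1 := lintegral_profile_le hw (0, g₀)
  refine ENNReal.toReal_pos (fun h => ?_) (h1.trans_lt ENNReal.ofReal_lt_top).ne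
  rw [lintegral_eq_zero_iff (measurable_profile_right w _)] at h
  obtain ⟨g, hg⟩ := h.exists
  rw [Pi.zero_apply, profile, ENNReal.ofReal_eq_zero] at hg
  have := Real.exp_pos (pairFun w (0, g₀) (0, g))
  linarith

theorem meanProfile_le {w : Fin p → ℝ} (hw : ∀ q, 0 ≤ w q) (g₀ : Fin p → ℝ) :
    meanProfile w g₀ ≤ 1 / 2 := by
  have h1 := lintegral_profile_le hw (0, g₀)
  rw [Real.exp_zero] at h1
  exact ENNReal.toReal_le_of_le_ofReal (by norm_num) h1

theorem measurable_meanProfile (w : Fin p → ℝ) : Measurable (meanProfile w) := by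
  have h1 : Measurable fun z : (Fin p → ℝ) × (Fin p → ℝ) => profile w (0, z.1) z.2 := by
    unfold profile pairFun
    fun_prop
  have h2 : Measurable fun g₀ : Fin p → ℝ => ∫⁻ g, profile w (0, g₀) g ∂stdGauss p :=
    Measurable.lintegral_prod_right' (ν := stdGauss p) h1
  unfold meanProfile
  exact h2.ennreal_toReal

/-- The scale of the Fréchet law of `topMass`. -/
noncomputable def topScale (w : Fin p → ℝ) : ℝ :=
  (∫⁻ g, ENNReal.ofReal (meanProfile w g / 2) ∂stdGauss p).toReal

theorem ofReal_topScale {w : Fin p → ℝ} (hw : ∀ q, 0 ≤ w q) :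
    ENNReal.ofReal (topScale w) = ∫⁻ g, ENNReal.ofReal (meanProfile w g / 2) ∂stdGauss p := by
  refine ENNReal.ofReal_toReal (ne_of_lt ?_)
  refine lt_of_le_of_lt (lintegral_mono (g := fun _ => 1) fun g => ?_) (by simp)
  rw [ENNReal.ofReal_le_one]
  linarith [meanProfile_le hw g]

theorem topScale_pos {w : Fin p → ℝ} (hw : ∀ q, 0 ≤ w q) : 0 < topScale w := by
  rw [← ENNReal.ofReal_pos, ofReal_topScale hw, pos_iff_ne_zero, Ne,
    lintegral_eq_zero_iff ((measurable_meanProfile w).div_const _).ennreal_ofReal]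
  intro h
  obtain ⟨g, hg⟩ := h.exists
  rw [Pi.zero_apply, ENNReal.ofReal_eq_zero] at hg
  linarith [meanProfile_pos hw g]

/-- The points whose profile has a mean above `y`. -/
def highPoints (w : Fin p → ℝ) (y : ℝ) : Set (ℝ × (Fin p → ℝ)) :=
  {z | y < Real.exp z.1 * meanProfile w z.2}

theorem measurableSet_highPoints (w : Fin p → ℝ) (y : ℝ) : MeasurableSet (highPoints w y) := by
  have h := measurable_meanProfile w
  exact measurableSet_lt measurable_const (by fun_prop)

/-- For a fixed mark `g` the condition is a half-line starting at `log (y / meanProfile w g)`, of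
measure `meanProfile w g / (2 y)`; the exponential intensity thus becomes a pure power of `y`. -/
theorem markedIntensity_highPoints {w : Fin p → ℝ} (hw : ∀ q, 0 ≤ w q) {y : ℝ} (hy : 0 < y) :
    markedIntensity p (highPoints w y) = ENNReal.ofReal (topScale w / y) := by
  have hm := measurable_meanProfile w
  rw [markedIntensity, Measure.prod_apply_symm (measurableSet_highPoints w y), div_eq_inv_mul,
    ENNReal.ofReal_mul (by positivity), ofReal_topScale hw,
    ← lintegral_const_mul _ (by fun_prop)]
  refine lintegral_congr fun g => ?_
  have hg := meanProfile_pos hw g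
  have h1 : (fun t : ℝ => (t, g)) ⁻¹' highPoints w y = Set.Ioi (Real.log (y / meanProfile w g)) := by
    ext t
    simp only [highPoints, Set.mem_preimage, Set.mem_ofPred_eq, Set.mem_Ioi]
    rw [Real.log_lt_iff_lt_exp (by positivity), div_lt_iff₀ hg]
  rw [h1]
  refine (halfExp_Ioi _).trans ?_
  rw [← ENNReal.ofReal_mul (by positivity), Real.exp_neg, Real.exp_log (by positivity)]
  congr 1
  field_simp

variable {Ω : Type*} [MeasurableSpace Ω] {P : Measure Ω} [IsProbabilityMeasure P]
  {Γ : ℕ → Ω → ℝ} {G : ℕ → Ω → Fin p → ℝ}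

/-- The largest of the means of the profiles of the points. -/
noncomputable def topMass (w : Fin p → ℝ) (Γ : ℕ → Ω → ℝ) (G : ℕ → Ω → Fin p → ℝ) (ω : Ω) :
    ENNReal :=
  ⨆ i, ∫⁻ g, profile w (Γ i ω, G i ω) g ∂stdGauss p

theorem topMass_le_totalMass (w : Fin p → ℝ) (Γ : ℕ → Ω → ℝ) (G : ℕ → Ω → Fin p → ℝ) (ω : Ω) :
    topMass w Γ G ω ≤ totalMass w Γ G ω :=
  iSup_le fun i => lintegral_mono fun _ => le_iSup (fun i => profile w (Γ i ω, G i ω) _) i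

theorem measurable_topMass {w : Fin p → ℝ} (hw : ∀ q, 0 ≤ w q)
    (hΓ : ∀ i, Measurable (Γ i)) (hG : ∀ i, Measurable (G i)) : Measurable (topMass w Γ G) := by
  refine Measurable.iSup fun i => ?_
  simp only [lintegral_profile hw]
  exact (((hΓ i).exp).mul ((measurable_meanProfile w).comp (hG i))).ennreal_ofReal

theorem measure_ne_zero_eq {N : Ω → Measure (ℝ × (Fin p → ℝ))}
    (hN : IsPoissonProcess P (markedIntensity p) N)
    {B : Set (ℝ × (Fin p → ℝ))} (hB : MeasurableSet B) (hfin : markedIntensity p B < ⊤) :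
    P {ω | N ω B ≠ 0} = ENNReal.ofReal (1 - Real.exp (-(markedIntensity p B).toReal)) := by
  have h1 : {ω | N ω B ≠ 0} = {ω | N ω B = 0}ᶜ := rfl
  have h2 : MeasurableSet {ω | N ω B = 0} :=
    hN.measurable_apply hB (measurableSet_singleton 0)
  rw [h1, measure_compl h2 (measure_ne_top _ _),
    hN.measure_eq_zero hB hfin, measure_univ, ENNReal.ofReal_sub _ (Real.exp_nonneg _),
    ENNReal.ofReal_one]

/-- The law of `topMass` is a Fréchet law. -/
theorem measure_lt_topMass {w : Fin p → ℝ} (hw : ∀ q, 0 ≤ w q)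
    (hN : IsPoissonProcess P (markedIntensity p) (pointMeasure Γ G)) {y : ℝ} (hy : 0 < y) :
    P {ω | ENNReal.ofReal y < topMass w Γ G ω} =
      ENNReal.ofReal (1 - Real.exp (-(topScale w / y))) := by
  have h1 := measure_ne_zero_eq hN (measurableSet_highPoints w y)
    (by rw [markedIntensity_highPoints hw hy]; exact ENNReal.ofReal_lt_top)
  rw [markedIntensity_highPoints hw hy,
    ENNReal.toReal_ofReal (div_nonneg (topScale_pos hw).le hy.le)] at h1
  rw [← h1]
  congr 1
  ext ω
  simp only [Set.mem_ofPred_eq, Ne, pointMeasure_eq_zero_iff Γ G ω (measurableSet_highPoints w y),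
    topMass, lt_iSup_iff, lintegral_profile hw]
  push Not
  refine exists_congr fun i => ?_
  rw [ENNReal.ofReal_lt_ofReal_iff_of_nonneg hy.le]
  rfl

/-- The total mass is at most half the exponential of the highest first coordinate. To exceed `y` it
needs a point above `log (2 y)`, an event of intensity `1 / (4 y)`. -/
theorem measure_lt_totalMass_le {w : Fin p → ℝ} (hw : ∀ q, 0 ≤ w q)
    (hN : IsPoissonProcess P (markedIntensity p) (pointMeasure Γ G)) {y : ℝ} (hy : 0 < y) :
    P {ω | ENNReal.ofReal y < totalMass w Γ G ω} ≤ ENNReal.ofReal (1 / (4 * y)) := by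
  have hB : MeasurableSet (Set.Ioi (Real.log (2 * y)) ×ˢ (Set.univ : Set (Fin p → ℝ))) :=
    measurableSet_Ioi.prod .univ
  have h1 := measure_ne_zero_eq hN hB (markedIntensity_Ioi_prod_lt_top p _ _)
  have h2 : (markedIntensity p (Set.Ioi (Real.log (2 * y)) ×ˢ (Set.univ : Set (Fin p → ℝ)))).toReal =
      1 / (4 * y) := by
    rw [markedIntensity_Ioi_prod, measure_univ, mul_one, ENNReal.toReal_ofReal (by positivity),
      Real.exp_neg, Real.exp_log (by positivity)]
    field_simp
    norm_num
  rw [h2] at h1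
  refine (measure_mono fun ω hω => ?_).trans (h1.le.trans (ENNReal.ofReal_le_ofReal ?_))
  · intro h0
    rw [pointMeasure_eq_zero_iff Γ G ω hB] at h0
    have h3 : ∀ i, Γ i ω ≤ Real.log (2 * y) := fun i => by
      by_contra hlt
      exact h0 i ⟨not_le.1 hlt, trivial⟩
    have h4 := totalMass_le hw (G := G) h3
    rw [Real.exp_log (by positivity), mul_div_cancel_left₀ _ two_ne_zero] at h4
    exact absurd hω (not_lt.2 h4)
  · have := Real.add_one_le_exp (-(1 / (4 * y)))
    linarith

theorem poissonMeasure_two_le (r : NNReal) :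
    poissonMeasure r {k | 2 ≤ k} ≤ ENNReal.ofReal ((r : ℝ) ^ 2) := by
  have h1 : ({k : ℕ | 2 ≤ k}) = ({0, 1} : Set ℕ)ᶜ := by
    ext k
    simp only [Set.mem_ofPred_eq, Set.mem_compl_iff, Set.mem_insert_iff, Set.mem_singleton_iff]
    omega
  have h2 : poissonMeasure r ({0, 1} : Set ℕ) = ENNReal.ofReal (Real.exp (-r) * (1 + r)) := by
    rw [show ({0, 1} : Set ℕ) = {0} ∪ {1} from rfl,
      measure_union (by simp) (measurableSet_singleton _), poissonMeasure_singleton,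
      poissonMeasure_singleton, ← ENNReal.ofReal_add (by positivity) (by positivity)]
    congr 1
    simp
    ring
  rw [h1, measure_compl (Set.toFinite _).measurableSet (measure_ne_top _ _), measure_univ, h2,
    ← ENNReal.ofReal_one, ← ENNReal.ofReal_sub _ (by positivity)]
  refine ENNReal.ofReal_le_ofReal ?_
  have h3 := Real.add_one_le_exp (-(r : ℝ))
  have h4 : (0 : ℝ) ≤ r := r.2
  nlinarith

theorem measure_two_le {S : Type*} [MeasurableSpace S] {Λ : Measure S} {N : Ω → Measure S}
    (hN : IsPoissonProcess P Λ N) {B : Set S} (hB : MeasurableSet B) (hfin : Λ B < ⊤) :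
    P {ω | 2 ≤ N ω B} ≤ ENNReal.ofReal ((Λ B).toReal ^ 2) := by
  have h1 := congrArg (fun m => m (Set.Ici 2)) (hN.law B hB hfin)
  beta_reduce at h1
  rw [Measure.map_apply (hN.measurable_apply hB) measurableSet_Ici,
    Measure.map_apply (by fun_prop) measurableSet_Ici] at h1
  have h2 : (fun k : ℕ => (k : ENNReal)) ⁻¹' Set.Ici 2 = {k | 2 ≤ k} := by
    ext k
    simp only [Set.mem_preimage, Set.mem_Ici, Set.mem_ofPred_eq]
    exact_mod_cast Iff.rfl
  rw [h2] at h1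
  exact h1.le.trans (poissonMeasure_two_le _)

theorem exists_forall_ne_le_of_lt_two {ω : Ω} {c : ℝ}
    (h : pointMeasure Γ G ω (Set.Ioi c ×ˢ Set.univ) < 2) : ∃ i, ∀ j, j ≠ i → Γ j ω ≤ c := by
  rw [pointMeasure_apply Γ G ω (measurableSet_Ioi.prod .univ)] at h
  by_contra hcon
  push Not at hcon
  obtain ⟨i, -, hi⟩ := hcon 0
  obtain ⟨j, hji, hj⟩ := hcon i
  have h1 := ENNReal.sum_le_tsum (f := fun i =>
    (Set.Ioi c ×ˢ (Set.univ : Set (Fin p → ℝ))).indicator (1 : ℝ × (Fin p → ℝ) → ENNReal)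
      (Γ i ω, G i ω)) {j, i}
  have hmem : ∀ k, c < Γ k ω → (Γ k ω, G k ω) ∈ Set.Ioi c ×ˢ (Set.univ : Set (Fin p → ℝ)) :=
    fun k hk => ⟨hk, trivial⟩
  rw [Finset.sum_pair hji, Set.indicator_of_mem (hmem j hj),
    Set.indicator_of_mem (hmem i hi)] at h1
  have h2 := h1.trans_lt h
  norm_num at h2

/-- With at most one point above `c`, every other profile is at most `e^c / 2`, so the supremum
exceeds the profile of the exceptional point by no more than that. -/
theorem totalMass_le_topMass_add {w : Fin p → ℝ} (hw : ∀ q, 0 ≤ w q) {ω : Ω} {c : ℝ}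
    (h : pointMeasure Γ G ω (Set.Ioi c ×ˢ Set.univ) < 2) :
    totalMass w Γ G ω ≤ topMass w Γ G ω + ENNReal.ofReal (Real.exp c / 2) := by
  obtain ⟨i, hi⟩ := exists_forall_ne_le_of_lt_two h
  have h1 : ∀ g, ⨆ j, profile w (Γ j ω, G j ω) g ≤
      profile w (Γ i ω, G i ω) g + ENNReal.ofReal (Real.exp c / 2) := fun g => by
    refine iSup_le fun j => ?_
    rcases eq_or_ne j i with rfl | hji
    · exact le_self_add
    · refine le_trans ((profile_le hw _ g).trans (ENNReal.ofReal_le_ofReal ?_)) le_add_self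
      have := Real.exp_le_exp.2 (hi j hji)
      simp only
      linarith
  refine (lintegral_mono h1).trans ?_
  rw [lintegral_add_right _ measurable_const, lintegral_const, measure_univ, mul_one]
  exact add_le_add_left (le_iSup (fun i => ∫⁻ g, profile w (Γ i ω, G i ω) g ∂stdGauss p) i) _

/-- The tail of the total mass is asymptotically at most that of `topMass`. -/
theorem exists_measure_lt_totalMass_le {w : Fin p → ℝ} (hw : ∀ q, 0 ≤ w q)
    (hN : IsPoissonProcess P (markedIntensity p) (pointMeasure Γ G)) {κ : ℝ} (hκ : topScale w < κ) :
    ∃ y₀ : ℝ, 0 < y₀ ∧ ∀ y, y₀ ≤ y →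
      P {ω | ENNReal.ofReal y < totalMass w Γ G ω} ≤ ENNReal.ofReal (κ / y) := by
  have hs := topScale_pos hw
  -- Split `y` into `(1 - η) y` for the dominant point and `η y` for all the others; `η` is small
  -- enough to keep the constant below `κ`.
  obtain ⟨η, hη, hη1, hηκ⟩ : ∃ η : ℝ, 0 < η ∧ η < 1 ∧ topScale w / (1 - η) < κ := by
    have h1 : Tendsto (fun η : ℝ => topScale w / (1 - η)) (𝓝[>] 0) (𝓝 (topScale w / (1 - 0))) :=
      (ContinuousAt.div (by fun_prop) (by fun_prop) (by simp)).tendsto.mono_left nhdsWithin_le_nhds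
    have h2 : ∀ᶠ η : ℝ in 𝓝[>] 0, η ∈ Set.Ioo (0 : ℝ) 1 := Ioo_mem_nhdsGT one_pos
    obtain ⟨η, h3, h4⟩ := ((h1.eventually_lt_const (by simpa using hκ)).and h2).exists
    exact ⟨η, h4.1, h4.2, h3⟩
  set δ := κ - topScale w / (1 - η) with hδ
  have hδ0 : 0 < δ := sub_pos.2 hηκ
  -- Two points above `log (2 η y)`, a level whose points contribute `η y`, occur with probability
  -- at most `(1 / (4 η y))²`. Beyond this threshold that is at most `δ / y`.
  refine ⟨(4 * η)⁻¹ ^ 2 / δ, by positivity, fun y hy => ?_⟩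
  have hy0 : 0 < y := lt_of_lt_of_le (by positivity) hy
  have hB : MeasurableSet (Set.Ioi (Real.log (2 * η * y)) ×ˢ (Set.univ : Set (Fin p → ℝ))) :=
    measurableSet_Ioi.prod .univ
  have h1 := measure_two_le hN hB (markedIntensity_Ioi_prod_lt_top p _ _)
  have h2 : (markedIntensity p
      (Set.Ioi (Real.log (2 * η * y)) ×ˢ (Set.univ : Set (Fin p → ℝ)))).toReal =
      (4 * η)⁻¹ / y := by
    rw [markedIntensity_Ioi_prod, measure_univ, mul_one, ENNReal.toReal_ofReal (by positivity),
      Real.exp_neg, Real.exp_log (by positivity)]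
    field_simp
    norm_num
  rw [h2] at h1
  have hη1' : 0 < 1 - η := by linarith
  have h3 := measure_lt_topMass hw hN (y := (1 - η) * y) (by positivity)
  have h4 : {ω | ENNReal.ofReal y < totalMass w Γ G ω} ⊆
      {ω | 2 ≤ pointMeasure Γ G ω (Set.Ioi (Real.log (2 * η * y)) ×ˢ Set.univ)} ∪
        {ω | ENNReal.ofReal ((1 - η) * y) < topMass w Γ G ω} := fun ω hω => by
    by_contra hcon
    rw [Set.mem_union, not_or] at hcon
    have h5 := totalMass_le_topMass_add hw (not_le.1 hcon.1)
    have h6 : topMass w Γ G ω ≤ ENNReal.ofReal ((1 - η) * y) := not_lt.1 hcon.2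
    have h7 := h5.trans (add_le_add_left h6 _)
    rw [Real.exp_log (by positivity), ← ENNReal.ofReal_add (by positivity) (by positivity),
      show (1 - η) * y + 2 * η * y / 2 = y by ring] at h7
    exact absurd hω (not_lt.2 h7)
  refine (measure_mono h4).trans ((measure_union_le _ _).trans ?_)
  refine (add_le_add h1 h3.le).trans ?_
  have h8 : (0 : ℝ) ≤ 1 - Real.exp (-(topScale w / ((1 - η) * y))) := by
    rw [sub_nonneg, Real.exp_le_one_iff, Left.neg_nonpos_iff]
    positivity
  rw [← ENNReal.ofReal_add (by positivity) h8]
  refine ENNReal.ofReal_le_ofReal ?_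
  have h9 := Real.add_one_le_exp (-(topScale w / ((1 - η) * y)))
  have h10 : topScale w / ((1 - η) * y) = topScale w / (1 - η) / y := by rw [div_div]
  have h11 : ((4 * η)⁻¹ / y) ^ 2 ≤ δ / y := by
    rw [div_pow, div_le_div_iff₀ (by positivity) hy0]
    rw [div_le_iff₀ hδ0] at hy
    nlinarith
  have h12 : κ / y = topScale w / (1 - η) / y + δ / y := by rw [hδ]; ring
  linarith

end TopMass

/-! ### Strict inequality between the two masses. -/

section Strict

variable {p : ℕ} {Ω : Type*} [MeasurableSpace Ω] {P : Measure Ω} [IsProbabilityMeasure P]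
  {Γ : ℕ → Ω → ℝ} {G : ℕ → Ω → Fin p → ℝ}

/-- The intensity over a set of marks of positive measure is infinite when the level goes to `-∞`,
so the void probabilities tend to zero. -/
theorem ae_exists_mark_mem (hN : IsPoissonProcess P (markedIntensity p) (pointMeasure Γ G))
    {H : Set (Fin p → ℝ)} (hH : MeasurableSet H) (h0 : stdGauss p H ≠ 0) :
    ∀ᵐ ω ∂P, ∃ i, G i ω ∈ H := by
  have h1 : 0 < (stdGauss p H).toReal := ENNReal.toReal_pos h0 (measure_ne_top _ _)
  have h2 : ∀ k : ℕ, P {ω | ¬ ∃ i, G i ω ∈ H} ≤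
      ENNReal.ofReal (Real.exp (-(Real.exp k / 2 * (stdGauss p H).toReal))) := fun k => by
    have hB : MeasurableSet (Set.Ioi (-(k : ℝ)) ×ˢ H) := measurableSet_Ioi.prod hH
    have h3 := hN.measure_eq_zero hB (markedIntensity_Ioi_prod_lt_top p _ _)
    rw [markedIntensity_Ioi_prod, neg_neg, ENNReal.toReal_mul,
      ENNReal.toReal_ofReal (by positivity)] at h3
    rw [← h3]
    refine measure_mono fun ω hω => ?_
    rw [Set.mem_ofPred_eq, pointMeasure_eq_zero_iff Γ G ω hB]
    exact fun i hi => hω ⟨i, hi.2⟩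
  have h4 : Tendsto (fun k : ℕ =>
      ENNReal.ofReal (Real.exp (-(Real.exp k / 2 * (stdGauss p H).toReal)))) atTop (𝓝 0) := by
    have h5 : Tendsto (fun k : ℕ => Real.exp k / 2 * (stdGauss p H).toReal) atTop atTop :=
      ((Real.tendsto_exp_atTop.comp tendsto_natCast_atTop_atTop).atTop_div_const
        two_pos).atTop_mul_const h1
    have h6 := ENNReal.tendsto_ofReal (Real.tendsto_exp_neg_atTop_nhds_zero.comp h5)
    simpa [Function.comp_def] using h6
  exact le_antisymm (ge_of_tendsto' h4 h2) zero_le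

theorem pairFun_sub_pairFun (w : Fin p → ℝ) (z z' : ℝ × (Fin p → ℝ)) (g : Fin p → ℝ) :
    pairFun w z' (0, g) - pairFun w z (0, g) =
      pairFun w z' (0, 0) - pairFun w z (0, 0) + 1 / 2 * ∑ q, w q * (z'.2 q - z.2 q) * g q := by
  have h1 : ∑ q, w q * (z'.2 q - g q) ^ 2 - ∑ q, w q * (z.2 q - g q) ^ 2 =
      ∑ q, w q * (z'.2 q - 0) ^ 2 - ∑ q, w q * (z.2 q - 0) ^ 2 -
        2 * ∑ q, w q * (z'.2 q - z.2 q) * g q := by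
    rw [Finset.mul_sum, ← Finset.sum_sub_distrib, ← Finset.sum_sub_distrib,
      ← Finset.sum_sub_distrib]
    exact Finset.sum_congr rfl fun q _ => by ring
  unfold pairFun
  simp only [Pi.zero_apply]
  linear_combination (-1 / 4 : ℝ) * h1

/-- The quadratic terms in `g` cancel, so the difference is affine in `g`, with nonzero gradient
when the marks differ. The witness moves along `z'.2 - z.2` until the difference equals one. -/
theorem exists_pairFun_lt {w : Fin p → ℝ} (hw : ∀ q, 0 < w q) {z z' : ℝ × (Fin p → ℝ)}
    (hne : z.2 ≠ z'.2) : ∃ g, pairFun w z (0, g) < pairFun w z' (0, g) := by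
  set S : ℝ := ∑ q, w q * (z'.2 q - z.2 q) ^ 2 with hS
  have hS0 : 0 < S := by
    obtain ⟨q, hq⟩ := Function.ne_iff.1 hne
    refine Finset.sum_pos' (fun q _ => mul_nonneg (hw q).le (sq_nonneg _)) ⟨q, Finset.mem_univ q, ?_⟩
    have : z'.2 q - z.2 q ≠ 0 := sub_ne_zero.2 (Ne.symm hq)
    have := hw q
    positivity
  set c := pairFun w z' (0, 0) - pairFun w z (0, 0)
  refine ⟨fun q => 2 * (1 - c) / S * (z'.2 q - z.2 q), ?_⟩
  rw [← sub_pos, pairFun_sub_pairFun]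
  have h1 : ∑ q, w q * (z'.2 q - z.2 q) * (2 * (1 - c) / S * (z'.2 q - z.2 q)) =
      2 * (1 - c) / S * S := by
    conv_rhs => rw [hS, Finset.mul_sum]
    exact Finset.sum_congr rfl fun q _ => by ring
  rw [h1, div_mul_cancel₀ _ hS0.ne']
  have : c + 1 / 2 * (2 * (1 - c)) = 1 := by ring
  rw [this]
  exact one_pos

theorem lintegral_profile_lt {w : Fin p → ℝ} (hw : ∀ q, 0 < w q) {z z' : ℝ × (Fin p → ℝ)}
    (hne : z.2 ≠ z'.2) :
    ∫⁻ g, profile w z g ∂stdGauss p < ∫⁻ g, max (profile w z g) (profile w z' g) ∂stdGauss p := by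
  have hw' : ∀ q, 0 ≤ w q := fun q => (hw q).le
  have hc : ∀ z : ℝ × (Fin p → ℝ), Continuous fun g : Fin p → ℝ => pairFun w z (0, g) := fun z =>
    (continuous_pairFun w).comp (continuous_const.prodMk (continuous_const.prodMk continuous_id))
  have hopen : IsOpen {g | pairFun w z (0, g) < pairFun w z' (0, g)} := isOpen_lt (hc z) (hc z')
  obtain ⟨g₀, hg₀⟩ := exists_pairFun_lt hw hne
  refine lintegral_strict_mono_of_ae_le_of_ae_lt_on
    ((measurable_profile_right w z).max (measurable_profile_right w z')).aemeasurable
    ((lintegral_profile_le hw' z).trans_lt ENNReal.ofReal_lt_top).ne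
    (Eventually.of_forall fun g => le_max_left _ _)
    (hopen.measure_ne_zero (stdGauss p) ⟨g₀, hg₀⟩) (Eventually.of_forall fun g hg => ?_)
  rw [lt_max_iff]
  right
  have h1 := Real.exp_lt_exp.2 (show pairFun w z (0, g) < pairFun w z' (0, g) from hg)
  exact (ENNReal.ofReal_lt_ofReal_iff (by positivity)).2 (by linarith)

/-- The mean of a profile is `e^γ` times a factor at most `1 / 2`. On a logarithmic scale it is the
first coordinate lowered by a nonnegative amount, so only finitely many points compete at any level.
-/
theorem exists_forall_lintegral_profile_le {w : Fin p → ℝ} (hw : ∀ q, 0 ≤ w q)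
    {z : ℕ → ℝ × (Fin p → ℝ)} (hz : ∀ c, {i | c < (z i).1}.Finite) :
    ∃ i, ∀ j, ∫⁻ g, profile w (z j) g ∂stdGauss p ≤ ∫⁻ g, profile w (z i) g ∂stdGauss p := by
  have h1 : ∀ c, {i | c < (z i).1 + Real.log (meanProfile w (z i).2)}.Finite := fun c => by
    refine (hz c).subset fun i hi => ?_
    have h2 : Real.log (meanProfile w (z i).2) ≤ 0 :=
      Real.log_nonpos (meanProfile_pos hw _).le ((meanProfile_le hw _).trans (by norm_num))
    simp only [Set.mem_ofPred_eq] at hi ⊢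
    linarith
  obtain ⟨⟨i, hi⟩, hmax⟩ := isGreatest_iSup_of_finite_above h1
  refine ⟨i, fun j => ?_⟩
  have h3 := hmax ⟨j, rfl⟩
  rw [← hi] at h3
  rw [lintegral_profile hw, lintegral_profile hw]
  refine ENNReal.ofReal_le_ofReal ?_
  have h4 := Real.exp_le_exp.2 h3
  rwa [Real.exp_add, Real.exp_add, Real.exp_log (meanProfile_pos hw _),
    Real.exp_log (meanProfile_pos hw _)] at h4

/-- Marks occur in both open half-spaces of a coordinate, which exists because `p ≥ 1`, so some
point has a mark other than that of the dominant one. Its profile is larger on a nonempty open set,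
and the Gaussian law charges open sets. -/
theorem ae_topMass_lt_totalMass (hp : 1 ≤ p) {w : Fin p → ℝ} (hw : ∀ q, 0 < w q)
    (hN : IsPoissonProcess P (markedIntensity p) (pointMeasure Γ G)) :
    ∀ᵐ ω ∂P, topMass w Γ G ω < totalMass w Γ G ω := by
  set q₀ : Fin p := ⟨0, hp⟩
  have ho1 : IsOpen {g : Fin p → ℝ | 0 < g q₀} := isOpen_lt continuous_const (continuous_apply q₀)
  have ho2 : IsOpen {g : Fin p → ℝ | g q₀ < 0} := isOpen_lt (continuous_apply q₀) continuous_const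
  have h1 := ae_exists_mark_mem hN ho1.measurableSet
    (ho1.measure_ne_zero (stdGauss p) ⟨fun _ => 1, show (0 : ℝ) < 1 from one_pos⟩)
  have h2 := ae_exists_mark_mem hN ho2.measurableSet
    (ho2.measure_ne_zero (stdGauss p) ⟨fun _ => -1, show (-1 : ℝ) < 0 from neg_one_lt_zero⟩)
  filter_upwards [h1, h2, ae_finite_above hN] with ω ⟨j, hj⟩ ⟨k, hk⟩ hfin
  obtain ⟨i, hi⟩ := exists_forall_lintegral_profile_le (fun q => (hw q).le)
    (z := fun i => (Γ i ω, G i ω)) hfin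
  obtain ⟨l, hl⟩ : ∃ l, G i ω ≠ G l ω := by
    by_contra hcon
    push Not at hcon
    have h3 : 0 < G i ω q₀ := by rw [hcon j]; exact hj
    have h4 : G i ω q₀ < 0 := by rw [hcon k]; exact hk
    exact lt_asymm h3 h4
  calc topMass w Γ G ω ≤ ∫⁻ g, profile w (Γ i ω, G i ω) g ∂stdGauss p := iSup_le hi
    _ < ∫⁻ g, max (profile w (Γ i ω, G i ω) g) (profile w (Γ l ω, G l ω) g) ∂stdGauss p :=
      lintegral_profile_lt hw hl
    _ ≤ totalMass w Γ G ω := lintegral_mono fun g =>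
      max_le (le_iSup (fun i => profile w (Γ i ω, G i ω) g) i)
        (le_iSup (fun i => profile w (Γ i ω, G i ω) g) l)

end Strict

/-! ### Tails of order `1 / t` and their Laplace transforms. -/

section LaplaceTail

/-- The complement to one of the Laplace transform at `s` of a positive law with tail `τ`. -/
noncomputable def laplaceTail (τ : ℝ → ENNReal) (s : ℝ) : ENNReal :=
  ∫⁻ t in Set.Ioi (0 : ℝ), τ t * ENNReal.ofReal (s * Real.exp (-(s * t)))

theorem lintegral_one_sub_exp_eq_laplaceTail {Ω : Type*} [MeasurableSpace Ω] {μ : Measure Ω}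
    {f : Ω → ℝ} (hf : AEMeasurable f μ) (h0 : ∀ ω, 0 ≤ f ω) {s : ℝ} (hs : 0 < s) :
    ∫⁻ ω, ENNReal.ofReal (1 - Real.exp (-(s * f ω))) ∂μ =
      laplaceTail (fun t => μ {ω | t < f ω}) s := by
  have hint : ∀ a b : ℝ, IntervalIntegrable (fun t => s * Real.exp (-(s * t))) volume a b :=
    fun a b => (by fun_prop : Continuous fun t => s * Real.exp (-(s * t))).intervalIntegrable a b
  have h1 := lintegral_comp_eq_lintegral_meas_lt_mul μ (Eventually.of_forall h0) hf
    (g := fun t => s * Real.exp (-(s * t))) (fun t _ => hint 0 t)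
    (Eventually.of_forall fun t => by positivity)
  rw [laplaceTail, ← h1]
  refine lintegral_congr fun ω => ?_
  congr 1
  rw [intervalIntegral.integral_eq_sub_of_hasDerivAt (f := fun t => -Real.exp (-(s * t)))
    (fun t _ => ?_) (hint 0 _)]
  · simp
    ring
  · have h2 : HasDerivAt (fun t => -(s * t)) (-s) t := by
      simpa only [mul_one] using ((hasDerivAt_id' t).const_mul s).fun_neg
    have h3 := h2.exp.fun_neg
    rwa [mul_neg, neg_neg, mul_comm] at h3

theorem laplaceTail_mono {τ τ' : ℝ → ENNReal} (h : ∀ t, 0 < t → τ t ≤ τ' t) (s : ℝ) :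
    laplaceTail τ s ≤ laplaceTail τ' s :=
  setLIntegral_mono' measurableSet_Ioi fun t ht => mul_le_mul_left (h t ht) _

theorem lintegral_Ioi_mul_exp {s : ℝ} (hs : 0 < s) :
    ∫⁻ t in Set.Ioi (0 : ℝ), ENNReal.ofReal (s * Real.exp (-(s * t))) = 1 := by
  have h1 : IntegrableOn (fun t => s * Real.exp (-(s * t))) (Set.Ioi 0) := by
    have h2 := (exp_neg_integrableOn_Ioi 0 hs).const_mul s
    simp only [neg_mul] at h2
    exact h2
  rw [← ofReal_integral_eq_lintegral_ofReal h1 (Eventually.of_forall fun t => by positivity),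
    integral_const_mul]
  have h3 := integral_exp_mul_Ioi (a := -s) (by linarith) 0
  simp only [neg_mul] at h3
  rw [h3]
  simp [hs.ne']

theorem lintegral_Ioc_inv {a b : ℝ} (ha : 0 < a) (hab : a ≤ b) :
    ∫⁻ t in Set.Ioc a b, ENNReal.ofReal (1 / t) = ENNReal.ofReal (Real.log (b / a)) := by
  have h1 : IntervalIntegrable (fun t : ℝ => 1 / t) volume a b := by
    refine intervalIntegral.intervalIntegrable_one_div (fun x hx => ?_) continuousOn_id
    rw [Set.uIcc_of_le hab] at hx
    exact (ha.trans_le hx.1).ne'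
  rw [← integral_one_div_of_pos ha (ha.trans_le hab), intervalIntegral.integral_of_le hab,
    ofReal_integral_eq_lintegral_ofReal h1.1]
  refine (ae_restrict_iff' measurableSet_Ioc).2 (Eventually.of_forall fun t ht => ?_)
  exact one_div_nonneg.2 (ha.trans ht.1).le

theorem lintegral_Ioi_inv_mul_exp_ge {a s : ℝ} (ha : 0 < a) (hs : 0 < s) (hsa : a ≤ 1 / s) :
    ENNReal.ofReal (s * Real.exp (-1) * Real.log (1 / s / a)) ≤
      ∫⁻ t in Set.Ioi a, ENNReal.ofReal (1 / t) * ENNReal.ofReal (s * Real.exp (-(s * t))) := by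
  rw [ENNReal.ofReal_mul (by positivity), ← lintegral_Ioc_inv ha hsa,
    ← lintegral_const_mul _ (by fun_prop)]
  refine le_trans ?_ (lintegral_mono_set (s := Set.Ioc a (1 / s)) Set.Ioc_subset_Ioi_self)
  refine setLIntegral_mono' measurableSet_Ioc fun t ht => ?_
  rw [mul_comm]
  refine mul_le_mul_right (ENNReal.ofReal_le_ofReal ?_) _
  have h3 : s * t ≤ 1 := by
    have := (le_div_iff₀ hs).1 ht.2
    linarith
  have h4 : Real.exp (-1) ≤ Real.exp (-(s * t)) := Real.exp_le_exp.2 (by linarith)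
  gcongr

/-- On `(a, 1/s]` the exponential is at least `e^{-1}`, and the integral of `1/t` there produces the
logarithm. This logarithm is the extra factor `x` in the tail `x e^{-x}`. -/
theorem laplaceTail_ge {τ : ℝ → ENNReal} {a c : ℝ} (ha : 0 < a) (hc : 0 ≤ c)
    (hτ : ∀ t, a ≤ t → ENNReal.ofReal (c / t) ≤ τ t) {s : ℝ} (hs : 0 < s) (hsa : a ≤ 1 / s) :
    ENNReal.ofReal (c * (s * Real.exp (-1) * Real.log (1 / s / a))) ≤ laplaceTail τ s := by
  rw [ENNReal.ofReal_mul hc]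
  refine (mul_le_mul_right (lintegral_Ioi_inv_mul_exp_ge ha hs hsa) _).trans ?_
  rw [← lintegral_const_mul _ (by fun_prop)]
  refine le_trans ?_ (lintegral_mono_set (Set.Ioi_subset_Ioi ha.le))
  refine setLIntegral_mono' measurableSet_Ioi fun t ht => ?_
  rw [← mul_assoc, ← ENNReal.ofReal_mul hc, mul_one_div]
  exact mul_le_mul_left (hτ t (le_of_lt ht)) _

/-- Cut at `1` and at `1 / s`: the tail is bounded by one on the first piece, by `1 / t` on the
second and by `s` on the third. The contributions are `s`, `s log (1/s)` and `s`. -/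
theorem laplaceTail_le {τ : ℝ → ENNReal} (h1 : ∀ t, τ t ≤ 1)
    (hτ : ∀ t, 0 < t → τ t ≤ ENNReal.ofReal (1 / t)) {s : ℝ} (hs : 0 < s) (hs1 : s ≤ 1) :
    laplaceTail τ s ≤ ENNReal.ofReal (s * (2 + Real.log (1 / s))) := by
  have hs1' : 1 ≤ 1 / s := (one_le_div hs).2 hs1
  have hlog := Real.log_nonneg hs1'
  have hle : ∀ t, 0 < t → Real.exp (-(s * t)) ≤ 1 := fun t ht => by
    rw [Real.exp_le_one_iff]
    have := mul_pos hs ht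
    linarith
  have hcov : Set.Ioi (0 : ℝ) ⊆ Set.Ioc 0 1 ∪ (Set.Ioc 1 (1 / s) ∪ Set.Ioi (1 / s)) := fun t ht => by
    rcases le_or_gt t 1 with h | h
    · exact Or.inl ⟨ht, h⟩
    · rcases le_or_gt t (1 / s) with h' | h'
      · exact Or.inr (Or.inl ⟨h, h'⟩)
      · exact Or.inr (Or.inr h')
  have e1 : ∫⁻ t in Set.Ioc (0 : ℝ) 1, τ t * ENNReal.ofReal (s * Real.exp (-(s * t))) ≤
      ENNReal.ofReal s := by
    refine (setLIntegral_mono' (g := fun _ => ENNReal.ofReal s) measurableSet_Ioc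
      fun t ht => ?_).trans (by simp)
    refine (mul_le_of_le_one_left zero_le (h1 t)).trans (ENNReal.ofReal_le_ofReal ?_)
    exact mul_le_of_le_one_right hs.le (hle t ht.1)
  have e2 : ∫⁻ t in Set.Ioc (1 : ℝ) (1 / s), τ t * ENNReal.ofReal (s * Real.exp (-(s * t))) ≤
      ENNReal.ofReal (s * Real.log (1 / s)) := by
    have h3 := lintegral_Ioc_inv one_pos hs1'
    rw [div_one] at h3
    rw [ENNReal.ofReal_mul hs.le, ← h3, ← lintegral_const_mul _ (by fun_prop)]
    refine setLIntegral_mono' measurableSet_Ioc fun t ht => ?_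
    have ht0 : (0 : ℝ) < t := one_pos.trans ht.1
    rw [mul_comm (ENNReal.ofReal s)]
    exact mul_le_mul' (hτ t ht0)
      (ENNReal.ofReal_le_ofReal (mul_le_of_le_one_right hs.le (hle t ht0)))
  have e3 : ∫⁻ t in Set.Ioi (1 / s), τ t * ENNReal.ofReal (s * Real.exp (-(s * t))) ≤
      ENNReal.ofReal s := by
    have h3 := lintegral_Ioi_mul_exp hs
    calc _ ≤ ∫⁻ t in Set.Ioi (1 / s), ENNReal.ofReal s * ENNReal.ofReal (s * Real.exp (-(s * t))) := by
          refine setLIntegral_mono' measurableSet_Ioi fun t ht => mul_le_mul_left ?_ _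
          have ht' : 1 / s < t := ht
          have ht0 : 0 < t := lt_trans (by positivity) ht'
          refine (hτ t ht0).trans (ENNReal.ofReal_le_ofReal ?_)
          rw [div_le_iff₀ ht0]
          rw [div_lt_iff₀ hs] at ht'
          linarith
      _ ≤ ∫⁻ t in Set.Ioi (0 : ℝ), ENNReal.ofReal s * ENNReal.ofReal (s * Real.exp (-(s * t))) :=
          lintegral_mono_set (Set.Ioi_subset_Ioi (by positivity))
      _ = ENNReal.ofReal s := by
          rw [lintegral_const_mul _ (by fun_prop), h3, mul_one]
  refine (lintegral_mono_set hcov).trans ((lintegral_union_le _ _ _).trans ?_)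
  refine (add_le_add e1 ((lintegral_union_le _ _ _).trans (add_le_add e2 e3))).trans ?_
  rw [← ENNReal.ofReal_add (by positivity) hs.le, ← ENNReal.ofReal_add hs.le (by positivity)]
  exact ENNReal.ofReal_le_ofReal (by nlinarith)

theorem one_sub_exp_neg_ge {y : ℝ} (hy : 0 ≤ y) : y / (1 + y) ≤ 1 - Real.exp (-y) := by
  have h1 := Real.add_one_le_exp y
  have h2 : Real.exp (-y) ≤ 1 / (1 + y) := by
    rw [Real.exp_neg, ← one_div]
    exact one_div_le_one_div_of_le (by linarith) (by linarith)
  have h3 : y / (1 + y) = 1 - 1 / (1 + y) := by field_simp; ring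
  linarith

/-- Laplace transforms distinguish tails with different constants at infinity. -/
theorem exists_laplaceTail_lt_laplaceTail {τ τ' : ℝ → ENNReal} {t₀ κ κ' : ℝ} (ht₀ : 0 < t₀)
    (hκ : 0 ≤ κ) (hκκ' : κ < κ') (h1 : ∀ t, τ t ≤ 1)
    (hτ : ∀ t, t₀ ≤ t → τ t ≤ ENNReal.ofReal (κ / t))
    (hτ' : ∀ t, t₀ ≤ t → ENNReal.ofReal (κ' / t) ≤ τ' t) :
    ∃ s : ℝ, 0 < s ∧ laplaceTail τ s < laplaceTail τ' s := by
  have hδ : 0 < κ' - κ := sub_pos.2 hκκ'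
  -- At `s = 1 / (t₀ e^L)` the part of `τ` on `(0, t₀]`, where nothing but `τ ≤ 1` is known, costs
  -- at most `s t₀`; the larger constant gains at least `(κ' - κ) s e^{-1} L` beyond `t₀`. A large
  -- `L` decides.
  obtain ⟨L, hL0, hL⟩ : ∃ L : ℝ, 0 < L ∧ t₀ < (κ' - κ) * (Real.exp (-1) * L) := by
    refine ⟨2 * t₀ / ((κ' - κ) * Real.exp (-1)), by positivity, ?_⟩
    field_simp
    linarith
  set s : ℝ := 1 / (t₀ * Real.exp L) with hs
  have hs0 : 0 < s := by positivity
  have hst : t₀ ≤ 1 / s := by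
    rw [hs, one_div_one_div]
    exact le_mul_of_one_le_right ht₀.le (Real.one_le_exp hL0.le)
  have hlogs : Real.log (1 / s / t₀) = L := by
    rw [hs, one_div_one_div, mul_div_cancel_left₀ _ ht₀.ne', Real.log_exp]
  refine ⟨s, hs0, ?_⟩
  set K : ℝ → ENNReal := fun t => ENNReal.ofReal (s * Real.exp (-(s * t))) with hK
  have hKm : Measurable K := by fun_prop
  have hsplit : ∀ σ : ℝ → ENNReal, laplaceTail σ s =
      (∫⁻ t in Set.Ioc 0 t₀, σ t * K t) + ∫⁻ t in Set.Ioi t₀, σ t * K t := fun σ => by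
    rw [laplaceTail, ← Set.Ioc_union_Ioi_eq_Ioi ht₀.le,
      lintegral_union measurableSet_Ioi (Set.Ioc_disjoint_Ioi le_rfl)]
  set I : ENNReal := ∫⁻ t in Set.Ioi t₀, ENNReal.ofReal (1 / t) * K t with hI
  have hmul : ∀ c : ℝ, 0 ≤ c →
      ∫⁻ t in Set.Ioi t₀, ENNReal.ofReal (c / t) * K t = ENNReal.ofReal c * I := fun c hc => by
    rw [hI, ← lintegral_const_mul _ (by fun_prop)]
    refine lintegral_congr fun t => ?_
    rw [← mul_assoc, ← ENNReal.ofReal_mul hc, mul_one_div]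
  have hIfin : I < ⊤ := by
    refine lt_of_le_of_lt (b := ENNReal.ofReal (1 / t₀) * 1) ?_
      (ENNReal.mul_lt_top ENNReal.ofReal_lt_top ENNReal.one_lt_top)
    rw [← lintegral_Ioi_mul_exp hs0, ← lintegral_const_mul _ (by fun_prop)]
    refine le_trans ?_ (lintegral_mono_set (Set.Ioi_subset_Ioi ht₀.le))
    refine setLIntegral_mono' measurableSet_Ioi fun t ht => mul_le_mul_left ?_ _
    exact ENNReal.ofReal_le_ofReal (one_div_le_one_div_of_le ht₀ (le_of_lt ht))
  have hIlow : ENNReal.ofReal (s * Real.exp (-1) * L) ≤ I := by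
    have h2 := lintegral_Ioi_inv_mul_exp_ge ht₀ hs0 hst
    rwa [hlogs] at h2
  have hup : laplaceTail τ s ≤ ENNReal.ofReal (s * t₀) + ENNReal.ofReal κ * I := by
    rw [hsplit, ← hmul κ hκ]
    refine add_le_add ?_ (setLIntegral_mono' measurableSet_Ioi fun t ht =>
      mul_le_mul_left (hτ t (le_of_lt ht)) _)
    refine (setLIntegral_mono' (g := fun _ => ENNReal.ofReal s) measurableSet_Ioc
      fun t ht => ?_).trans ?_
    · refine (mul_le_of_le_one_left zero_le (h1 t)).trans (ENNReal.ofReal_le_ofReal ?_)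
      refine mul_le_of_le_one_right hs0.le ?_
      rw [Real.exp_le_one_iff]
      have := mul_pos hs0 ht.1
      linarith
    · rw [setLIntegral_const, Real.volume_Ioc, sub_zero, ENNReal.ofReal_mul hs0.le]
  have hlow : ENNReal.ofReal κ' * I ≤ laplaceTail τ' s := by
    rw [hsplit, ← hmul κ' (hκ.trans hκκ'.le)]
    refine le_add_left (setLIntegral_mono' measurableSet_Ioi fun t ht =>
      mul_le_mul_left (hτ' t (le_of_lt ht)) _)
  refine lt_of_le_of_lt hup (lt_of_lt_of_le ?_ hlow)
  have hκ'eq : ENNReal.ofReal κ' = ENNReal.ofReal (κ' - κ) + ENNReal.ofReal κ := by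
    rw [← ENNReal.ofReal_add hδ.le hκ, sub_add_cancel]
  rw [hκ'eq, add_mul]
  refine ENNReal.add_lt_add_right (ENNReal.mul_lt_top ENNReal.ofReal_lt_top hIfin).ne ?_
  refine lt_of_lt_of_le ?_ (mul_le_mul_right hIlow _)
  rw [← ENNReal.ofReal_mul hδ.le]
  refine (ENNReal.ofReal_lt_ofReal_iff (by positivity)).2 ?_
  nlinarith

end LaplaceTail

/-! ### Tails and convolutions of Gumbel laws. -/

section Gumbel

variable {ν : Measure ℝ} [IsProbabilityMeasure ν] {m β : ℝ}

theorem gumbel_Ioi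
    (h : ∀ x, ν (Set.Iic x) = ENNReal.ofReal (Real.exp (-Real.exp (-((x - m) / β))))) (x : ℝ) :
    ν (Set.Ioi x) = ENNReal.ofReal (1 - Real.exp (-Real.exp (-((x - m) / β)))) := by
  rw [← Set.compl_Iic, measure_compl measurableSet_Iic (measure_ne_top _ _), measure_univ, h,
    ENNReal.ofReal_sub _ (Real.exp_nonneg _), ENNReal.ofReal_one]

theorem gumbel_Ioi_le
    (h : ∀ x, ν (Set.Iic x) = ENNReal.ofReal (Real.exp (-Real.exp (-((x - m) / β))))) (x : ℝ) :
    ν (Set.Ioi x) ≤ ENNReal.ofReal (Real.exp (-((x - m) / β))) := by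
  rw [gumbel_Ioi h]
  refine ENNReal.ofReal_le_ofReal ?_
  have := Real.add_one_le_exp (-Real.exp (-((x - m) / β)))
  linarith

theorem gumbel_Ioi_le_exp (hβ : 0 < β) (hβ1 : β ≤ 1)
    (h : ∀ x, ν (Set.Iic x) = ENNReal.ofReal (Real.exp (-Real.exp (-((x - m) / β))))) (x : ℝ) :
    ν (Set.Ioi x) ≤ ENNReal.ofReal (Real.exp (m - x)) := by
  rcases le_total m x with hx | hx
  · refine (gumbel_Ioi_le h x).trans (ENNReal.ofReal_le_ofReal (Real.exp_le_exp.2 ?_))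
    have : x - m ≤ (x - m) / β := le_div_self (by linarith) hβ hβ1
    linarith
  · refine prob_le_one.trans ?_
    rw [ENNReal.one_le_ofReal, Real.one_le_exp_iff]
    linarith

theorem le_gumbel_Ioi (hβ : 0 < β)
    (h : ∀ x, ν (Set.Iic x) = ENNReal.ofReal (Real.exp (-Real.exp (-((x - m) / β))))) {x : ℝ}
    (hx : m ≤ x) :
    ENNReal.ofReal (Real.exp (-((x - m) / β)) / 2) ≤ ν (Set.Ioi x) := by
  rw [gumbel_Ioi h]
  refine ENNReal.ofReal_le_ofReal ?_
  set y := Real.exp (-((x - m) / β))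
  have hy0 : 0 < y := Real.exp_pos _
  have hy1 : y ≤ 1 := by
    rw [Real.exp_le_one_iff, Left.neg_nonpos_iff]
    exact div_nonneg (by linarith) hβ.le
  refine le_trans ?_ (one_sub_exp_neg_ge hy0.le)
  exact div_le_div_of_nonneg_left hy0.le (by linarith) (by linarith)

theorem gumbel_Ioi_pos
    (h : ∀ x, ν (Set.Iic x) = ENNReal.ofReal (Real.exp (-Real.exp (-((x - m) / β))))) (x : ℝ) :
    0 < (ν (Set.Ioi x)).toReal := by
  refine ENNReal.toReal_pos ?_ (measure_ne_top _ _)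
  rw [gumbel_Ioi h, Ne, ENNReal.ofReal_eq_zero, not_le, sub_pos, Real.exp_lt_one_iff, neg_lt_zero]
  exact Real.exp_pos _

/-- The exponential of such a variable has a tail at most a multiple of `t^{-1/β}`, integrable at
infinity because `β < 1`. -/
theorem lintegral_exp_gumbel_lt_top (hβ : 0 < β) (hβ1 : β < 1)
    (h : ∀ x, ν (Set.Iic x) = ENNReal.ofReal (Real.exp (-Real.exp (-((x - m) / β))))) :
    ∫⁻ y, ENNReal.ofReal (Real.exp y) ∂ν < ⊤ := by
  rw [lintegral_eq_lintegral_meas_lt ν (Eventually.of_forall fun y => (Real.exp_pos y).le)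
    Real.measurable_exp.aemeasurable, ← Set.Ioc_union_Ioi_eq_Ioi zero_le_one,
    lintegral_union measurableSet_Ioi (Set.Ioc_disjoint_Ioi le_rfl)]
  refine ENNReal.add_lt_top.2 ⟨?_, ?_⟩
  · refine lt_of_le_of_lt (lintegral_mono (g := fun _ => 1) fun t => prob_le_one) ?_
    simp
  · have h1 : IntegrableOn (fun t : ℝ => Real.exp (m / β) * t ^ (-(1 / β))) (Set.Ioi 1) :=
      (integrableOn_Ioi_rpow_of_lt (by
        rw [neg_lt_neg_iff]; exact (one_lt_div hβ).2 hβ1) one_pos).const_mul _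
    refine lt_of_le_of_lt ?_ h1.lintegral_lt_top
    refine setLIntegral_mono' measurableSet_Ioi fun t ht => ?_
    have ht0 : (0 : ℝ) < t := one_pos.trans ht
    have h2 : {a : ℝ | t < Real.exp a} = Set.Ioi (Real.log t) := by
      ext a
      exact (Real.log_lt_iff_lt_exp ht0).symm
    rw [h2]
    refine (gumbel_Ioi_le h _).trans (ENNReal.ofReal_le_ofReal (le_of_eq ?_))
    rw [Real.rpow_def_of_pos ht0, ← Real.exp_add]
    congr 1
    field_simp
    ring

theorem conv_Ioi (ν₁ ν₂ : Measure ℝ) [IsProbabilityMeasure ν₁] [IsProbabilityMeasure ν₂] (x : ℝ) :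
    (Measure.conv ν₁ ν₂) (Set.Ioi x) = ∫⁻ y, ν₁ (Set.Ioi (x - y)) ∂ν₂ := by
  have hm : Measurable fun z : ℝ × ℝ => z.1 + z.2 := by fun_prop
  rw [Measure.conv, Measure.map_apply hm measurableSet_Ioi,
    Measure.prod_apply_symm (hm measurableSet_Ioi)]
  refine lintegral_congr fun y => ?_
  congr 1
  ext t
  simp only [Set.mem_preimage, Set.mem_Ioi, sub_lt_iff_lt_add]

/-- The tail of the sum of two independent Gumbel variables of scale one. -/
theorem conv_gumbel_Ioi {ν₁ ν₂ : Measure ℝ} [IsProbabilityMeasure ν₁] [IsProbabilityMeasure ν₂]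
    {m₁ m₂ : ℝ}
    (h₁ : ∀ x, ν₁ (Set.Iic x) = ENNReal.ofReal (Real.exp (-Real.exp (-((x - m₁) / 1)))))
    (h₂ : ∀ x, ν₂ (Set.Iic x) = ENNReal.ofReal (Real.exp (-Real.exp (-((x - m₂) / 1))))) (x : ℝ) :
    (Measure.conv ν₁ ν₂) (Set.Ioi x) =
      laplaceTail (fun t => ENNReal.ofReal (1 - Real.exp (-(Real.exp (m₁ + m₂) / t))))
        (Real.exp (-x)) := by
  rw [conv_Ioi]
  have h3 := lintegral_one_sub_exp_eq_laplaceTail (μ := ν₂) (f := fun y => Real.exp (y + m₁))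
    (by fun_prop) (fun y => Real.exp_nonneg _) (Real.exp_pos (-x))
  have h4 : ∀ t, 0 < t → ν₂ {y | t < Real.exp (y + m₁)} =
      ENNReal.ofReal (1 - Real.exp (-(Real.exp (m₁ + m₂) / t))) := fun t ht => by
    have h5 : {y : ℝ | t < Real.exp (y + m₁)} = Set.Ioi (Real.log t - m₁) := by
      ext y
      rw [Set.mem_ofPred_eq, ← Real.log_lt_iff_lt_exp ht, Set.mem_Ioi, sub_lt_iff_lt_add]
    rw [h5, gumbel_Ioi h₂]
    congr 4
    rw [show -((Real.log t - m₁ - m₂) / 1) = m₁ + m₂ - Real.log t by ring, Real.exp_sub,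
      Real.exp_log ht]
  refine Eq.trans (lintegral_congr fun y => ?_) (h3.trans (le_antisymm
    (laplaceTail_mono (fun t ht => (h4 t ht).le) _) (laplaceTail_mono (fun t ht => (h4 t ht).ge) _)))
  rw [gumbel_Ioi h₁]
  congr 3
  rw [← Real.exp_add]
  congr 2
  ring

end Gumbel

/-! ### Exclusion of Gumbel laws and of their sums. -/

section NotGumbel

variable {F : ℝ → ENNReal}

theorem not_le_exp_neg {c : ℝ} (hc : 0 < c)
    (hF : ∀ x, 0 ≤ x → ENNReal.ofReal (c * (Real.exp (-x) * x)) ≤ F x) (C : ℝ) :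
    ¬ ∀ x, F x ≤ ENNReal.ofReal (C * Real.exp (-x)) := by
  intro h
  set x := |C| / c + 1 with hx
  have hx0 : 0 < x := by positivity
  have hex := Real.exp_pos (-x)
  have h1 := (ENNReal.ofReal_le_ofReal_iff').1 ((hF x hx0.le).trans (h x))
  rcases h1 with h1 | h1
  · have h2 : c * x ≤ C := by
      have : (c * x) * Real.exp (-x) ≤ C * Real.exp (-x) := by linarith
      exact le_of_mul_le_mul_right this hex
    have h3 : c * x = |C| + c := by rw [hx]; field_simp
    linarith [le_abs_self C]
  · have : 0 < c * (Real.exp (-x) * x) := by positivity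
    linarith

theorem not_exp_neg_le (hF : ∀ x, 0 ≤ x → F x ≤ ENNReal.ofReal (Real.exp (-x) * (2 + x)))
    {q θ x₀ : ℝ} (hq : 0 < q) (hθ : θ < 1) :
    ¬ ∀ x, x₀ ≤ x → ENNReal.ofReal (q * Real.exp (-(θ * x))) ≤ F x := by
  intro h
  set k := q * (1 - θ) ^ 2 / 2 with hk
  have hθ' : 0 < 1 - θ := by linarith
  have hk0 : 0 < k := by positivity
  obtain ⟨x, hx1, hx2, hx3⟩ : ∃ x, x₀ ≤ x ∧ 1 ≤ x ∧ 3 / k < x :=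
    ⟨max x₀ (max 1 (3 / k + 1)), le_max_left _ _, (le_max_left _ _).trans (le_max_right _ _),
      lt_of_lt_of_le (lt_add_one _) ((le_max_right _ _).trans (le_max_right _ _))⟩
  have hx0 : 0 < x := by linarith
  have h1 := (ENNReal.ofReal_le_ofReal_iff (by positivity)).1 ((h x hx1).trans (hF x hx0.le))
  have h2 : q * Real.exp ((1 - θ) * x) ≤ 2 + x := by
    have h3 := mul_le_mul_of_nonneg_left h1 (Real.exp_nonneg x)
    have h4 : Real.exp x * (q * Real.exp (-(θ * x))) = q * Real.exp ((1 - θ) * x) := by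
      rw [mul_left_comm, ← Real.exp_add]
      congr 2
      ring
    have h5 : Real.exp x * (Real.exp (-x) * (2 + x)) = 2 + x := by
      rw [← mul_assoc, ← Real.exp_add, add_neg_cancel, Real.exp_zero, one_mul]
    rwa [h4, h5] at h3
  have h6 := Real.quadratic_le_exp_of_nonneg (mul_pos hθ' hx0).le
  have h7 : k * x ^ 2 ≤ 2 + x := by
    refine le_trans ?_ h2
    have : k * x ^ 2 = q * (((1 - θ) * x) ^ 2 / 2) := by rw [hk]; ring
    rw [this]
    refine mul_le_mul_of_nonneg_left ?_ hq.le
    have := mul_pos hθ' hx0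
    linarith
  rw [div_lt_iff₀ hk0] at hx3
  nlinarith

/-- A scale at most one gives a tail `O(e^{-x})`, too light by the factor `x`; a scale above one
gives a tail of order `e^{-x/β}`, too heavy. -/
theorem not_isGumbelLaw_of_tail {ν : Measure ℝ} {c : ℝ} (hc : 0 < c)
    (hlow : ∀ x, 0 ≤ x → ENNReal.ofReal (c * (Real.exp (-x) * x)) ≤ ν (Set.Ioi x))
    (hup : ∀ x, 0 ≤ x → ν (Set.Ioi x) ≤ ENNReal.ofReal (Real.exp (-x) * (2 + x))) :
    ¬ IsGumbelLaw ν := by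
  rintro ⟨hp, m, β, hβ, h⟩
  rcases le_or_gt β 1 with hβ1 | hβ1
  · refine not_le_exp_neg hc hlow (Real.exp m) fun x => ?_
    rw [← Real.exp_add]
    exact gumbel_Ioi_le_exp hβ hβ1 h x
  · refine not_exp_neg_le hup (q := Real.exp (m / β) / 2) (θ := 1 / β) (x₀ := m) (by positivity)
      ((div_lt_one hβ).2 hβ1) fun x hx => ?_
    refine le_trans (le_of_eq ?_) (le_gumbel_Ioi hβ h hx)
    congr 1
    rw [div_mul_eq_mul_div, ← Real.exp_add]
    congr 2
    ring

theorem le_conv_gumbel_Ioi {ν₁ ν₂ : Measure ℝ} [IsProbabilityMeasure ν₁] [IsProbabilityMeasure ν₂]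
    {m β : ℝ} (hβ : 0 < β)
    (h : ∀ x, ν₁ (Set.Iic x) = ENNReal.ofReal (Real.exp (-Real.exp (-((x - m) / β))))) {x : ℝ}
    (hx : m ≤ x) :
    ENNReal.ofReal ((ν₂ (Set.Ioi 0)).toReal * (Real.exp (m / β) / 2) * Real.exp (-(1 / β * x))) ≤
      (Measure.conv ν₁ ν₂) (Set.Ioi x) := by
  rw [conv_Ioi]
  calc _ = ∫⁻ _ in Set.Ioi (0 : ℝ), ENNReal.ofReal (Real.exp (-((x - m) / β)) / 2) ∂ν₂ := by
        rw [setLIntegral_const, mul_assoc, ENNReal.ofReal_mul ENNReal.toReal_nonneg,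
          ENNReal.ofReal_toReal (measure_ne_top _ _), mul_comm]
        congr 2
        rw [div_mul_eq_mul_div, ← Real.exp_add]
        congr 2
        ring
    _ ≤ ∫⁻ y in Set.Ioi (0 : ℝ), ν₁ (Set.Ioi (x - y)) ∂ν₂ := by
        refine setLIntegral_mono' measurableSet_Ioi fun y hy => ?_
        refine (le_gumbel_Ioi hβ h hx).trans (measure_mono (Set.Ioi_subset_Ioi ?_))
        linarith [show (0 : ℝ) < y from hy]
    _ ≤ _ := setLIntegral_le_lintegral _ _

/-- Conditioning on the second summand shifts the exponential bound of the first one; a finite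
exponential moment keeps the average of order `e^{-x}`, without a logarithmic correction. -/
theorem conv_gumbel_Ioi_le {ν₁ ν₂ : Measure ℝ} [IsProbabilityMeasure ν₁] [IsProbabilityMeasure ν₂]
    {m β : ℝ} (hβ : 0 < β) (hβ1 : β ≤ 1)
    (h : ∀ x, ν₁ (Set.Iic x) = ENNReal.ofReal (Real.exp (-Real.exp (-((x - m) / β)))))
    (hfin : ∫⁻ y, ENNReal.ofReal (Real.exp y) ∂ν₂ < ⊤) (x : ℝ) :
    (Measure.conv ν₁ ν₂) (Set.Ioi x) ≤ ENNReal.ofReal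
      (Real.exp m * (∫⁻ y, ENNReal.ofReal (Real.exp y) ∂ν₂).toReal * Real.exp (-x)) := by
  rw [conv_Ioi, mul_right_comm, ENNReal.ofReal_mul (by positivity), ENNReal.ofReal_toReal hfin.ne,
    ← lintegral_const_mul _ (by fun_prop)]
  refine lintegral_mono fun y => (gumbel_Ioi_le_exp hβ hβ1 h _).trans (le_of_eq ?_)
  rw [← ENNReal.ofReal_mul (by positivity), ← Real.exp_add, ← Real.exp_add]
  congr 2
  ring

/-- A scale above one makes the sum too heavy. If one scale is below one and the other at most one,
the sum is `O(e^{-x})`, too light. Up to exchange of the summands, only two unit scales remain. -/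
theorem ne_conv_gumbel_of_scale {ν ν₁ ν₂ : Measure ℝ} [IsProbabilityMeasure ν₁]
    [IsProbabilityMeasure ν₂] {c : ℝ} (hc : 0 < c)
    (hlow : ∀ x, 0 ≤ x → ENNReal.ofReal (c * (Real.exp (-x) * x)) ≤ ν (Set.Ioi x))
    (hup : ∀ x, 0 ≤ x → ν (Set.Ioi x) ≤ ENNReal.ofReal (Real.exp (-x) * (2 + x)))
    {m₁ β₁ m₂ β₂ : ℝ} (hβ₁ : 0 < β₁) (hβ₂ : 0 < β₂)
    (h₁ : ∀ x, ν₁ (Set.Iic x) = ENNReal.ofReal (Real.exp (-Real.exp (-((x - m₁) / β₁)))))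
    (h₂ : ∀ x, ν₂ (Set.Iic x) = ENNReal.ofReal (Real.exp (-Real.exp (-((x - m₂) / β₂)))))
    (hβ : 1 < β₁ ∨ β₁ ≤ 1 ∧ β₂ < 1) : ν ≠ Measure.conv ν₁ ν₂ := by
  rintro rfl
  rcases hβ with hβ | ⟨hβ, hβ'⟩
  · have := gumbel_Ioi_pos h₂ 0
    exact not_exp_neg_le hup (q := (ν₂ (Set.Ioi 0)).toReal * (Real.exp (m₁ / β₁) / 2))
      (θ := 1 / β₁) (x₀ := m₁) (by positivity) ((div_lt_one hβ₁).2 hβ)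
      fun x hx => le_conv_gumbel_Ioi hβ₁ h₁ hx
  · exact not_le_exp_neg hc hlow _
      (conv_gumbel_Ioi_le hβ₁ hβ h₁ (lintegral_exp_gumbel_lt_top hβ₂ hβ' h₂))

/-- A law whose tail is the complement of a Laplace transform with the tail of a Fréchet law, but
strictly larger, is not the law of the sum of two independent Gumbel variables. -/
theorem ne_conv_of_laplaceTail {ν : Measure ℝ} {τ : ℝ → ENNReal} {c κ : ℝ} (hc : 0 < c)
    (hlow : ∀ x, 0 ≤ x → ENNReal.ofReal (c * (Real.exp (-x) * x)) ≤ ν (Set.Ioi x))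
    (hup : ∀ x, 0 ≤ x → ν (Set.Ioi x) ≤ ENNReal.ofReal (Real.exp (-x) * (2 + x)))
    (hν : ∀ x, ν (Set.Ioi x) = laplaceTail τ (Real.exp (-x))) (hκ : 0 < κ) (h1 : ∀ t, τ t ≤ 1)
    (hτ : ∀ κ', κ < κ' → ∃ t₀ : ℝ, 0 < t₀ ∧ ∀ t, t₀ ≤ t → τ t ≤ ENNReal.ofReal (κ' / t))
    (hstrict : ∀ s, 0 < s →
      laplaceTail (fun t => ENNReal.ofReal (1 - Real.exp (-(κ / t)))) s < laplaceTail τ s)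
    {ν₁ ν₂ : Measure ℝ} (h₁ : IsGumbelLaw ν₁) (h₂ : IsGumbelLaw ν₂) : ν ≠ Measure.conv ν₁ ν₂ := by
  obtain ⟨hp₁, m₁, β₁, hβ₁, h₁⟩ := h₁
  obtain ⟨hp₂, m₂, β₂, hβ₂, h₂⟩ := h₂
  have hcase1 := ne_conv_gumbel_of_scale hc hlow hup hβ₁ hβ₂ h₁ h₂
  have hcase2 := ne_conv_gumbel_of_scale hc hlow hup hβ₂ hβ₁ h₂ h₁
  rw [Measure.conv_comm] at hcase2
  by_cases hc1 : 1 < β₁ ∨ β₁ ≤ 1 ∧ β₂ < 1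
  · exact hcase1 hc1
  by_cases hc2 : 1 < β₂ ∨ β₂ ≤ 1 ∧ β₁ < 1
  · exact hcase2 hc2
  have hb : β₁ = 1 ∧ β₂ = 1 := by
    push Not at hc1 hc2
    exact ⟨le_antisymm hc1.1 (hc2.2 hc2.1), le_antisymm hc2.1 (hc1.2 hc1.1)⟩
  obtain ⟨rfl, rfl⟩ := hb
  rintro rfl
  have h3 : ∀ s, 0 < s → laplaceTail τ s =
      laplaceTail (fun t => ENNReal.ofReal (1 - Real.exp (-(Real.exp (m₁ + m₂) / t)))) s := by
    intro s hs
    have h4 := hν (-Real.log s)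
    rw [conv_gumbel_Ioi h₁ h₂, neg_neg, Real.exp_log hs] at h4
    exact h4.symm
  set κ' := Real.exp (m₁ + m₂) with hκ'
  -- A Fréchet tail of scale `κ' ≤ κ` lies below that of scale `κ`, whose transform is already
  -- strictly smaller than that of `τ`. If `κ' > κ`, the constants at infinity differ, in the
  -- opposite direction.
  rcases le_or_gt κ' κ with hle | hlt
  · refine absurd (hstrict 1 one_pos) (not_lt.2 ?_)
    rw [h3 1 one_pos]
    refine laplaceTail_mono (fun t ht => ENNReal.ofReal_le_ofReal ?_) 1
    have h5 : κ' / t ≤ κ / t := by gcongr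
    have h6 : Real.exp (-(κ / t)) ≤ Real.exp (-(κ' / t)) := Real.exp_le_exp.2 (by linarith)
    linarith
  · obtain ⟨κ₁, hκ₁, hκ₁'⟩ := exists_between hlt
    obtain ⟨κ₂, hκ₂, hκ₂'⟩ := exists_between hκ₁'
    obtain ⟨t₀, ht₀, hτ₀⟩ := hτ κ₁ hκ₁
    have hκ₂0 : 0 < κ₂ := by linarith
    -- Beyond `t₁` the lower bound `κ' / (t + κ')` of the Fréchet tail is at least `κ₂ / t`.
    set t₁ := κ₂ * κ' / (κ' - κ₂) with ht₁
    have hsub : 0 < κ' - κ₂ := by linarith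
    have hκ'0 : 0 < κ' := Real.exp_pos _
    obtain ⟨s, hs, hlt'⟩ := exists_laplaceTail_lt_laplaceTail (τ := τ)
      (τ' := fun t => ENNReal.ofReal (1 - Real.exp (-(κ' / t)))) (t₀ := max t₀ t₁) (κ := κ₁)
      (κ' := κ₂) (ht₀.trans_le (le_max_left _ _)) (by linarith) hκ₂ h1
      (fun t ht => hτ₀ t ((le_max_left _ _).trans ht)) (fun t ht => by
        have ht1 : t₁ ≤ t := (le_max_right _ _).trans ht
        have ht0 : 0 < t := ht₀.trans_le ((le_max_left _ _).trans ht)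
        refine ENNReal.ofReal_le_ofReal (le_trans ?_ (one_sub_exp_neg_ge (by positivity)))
        have h5 : κ' / t / (1 + κ' / t) = κ' / (t + κ') := by field_simp
        rw [h5, div_le_div_iff₀ ht0 (by positivity)]
        rw [ht₁, div_le_iff₀ hsub] at ht1
        linarith)
    exact hlt'.ne (h3 s hs)

end NotGumbel

/-! ### The law of the limit, and the theorem. -/

section Conclusion

variable {p : ℕ} {Ω : Type*} [MeasurableSpace Ω] {P : Measure Ω} [IsProbabilityMeasure P]
  {Γp Γm : ℕ → Ω → ℝ} {Gp Gm : ℕ → Ω → Fin p → ℝ}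

theorem measure_lt_toReal_congr {Z : Ω → ENNReal} (hZ : ∀ᵐ ω ∂P, Z ω < ⊤) {t : ℝ} (ht : 0 ≤ t) :
    P {ω | t < (Z ω).toReal} = P {ω | ENNReal.ofReal t < Z ω} := by
  refine measure_congr ?_
  filter_upwards [hZ] with ω hω
  exact propext (ENNReal.ofReal_lt_iff_lt_toReal ht hω.ne).symm

/-- Everything is read off the tail `τ` of the total mass: the Fréchet law of the dominant mass
bounds it below, the highest point bounds it above, and the almost sure gap between the two masses
makes the transforms strictly ordered. -/
theorem not_gumbel_iSup_pairFun (hp : 1 ≤ p) {w : Fin p → ℝ} (hw : ∀ q, 0 < w q)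
    (hΓp : ∀ i, Measurable (Γp i)) (hΓm : ∀ i, Measurable (Γm i))
    (hGp : ∀ i, Measurable (Gp i)) (hGm : ∀ i, Measurable (Gm i))
    (hNp : IsPoissonProcess P (markedIntensity p) (pointMeasure Γp Gp))
    (hNm : IsPoissonProcess P (markedIntensity p) (pointMeasure Γm Gm))
    (hN : IndepFun (pointMeasure Γp Gp) (pointMeasure Γm Gm) P) {D : Ω → ℝ}
    (hD : D = fun ω => ⨆ ij : ℕ × ℕ, pairFun w (Γp ij.1 ω, Gp ij.1 ω) (Γm ij.2 ω, Gm ij.2 ω)) :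
    ¬ IsGumbelLaw (P.map D) ∧ ∀ ν₁ ν₂ : Measure ℝ, IsGumbelLaw ν₁ → IsGumbelLaw ν₂ →
      P.map D ≠ Measure.conv ν₁ ν₂ := by
  have hw' : ∀ q, 0 ≤ w q := fun q => (hw q).le
  have hDm : Measurable D := hD ▸ measurable_iSup_pairFun hΓp hΓm hGp hGm
  have hZm := (measurable_totalMass w hΓp hGp).ennreal_toReal
  have hZfin := ae_totalMass_lt_top hw' hNp
  have hlt := ae_topMass_lt_totalMass hp hw hNp
  have hMm := (measurable_topMass hw' hΓp hGp).ennreal_toReal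
  have hMfin : ∀ᵐ ω ∂P, topMass w Γp Gp ω < ⊤ := by
    filter_upwards [hlt, hZfin] with ω h1 h2 using h1.trans h2
  have hκ := topScale_pos hw'
  set τ : ℝ → ENNReal := fun t => P {ω | t < (totalMass w Γp Gp ω).toReal} with hτdef
  have hτ0 : ∀ t, 0 < t → τ t = P {ω | ENNReal.ofReal t < totalMass w Γp Gp ω} := fun t ht =>
    measure_lt_toReal_congr hZfin ht.le
  have hM0 : ∀ t, 0 < t → P {ω | t < (topMass w Γp Gp ω).toReal} =
      ENNReal.ofReal (1 - Real.exp (-(topScale w / t))) := fun t ht =>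
    (measure_lt_toReal_congr hMfin ht.le).trans (measure_lt_topMass hw' hNp ht)
  have h1 : ∀ t, τ t ≤ 1 := fun t => prob_le_one
  have hMτ : ∀ t, 0 < t → ENNReal.ofReal (1 - Real.exp (-(topScale w / t))) ≤ τ t := fun t ht => by
    rw [hτ0 t ht, ← measure_lt_topMass hw' hNp ht]
    exact measure_mono fun ω hω => lt_of_lt_of_le hω (topMass_le_totalMass w Γp Gp ω)
  have hν : ∀ x, P.map D (Set.Ioi x) = laplaceTail τ (Real.exp (-x)) := fun x => by
    rw [Measure.map_apply hDm measurableSet_Ioi, hD]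
    refine (measure_lt_iSup_pairFun hw' hΓp hΓm hGp hGm hNp hNm hN x).trans ?_
    exact lintegral_one_sub_exp_eq_laplaceTail hZm.aemeasurable (fun _ => ENNReal.toReal_nonneg)
      (Real.exp_pos _)
  have hlog : ∀ x : ℝ, 1 / Real.exp (-x) = Real.exp x := fun x => by
    rw [Real.exp_neg, one_div, inv_inv]
  have hlow : ∀ x, 0 ≤ x → ENNReal.ofReal (topScale w / (1 + topScale w) * (Real.exp (-1)) *
      (Real.exp (-x) * x)) ≤ P.map D (Set.Ioi x) := fun x hx => by
    have h2 := laplaceTail_ge (τ := τ) (a := 1) (c := topScale w / (1 + topScale w)) one_pos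
      (by positivity) (fun t ht => by
        have ht0 : 0 < t := by linarith
        refine le_trans (ENNReal.ofReal_le_ofReal ?_) (hMτ t ht0)
        refine le_trans ?_ (one_sub_exp_neg_ge (by positivity))
        have h5 : topScale w / t / (1 + topScale w / t) = topScale w / (t + topScale w) := by
          field_simp
        rw [h5, div_div]
        exact div_le_div_of_nonneg_left hκ.le (by positivity) (by nlinarith))
      (Real.exp_pos (-x)) (by rw [hlog]; exact Real.one_le_exp hx)
    rw [hν, div_one, hlog, Real.log_exp] at *
    refine le_trans (le_of_eq ?_) h2
    congr 1
    ring
  have hup : ∀ x, 0 ≤ x → P.map D (Set.Ioi x) ≤ ENNReal.ofReal (Real.exp (-x) * (2 + x)) :=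
    fun x hx => by
    have h2 := laplaceTail_le h1 (fun t ht => by
      rw [hτ0 t ht]
      refine (measure_lt_totalMass_le hw' hNp ht).trans (ENNReal.ofReal_le_ofReal ?_)
      exact one_div_le_one_div_of_le ht (by linarith)) (Real.exp_pos (-x)) (by
        rw [Real.exp_le_one_iff]; linarith)
    rwa [hlog, Real.log_exp, ← hν] at h2
  have hc : 0 < topScale w / (1 + topScale w) * Real.exp (-1) := by positivity
  refine ⟨not_isGumbelLaw_of_tail hc hlow hup, fun ν₁ ν₂ h₁ h₂ => ?_⟩
  refine ne_conv_of_laplaceTail hc hlow hup hν hκ h1 (fun κ' hκ' => ?_) (fun s hs => ?_) h₁ h₂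
  · obtain ⟨t₀, ht₀, h2⟩ := exists_measure_lt_totalMass_le hw' hNp hκ'
    exact ⟨t₀, ht₀, fun t ht => by rw [hτ0 t (ht₀.trans_le ht)]; exact h2 t ht⟩
  · have e1 : laplaceTail (fun t => ENNReal.ofReal (1 - Real.exp (-(topScale w / t)))) s =
        ∫⁻ ω, ENNReal.ofReal (1 - Real.exp (-(s * (topMass w Γp Gp ω).toReal))) ∂P := by
      rw [lintegral_one_sub_exp_eq_laplaceTail hMm.aemeasurable (fun _ => ENNReal.toReal_nonneg) hs]
      exact le_antisymm (laplaceTail_mono (fun t ht => (hM0 t ht).ge) s)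
        (laplaceTail_mono (fun t ht => (hM0 t ht).le) s)
    rw [e1, ← lintegral_one_sub_exp_eq_laplaceTail hZm.aemeasurable
      (fun _ => ENNReal.toReal_nonneg) hs]
    have hlt' : ∀ᵐ ω ∂P, ENNReal.ofReal (1 - Real.exp (-(s * (topMass w Γp Gp ω).toReal))) <
        ENNReal.ofReal (1 - Real.exp (-(s * (totalMass w Γp Gp ω).toReal))) := by
      filter_upwards [hlt, hZfin] with ω h2 h3
      have h4 : (topMass w Γp Gp ω).toReal < (totalMass w Γp Gp ω).toReal :=
        ENNReal.toReal_strict_mono h3.ne h2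
      have h5 : 0 ≤ (topMass w Γp Gp ω).toReal := ENNReal.toReal_nonneg
      have h6 : s * (topMass w Γp Gp ω).toReal < s * (totalMass w Γp Gp ω).toReal := by gcongr
      have h7 := Real.exp_lt_exp.2 (neg_lt_neg h6)
      refine (ENNReal.ofReal_lt_ofReal_iff ?_).2 (by linarith)
      rw [sub_pos, Real.exp_lt_one_iff, neg_lt_zero]
      exact mul_pos hs (h5.trans_lt h4)
    refine lintegral_strict_mono (IsProbabilityMeasure.ne_zero P)
      (((hZm.const_mul s).neg.exp).const_sub 1).ennreal_ofReal.aemeasurable (ne_of_lt ?_) hlt'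
    refine lt_of_le_of_lt (lintegral_mono (g := fun _ => 1) fun ω => ?_) (by simp)
    rw [ENNReal.ofReal_le_one]
    linarith [Real.exp_pos (-(s * (topMass w Γp Gp ω).toReal))]

end Conclusion

theorem mainTheorem2
    -- the dimension is `d = p + 1 ≥ 2`
    (p : ℕ) (hp : 1 ≤ p)
    (A : Matrix (Fin (p + 1)) (Fin (p + 1)) ℝ) (hA : IsUnit A.det)
    (hlam : orderedEigenvalues A 1 < orderedEigenvalues A 0)
    -- the elliptical vector `T A W`
    {Ω₀ : Type*} [MeasurableSpace Ω₀] (P₀ : Measure Ω₀) [IsProbabilityMeasure P₀]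
    (T : Ω₀ → ℝ) (W : Ω₀ → EuclideanSpace ℝ (Fin (p + 1)))
    (hT : Measurable T) (hTpos : ∀ᵐ ω ∂P₀, 0 < T ω)
    (hW : HasLaw W (uniformSphere (p + 1)) P₀) (hTW : IndepFun T W P₀)
    (ψ : ℝ → ℝ) (hψ : IsGumbelAuxiliary P₀ T ψ)
    -- the i.i.d. sample
    {Ω : Type*} [MeasurableSpace Ω] (P : Measure Ω) [IsProbabilityMeasure P]
    (X : ℕ → Ω → EuclideanSpace ℝ (Fin (p + 1)))
    (hXindep : iIndepFun X P)
    (hXlaw : ∀ i, IdentDistrib (X i) (ellipticalVector A T W) P P₀)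
    -- the normalizing sequences
    (a b : ℕ → ℝ)
    (ha : Tendsto (fun n : ℕ => (n : ℝ) * P₀.real {ω | a n < ‖ellipticalVector A T W ω‖})
      atTop (𝓝 1))
    (hb : ∀ n, b n = √(orderedEigenvalues A 0) * ψ (a n / √(orderedEigenvalues A 0)))
    -- the points of the two independent Poisson processes
    {Ω' : Type*} [MeasurableSpace Ω'] (P' : Measure Ω') [IsProbabilityMeasure P']
    (Γp Γm : ℕ → Ω' → ℝ) (Gp Gm : ℕ → Ω' → Fin p → ℝ)
    (hΓp : ∀ i, Measurable (Γp i)) (hΓm : ∀ i, Measurable (Γm i))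
    (hGp : ∀ i, Measurable (Gp i)) (hGm : ∀ i, Measurable (Gm i))
    (hNp : IsPoissonProcess P' (markedIntensity p) (pointMeasure Γp Gp))
    (hNm : IsPoissonProcess P' (markedIntensity p) (pointMeasure Γm Gm))
    (hN : IndepFun (pointMeasure Γp Gp) (pointMeasure Γm Gm) P')
    -- the limiting random variable
    (D : Ω' → ℝ)
    (hD : ∀ ω, D ω = ⨆ ij : ℕ × ℕ, pairValue (orderedEigenvalues A) Γp Γm Gp Gm ω ij) :
    (∀ᵐ ω ∂P', IsGreatest
      (Set.range (pairValue (orderedEigenvalues A) Γp Γm Gp Gm ω)) (D ω)) ∧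
    TendstoInDistribution (fun (n : ℕ) ω => (cloudDiam X n ω - 2 * a n) / b n) atTop D
      (fun _ => P) P' ∧
    ¬ IsGumbelLaw (P'.map D) ∧
    (∀ ν₁ ν₂ : Measure ℝ, IsGumbelLaw ν₁ → IsGumbelLaw ν₂ →
      P'.map D ≠ Measure.conv ν₁ ν₂) := by
  have hlam' : ∀ q : Fin p, orderedEigenvalues A q.succ < orderedEigenvalues A 0 := fun q => by
    refine lt_of_le_of_lt (orderedEigenvalues_antitone A ?_) hlam
    -- In `Fin (p + 1)` the numeral `1` is taken modulo `p + 1`, so `p ≥ 1` is needed for it to be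
    -- the second index.
    rw [Fin.le_def, Fin.val_succ, Fin.val_one', Nat.mod_eq_of_lt (by omega)]
    omega
  have hw := gapWeight_pos hA hlam'
  have hDeq : D = fun ω => ⨆ ij : ℕ × ℕ, pairFun (gapWeight (orderedEigenvalues A))
      (Γp ij.1 ω, Gp ij.1 ω) (Γm ij.2 ω, Gm ij.2 ω) := funext fun ω => hD ω
  refine ⟨?_, ?_, not_gumbel_iSup_pairFun hp hw hΓp hΓm hGp hGm hNp hNm hN hDeq⟩
  · filter_upwards [ae_isGreatest_pairFun (fun q => (hw q).le) hNp hNm] with ω hω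
    rw [hDeq]
    exact hω
  · rw [hDeq]
    exact tendstoInDistribution_cloudDiam hA hlam' hT hTpos hW hTW hψ hXindep hXlaw ha hb
      hΓp hΓm hGp hGm hNp hNm hN
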